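/- Let $T$ be an infinite spherically symmetric tree with root $\rho$: every vertex at distance $j$ from $\rho$ has the same finite number $d_j$ of children. Let $T_n$ be the set of vertices at distance $n$ from $\rho$, and let the edges from level $n-1$ to level $n$ have edge probability $p_n$, where $0<\inf_{n\ge1} p_n\le\sup_{n\ge1} p_n<1$. Let $w_n=\mathbf E[W_n]$, where $W_n$ is the number of vertices of $T_n$ that are connected to $\rho$ by an open path in static percolation (edges open independently, with the given edge probabilities). Consider dynamical percolation on $T$: the edges evolve independently, and an edge with edge probability $p$ evolves as a (right-continuous with left limits) two-state continuous time Markov chain which switches from closed to open at rate $p$ and from open to closed at rate $1-p$, started from its stationary distribution (open with probability $p$). By convention, an edge is on at the times at which it changes its state. The root percolates at time $t$ if its cluster of edges that are on at time $t$ is infinite. Let $Z$ be the (random) set of times $t\in[0,1]$ at which the root percolates. Write $a_k\asymp b_k$ if, for all large $k$, the ratio $a_k/b_k$ is bounded between two positive constants. (i) If $\sum_{k=1}^\infty k\,w_k^{-1}<\infty$, then almost surely $Z$ has finitely many connected components. The hypothesis $\sum_{k=1}^\infty k\,w_k^{-1}<\infty$ holds, for example, if $w_k\asymp k^\theta$ for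 some $\theta>2$, and also in the case of supercritical percolation on a homogeneous tree, that is, if $d_j=d_1$ for all $j\ge1$ and $p_n=p$ for all $n\ge 1$, where $p>p_c(T)$; here the critical probability $p_c(T)$ is the supremum of all $q\in[0,1]$ such that percolation with all edge probabilities equal to $q$ has almost surely no infinite cluster. (ii) If $\sup_j d_j<\infty$, and either $w_k\asymp k^\theta$ for some $1<\theta<2$, or $w_k\asymp k(\log k)^\theta$ for some $\theta>1$, then with positive probability $Z$ has infinitely many connected components. -/

import Mathlib

open MeasureTheory ProbabilityTheory Filter Topology Asymptotics
open scoped NNReal ENNReal unitInterval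

namespace DynPerc

noncomputable section

/-! ### Bond percolation on a graph -/

/-- The spanning subgraph of `G` whose edges are the edges in the set `O` of open edges. -/
def openSubgraph {V : Type*} (G : SimpleGraph V) (O : Set G.edgeSet) : SimpleGraph V :=
  SimpleGraph.fromEdgeSet (Subtype.val '' O)

/-- The open cluster of `x`: all vertices joined to `x` by a path of open edges. -/
def cluster {V : Type*} (G : SimpleGraph V) (O : Set G.edgeSet) (x : V) : Set V :=
  {y | (openSubgraph G O).Reachable x y}

/-- The law of (static) bond percolation with edge probabilities `q`: the edges are independent,
and the edge `e` is open (`true`) with probability `q e`. -/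
def percolationMeasure {V : Type*} (G : SimpleGraph V) (q : G.edgeSet → I) :
    Measure (G.edgeSet → Bool) :=
  Measure.infinitePi fun e => bernoulliMeasure true false (q e)

/-- The set of open edges of a configuration. -/
def openEdges {E : Type*} (η : E → Bool) : Set E := {e | η e = true}

/-- The critical probability `p_c(G)` of homogeneous bond percolation, i.e. the supremum of the
parameters for which there is almost surely no infinite cluster. -/
def criticalProbability {V : Type*} (G : SimpleGraph V) : I :=
  sSup {q : I | ∀ᵐ η ∂(percolationMeasure G fun _ => q),
    ¬ ∃ x, (cluster G (openEdges η) x).Infinite}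

/-! ### Spherically symmetric trees -/

/-- `G` is a tree, and with respect to the root `ρ` every vertex at level `j` has exactly
`d j` children (in particular finitely many: `Set.encard` takes values in `ℕ∞`). -/
structure IsSphericallySymmetricTree {V : Type*} (G : SimpleGraph V) (ρ : V) (d : ℕ → ℕ) :
    Prop where
  isTree : G.IsTree
  encard_children : ∀ v,
    {u | G.Adj v u ∧ G.dist ρ u = G.dist ρ v + 1}.encard = (d (G.dist ρ v) : ℕ∞)

/-- The level of an edge is `n` if it goes from level `n - 1` to level `n`; it is the larger of the
distances of its two endpoints from the root. -/
def edgeLevel {V : Type*} (G : SimpleGraph V) (ρ : V) (e : G.edgeSet) : ℕ :=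
  Sym2.lift ⟨fun u v => max (G.dist ρ u) (G.dist ρ v), fun _ _ => max_comm _ _⟩ (e : Sym2 V)

/-- Spherically symmetric edge probabilities: edges from level `n - 1` to level `n` get
probability `p n`. -/
def edgeProb {V : Type*} (G : SimpleGraph V) (ρ : V) (p : ℕ → I) (e : G.edgeSet) : I :=
  p (edgeLevel G ρ e)

/-- The number `W_n` of vertices at level `n` that are joined to the root by an open path. -/
def levelCount {V : Type*} (G : SimpleGraph V) (ρ : V) (O : Set G.edgeSet) (n : ℕ) : ℕ :=
  {x | G.dist ρ x = n ∧ x ∈ cluster G O ρ}.ncard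

/-- The expectation `w_n = E[W_n]` for static percolation. -/
def meanLevelCount {V : Type*} (G : SimpleGraph V) (ρ : V) (p : ℕ → I) (n : ℕ) : ℝ :=
  ∫ η, (levelCount G ρ (openEdges η) n : ℝ) ∂(percolationMeasure G (edgeProb G ρ p))

/-! ### Dynamical percolation -/

/-- A continuous time Markov chain `X` on a finite state space `S` with initial distribution `ν`
and generator matrix `Q`: its transition matrices are `exp (t • Q)`, its finite dimensional
distributions are those of the Markov process with these transition matrices, and almost surely its
paths are right continuous with left limits. -/
structure IsMarkovChain {Ω S : Type*} [MeasurableSpace Ω] [Fintype S] [DecidableEq S]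
    [MeasurableSpace S] [TopologicalSpace S] (P : Measure Ω) (ν : Measure S) (Q : Matrix S S ℝ)
    (X : ℝ≥0 → Ω → S) : Prop where
  measurable : ∀ t, Measurable (X t)
  finite_dim : ∀ (n : ℕ) (t : Fin (n + 1) → ℝ≥0) (a : Fin (n + 1) → S), Monotone t → t 0 = 0 →
    P.real {ω | ∀ i, X (t i) ω = a i} =
      ν.real {a 0} * ∏ i : Fin n,
        (NormedSpace.exp (((t i.succ : ℝ) - (t i.castSucc : ℝ)) • Q)) (a i.castSucc) (a i.succ)
  right_cont : ∀ᵐ ω ∂P, ∀ t, ContinuousWithinAt (fun s => X s ω) (Set.Ici t) t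
  left_lim : ∀ᵐ ω ∂P, ∀ t, ∃ b, Tendsto (fun s => X s ω) (𝓝[<] t) (𝓝 b)

/-- The generator of the evolution of a single edge: closed (`false`) switches to open (`true`) at
rate `q`, and open switches to closed at rate `1 - q`. -/
def edgeGenerator (q : I) : Matrix Bool Bool ℝ :=
  Matrix.of fun a b => match a, b with
    | false, true => (q : ℝ)
    | false, false => -(q : ℝ)
    | true, false => 1 - (q : ℝ)
    | true, true => -(1 - (q : ℝ))

/-- Dynamical percolation on `G` with edge probabilities `q`: the edges evolve independently, and
the edge `e` evolves as a two state Markov chain with rates `q e` and `1 - q e`, started from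
its stationary distribution (open with probability `q e`). -/
structure IsDynamicalPercolation {V Ω : Type*} [MeasurableSpace Ω] (G : SimpleGraph V)
    (q : G.edgeSet → I) (P : Measure Ω) (X : G.edgeSet → ℝ≥0 → Ω → Bool) : Prop where
  isMarkovChain : ∀ e,
    IsMarkovChain P (bernoulliMeasure true false (q e)) (edgeGenerator (q e)) (X e)
  indep : iIndepFun (fun e (ω : Ω) (t : ℝ≥0) => X e t ω) P

/-- The set of edges that are on at time `t`: those in the open state, and, by convention, those
that change their state at time `t`. -/
def onEdges {E Ω : Type*} (X : E → ℝ≥0 → Ω → Bool) (t : ℝ≥0) (ω : Ω) : Set E :=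
  {e | X e t ω = true ∨ ¬ ContinuousAt (fun s => X e s ω) t}

/-- The set of times in `[0, 1]` at which the vertex `x` percolates. -/
def percolationTimes {V Ω : Type*} (G : SimpleGraph V) (x : V) (X : G.edgeSet → ℝ≥0 → Ω → Bool)
    (ω : Ω) : Set ℝ≥0 :=
  {t | t ∈ Set.Icc 0 1 ∧ (cluster G (onEdges X t ω) x).Infinite}

end

end DynPerc

namespace DynPerc

/-! ### Elementary inequalities for binomial generating functions -/

lemma two_mul_geom_sum_eq {y : ℝ} (hy : 0 ≤ y) (d : ℕ) :
    2 * ∑ i ∈ Finset.range d, y ^ i = ∑ i ∈ Finset.range d,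
      (2 * Real.sqrt y ^ (d - 1) + (Real.sqrt y ^ i - Real.sqrt y ^ (d - 1 - i)) ^ 2) := by
  have h : ∑ i ∈ Finset.range d, y ^ i = ∑ i ∈ Finset.range d, y ^ (d - 1 - i) :=
    (Finset.sum_range_reflect (fun i => y ^ i) d).symm
  rw [two_mul]
  nth_rewrite 2 [h]
  rw [← Finset.sum_add_distrib]
  refine Finset.sum_congr rfl fun i hi => ?_
  have hi' : i ≤ d - 1 := by have := Finset.mem_range.1 hi; omega
  have e : Real.sqrt y ^ (d - 1) = Real.sqrt y ^ i * Real.sqrt y ^ (d - 1 - i) := by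
    rw [← pow_add]; congr 1; omega
  have e2 : ∀ n : ℕ, y ^ n = (Real.sqrt y ^ n) ^ 2 := fun n => by
    rw [← pow_mul, mul_comm, pow_mul, Real.sq_sqrt hy]
  rw [e, e2 i, e2 (d - 1 - i)]
  ring

lemma sq_mul_pow_le_geom_sum_sq {y : ℝ} (hy : 0 ≤ y) (d : ℕ) :
    (d : ℝ) ^ 2 * y ^ (d - 1) ≤ (∑ i ∈ Finset.range d, y ^ i) ^ 2 := by
  have h := two_mul_geom_sum_eq hy d
  have h2 : 2 * ((d : ℝ) * Real.sqrt y ^ (d - 1)) ≤ 2 * ∑ i ∈ Finset.range d, y ^ i := by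
    rw [h]
    calc 2 * ((d : ℝ) * Real.sqrt y ^ (d - 1))
        = ∑ i ∈ Finset.range d, 2 * Real.sqrt y ^ (d - 1) := by simp; ring
      _ ≤ _ := Finset.sum_le_sum fun i _ => by nlinarith [sq_nonneg (√y ^ i - √y ^ (d - 1 - i))]
  have h3 : (0 : ℝ) ≤ (d : ℝ) * Real.sqrt y ^ (d - 1) := by positivity
  calc (d : ℝ) ^ 2 * y ^ (d - 1) = ((d : ℝ) * Real.sqrt y ^ (d - 1)) ^ 2 := by
        rw [mul_pow, ← pow_mul, mul_comm (d - 1) 2, pow_mul, Real.sq_sqrt hy]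
    _ ≤ _ := by
        apply pow_le_pow_left₀ h3; linarith

lemma geom_sum_sq_le {ε y : ℝ} (hε : 0 < ε) (hy : ε ≤ y) (hy1 : y ≤ 1) {d D : ℕ} (hd : d ≤ D) :
    (∑ i ∈ Finset.range d, y ^ i) ^ 2 ≤
      (d : ℝ) ^ 2 * y ^ (d - 1) * (1 + (D : ℝ) ^ 2 / ε ^ D * (1 - y) ^ 2) ^ 2 := by
  have hy0 : 0 ≤ y := hε.le.trans hy
  set z := Real.sqrt y with hz
  have hz0 : 0 ≤ z := Real.sqrt_nonneg _
  have hz1 : z ≤ 1 := Real.sqrt_le_one.2 hy1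
  have hzz : z ^ 2 = y := Real.sq_sqrt hy0
  have hyz : y ≤ z := by nlinarith
  have h := two_mul_geom_sum_eq hy0 d
  rw [← hz] at h
  have hb : ∀ i ≤ D, 1 - (D : ℝ) * (1 - z) ≤ z ^ i ∧ z ^ i ≤ 1 := by
    intro i hi
    refine ⟨?_, pow_le_one₀ hz0 hz1⟩
    have := one_add_mul_le_pow (a := z - 1) (by linarith) i
    have hi' : (i : ℝ) ≤ D := by exact_mod_cast hi
    simp only [add_sub_cancel] at this
    nlinarith
  have h2 : 2 * ∑ i ∈ Finset.range d, y ^ i ≤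
      2 * ((d : ℝ) * (z ^ (d - 1) + (D : ℝ) ^ 2 * (1 - y) ^ 2)) := by
    rw [h]
    calc _ ≤ ∑ i ∈ Finset.range d, (2 * z ^ (d - 1) + (D : ℝ) ^ 2 * (1 - y) ^ 2) := by
          refine Finset.sum_le_sum fun i hi => ?_
          have hi' := Finset.mem_range.1 hi
          obtain ⟨a1, a2⟩ := hb i (by omega)
          obtain ⟨b1, b2⟩ := hb (d - 1 - i) (by omega)
          have hD : (0 : ℝ) ≤ D := Nat.cast_nonneg D
          have : |z ^ i - z ^ (d - 1 - i)| ≤ D * (1 - y) := by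
            have : (D : ℝ) * (1 - z) ≤ D * (1 - y) := by gcongr
            rw [abs_le]; constructor <;> linarith
          have := sq_le_sq' (abs_le.1 this).1 (abs_le.1 this).2
          rw [mul_pow] at this
          linarith
      _ = (d : ℝ) * (2 * z ^ (d - 1) + (D : ℝ) ^ 2 * (1 - y) ^ 2) := by simp [mul_add]
      _ ≤ _ := by
          have : 0 ≤ (d : ℝ) * ((D : ℝ) ^ 2 * (1 - y) ^ 2) := by positivity
          nlinarith
  have h3 : ε ^ D ≤ z ^ (d - 1) := by
    calc ε ^ D ≤ z ^ D := pow_le_pow_left₀ hε.le (hy.trans hyz) _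
      _ ≤ z ^ (d - 1) := pow_le_pow_of_le_one hz0 hz1 (by omega)
  have h4 : (∑ i ∈ Finset.range d, y ^ i) ≤
      (d : ℝ) * z ^ (d - 1) * (1 + (D : ℝ) ^ 2 / ε ^ D * (1 - y) ^ 2) := by
    have e : (D : ℝ) ^ 2 * (1 - y) ^ 2 ≤ z ^ (d - 1) * ((D : ℝ) ^ 2 / ε ^ D * (1 - y) ^ 2) := by
      have hp : 0 < ε ^ D := by positivity
      calc (D : ℝ) ^ 2 * (1 - y) ^ 2 = ε ^ D * ((D : ℝ) ^ 2 / ε ^ D * (1 - y) ^ 2) := by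
            field_simp
        _ ≤ _ := by gcongr
    have : (d : ℝ) * ((D : ℝ) ^ 2 * (1 - y) ^ 2) ≤
      d * (z ^ (d - 1) * ((D : ℝ) ^ 2 / ε ^ D * (1 - y) ^ 2)) := by gcongr
    nlinarith
  calc (∑ i ∈ Finset.range d, y ^ i) ^ 2 ≤
      ((d : ℝ) * z ^ (d - 1) * (1 + (D : ℝ) ^ 2 / ε ^ D * (1 - y) ^ 2)) ^ 2 := by
        apply pow_le_pow_left₀ (Finset.sum_nonneg fun i _ => by positivity) h4
    _ = _ := by
        rw [mul_pow, mul_pow, ← pow_mul z, mul_comm (d - 1) 2, pow_mul, hzz]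

lemma mul_le_one_sub_pow_mul {x : ℝ} (h0 : 0 ≤ x) (h1 : x ≤ 1) (d : ℕ) :
    d * x ≤ (1 - (1 - x) ^ d) * (1 + d * x) := by
  have h2 : 1 + d * x ≤ (1 + x) ^ d := one_add_mul_le_pow (by linarith) d
  have h3 : (1 - x) ^ d * (1 + d * x) ≤ 1 := by
    calc (1 - x) ^ d * (1 + d * x) ≤ (1 - x) ^ d * (1 + x) ^ d := by
          apply mul_le_mul_of_nonneg_left h2 (pow_nonneg (by linarith) _)
      _ = (1 - x ^ 2) ^ d := by rw [← mul_pow]; congr 1; ring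
      _ ≤ 1 := pow_le_one₀ (by nlinarith) (by nlinarith [sq_nonneg x])
  nlinarith

lemma one_sub_pow_mul_le_mul {x : ℝ} (h0 : 0 ≤ x) (h1 : x ≤ 1) (d : ℕ) :
    (1 - (1 - x) ^ (d + 1)) * (1 + d * x / 2) ≤ (d + 1) * x := by
  induction d with
  | zero => simp
  | succ d ih =>
    set s := 1 - (1 - x) ^ (d + 1)
    have e : 1 - (1 - x) ^ (d + 1 + 1) = s * (1 - x) + x := by simp only [s]; ring
    rw [e]
    push_cast
    have hd : (0 : ℝ) ≤ d := Nat.cast_nonneg d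
    have hq : 0 < 1 + d * x / 2 := by positivity
    refine le_of_mul_le_mul_right ?_ hq
    have k1 : s * (1 + d * x / 2) * ((1 - x) * (1 + (d + 1) * x / 2)) ≤
        (d + 1) * x * ((1 - x) * (1 + (d + 1) * x / 2)) :=
      mul_le_mul_of_nonneg_right ih (mul_nonneg (by linarith) (by positivity))
    have k2 : 0 ≤ (d : ℝ) * x ^ 3 := by positivity
    have k3 : 0 ≤ (d : ℝ) ^ 2 * x ^ 3 := by positivity
    have k4 : 0 ≤ x ^ 3 := by positivity
    nlinarith

/-! ### Survival probabilities, mean sizes and pivotality weights -/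

/-- The probability that a vertex at level `j` is joined to the `n`-th generation below it. -/
noncomputable def reachProb (d : ℕ → ℕ) (p : ℕ → ℝ) : ℕ → ℕ → ℝ
  | 0, _ => 1
  | n + 1, j => 1 - (1 - p (j + 1) * reachProb d p n (j + 1)) ^ d j

/-- The mean number of level `n` vertices joined to the root. -/
noncomputable def meanSize (d : ℕ → ℕ) (p : ℕ → ℝ) (n : ℕ) : ℝ :=
  ∏ i ∈ Finset.range n, (d i * p (i + 1))

/-- The mean number of children which are joined by an open edge to a vertex at level `j` while
no other child is open and successful, where `t` is the success probability of a child. -/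
noncomputable def pivotFactor (d : ℕ → ℕ) (p : ℕ → ℝ) (j : ℕ) (t : ℝ) : ℝ :=
  d j * p (j + 1) * (1 - p (j + 1) * t) ^ (d j - 1)

/-- The mean number of pivotal edges for reaching `n` generations below level `j`, normalised by
the edge probabilities. -/
noncomputable def pivotSum (d : ℕ → ℕ) (p : ℕ → ℝ) : ℕ → ℕ → ℝ
  | 0, _ => 0
  | n + 1, j => pivotFactor d p j (reachProb d p n (j + 1)) *
      (pivotSum d p n (j + 1) + reachProb d p n (j + 1))

section
variable {d : ℕ → ℕ} {p : ℕ → ℝ}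

lemma reachProb_mem (hp : ∀ j, 0 < p (j + 1) ∧ p (j + 1) ≤ 1) (n j : ℕ) :
    0 ≤ reachProb d p n j ∧ reachProb d p n j ≤ 1 := by
  induction n generalizing j with
  | zero => simp [reachProb]
  | succ n ih =>
    obtain ⟨h1, h2⟩ := ih (j + 1)
    obtain ⟨h3, h4⟩ := hp j
    have : p (j + 1) * reachProb d p n (j + 1) ≤ 1 := by nlinarith
    have : 0 ≤ p (j + 1) * reachProb d p n (j + 1) := by positivity
    have a := pow_nonneg (show 0 ≤ 1 - p (j + 1) * reachProb d p n (j + 1) by linarith) (d j)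
    have b := pow_le_one₀ (show 0 ≤ 1 - p (j + 1) * reachProb d p n (j + 1) by linarith)
      (by linarith) (n := d j)
    simp only [reachProb]
    constructor <;> linarith

lemma reachProb_antitone (hp : ∀ j, 0 < p (j + 1) ∧ p (j + 1) ≤ 1) (n j : ℕ) :
    reachProb d p (n + 1) j ≤ reachProb d p n j := by
  induction n generalizing j with
  | zero => exact (reachProb_mem hp 1 j).2
  | succ n ih =>
    have h1 := ih (j + 1)
    obtain ⟨h3, h4⟩ := hp j
    have h5 := reachProb_mem (d := d) hp n (j + 1)
    change 1 - (1 - p (j + 1) * reachProb d p (n + 1) (j + 1)) ^ d j ≤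
      1 - (1 - p (j + 1) * reachProb d p n (j + 1)) ^ d j
    apply sub_le_sub_left
    apply pow_le_pow_left₀
    · nlinarith
    · nlinarith

lemma meanSize_pos (hd : ∀ j, 1 ≤ d j) (hp : ∀ j, 0 < p (j + 1) ∧ p (j + 1) ≤ 1) (n : ℕ) :
    0 < meanSize d p n := by
  refine Finset.prod_pos fun i _ => ?_
  have := hd i
  have := (hp i).1
  positivity

lemma meanSize_succ (n : ℕ) : meanSize d p (n + 1) = meanSize d p n * (d n * p (n + 1)) := by
  rw [meanSize, Finset.prod_range_succ]; rfl

/-- The core inequality between the pivotality weight and the survival probabilities. -/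
lemma pivotFactor_mul_le (hp : ∀ j, 0 < p (j + 1) ∧ p (j + 1) ≤ 1) {j : ℕ} {t s : ℝ}
    (ht0 : 0 ≤ t) (ht1 : t ≤ 1) (hs : s = 1 - (1 - p (j + 1) * t) ^ d j) :
    pivotFactor d p j t * (d j * p (j + 1)) * t ^ 2 ≤ s ^ 2 := by
  obtain ⟨h3, h4⟩ := hp j
  set y := 1 - p (j + 1) * t with hy
  have hy0 : 0 ≤ y := by nlinarith
  have hg : s = (p (j + 1) * t) * ∑ i ∈ Finset.range (d j), y ^ i := by
    rw [hs, ← mul_neg_geom_sum]; congr 1; rw [hy]; ring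
  have := sq_mul_pow_le_geom_sum_sq hy0 (d j)
  rw [hg, mul_pow, pivotFactor, ← hy]
  calc _ = (p (j + 1) * t) ^ 2 * ((d j : ℝ) ^ 2 * y ^ (d j - 1)) := by ring
    _ ≤ _ := by gcongr

lemma pivotFactor_nonneg (hp : ∀ j, 0 < p (j + 1) ∧ p (j + 1) ≤ 1) (j : ℕ) {t : ℝ} (h0 : 0 ≤ t)
    (ht1 : t ≤ 1) : 0 ≤ pivotFactor d p j t := by
  obtain ⟨h3, h4⟩ := hp j
  have : 0 ≤ 1 - p (j + 1) * t := by nlinarith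
  rw [pivotFactor]; positivity

lemma le_reachStep (hd : ∀ j, 1 ≤ d j) (hp : ∀ j, 0 < p (j + 1) ∧ p (j + 1) ≤ 1) {j : ℕ}
    {t s : ℝ} (ht0 : 0 < t) (ht1 : t ≤ 1) (hs : s = 1 - (1 - p (j + 1) * t) ^ d j) :
    0 < s ∧ s⁻¹ ≤ 1 + t⁻¹ / (d j * p (j + 1)) := by
  obtain ⟨h3, h4⟩ := hp j
  have hd' : (0 : ℝ) < d j := by exact_mod_cast hd j
  have h := mul_le_one_sub_pow_mul (x := p (j + 1) * t) (by positivity) (by nlinarith) (d j)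
  rw [← hs] at h
  have hx : 0 < (d j : ℝ) * (p (j + 1) * t) := by positivity
  have hs0 : 0 < s := by
    by_contra hcon
    push Not at hcon
    nlinarith
  refine ⟨hs0, ?_⟩
  rw [inv_le_iff_one_le_mul₀ hs0]
  have : (1 + t⁻¹ / (d j * p (j + 1))) * s
      = s * (1 + d j * (p (j + 1) * t)) / (d j * (p (j + 1) * t)) := by
    field_simp
    ring
  rw [this, le_div_iff₀ hx]
  linarith

lemma reachProb_pos (hd : ∀ j, 1 ≤ d j) (hp : ∀ j, 0 < p (j + 1) ∧ p (j + 1) ≤ 1) (n j : ℕ) :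
    0 < reachProb d p n j := by
  induction n generalizing j with
  | zero => simp [reachProb]
  | succ n ih => exact (le_reachStep hd hp (ih (j + 1)) (reachProb_mem hp _ _).2 rfl).1

lemma inv_reachProb_le (hd : ∀ j, 1 ≤ d j) (hp : ∀ j, 0 < p (j + 1) ∧ p (j + 1) ≤ 1) (n j : ℕ) :
    (reachProb d p n j)⁻¹ ≤
      ∑ i ∈ Finset.range (n + 1), meanSize d p j / meanSize d p (j + i) := by
  induction n generalizing j with
  | zero => simp [reachProb, (meanSize_pos hd hp j).ne']
  | succ n ih =>
    have h := (le_reachStep hd hp (reachProb_pos hd hp n (j + 1)) (reachProb_mem hp _ _).2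
      (s := reachProb d p (n + 1) j) rfl).2
    have hd0 : 0 < (d j : ℝ) := by exact_mod_cast hd j
    have hp0 : 0 < p (j + 1) := (hp j).1
    have hm : 0 < (d j : ℝ) * p (j + 1) := mul_pos hd0 hp0
    rw [Finset.sum_range_succ']
    have e : ∑ i ∈ Finset.range (n + 1), meanSize d p j / meanSize d p (j + (i + 1)) =
        (∑ i ∈ Finset.range (n + 1), meanSize d p (j + 1) / meanSize d p (j + 1 + i)) /
          (d j * p (j + 1)) := by
      rw [Finset.sum_div]
      refine Finset.sum_congr rfl fun i _ => ?_
      rw [meanSize_succ, show j + (i + 1) = j + 1 + i by ring]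
      field_simp
    rw [e, add_zero, div_self (meanSize_pos hd hp j).ne']
    refine (h.trans ?_).trans (add_comm _ _).le
    gcongr
    exact ih (j + 1)

lemma pivotSum_le_aux (hd : ∀ j, 1 ≤ d j) (hp : ∀ j, 0 < p (j + 1) ∧ p (j + 1) ≤ 1) (n j : ℕ) :
    pivotSum d p n j ≤ reachProb d p n j ^ 2 *
      ∑ i ∈ Finset.range (n + 1), i * (meanSize d p j / meanSize d p (j + i)) := by
  induction n generalizing j with
  | zero => simp [pivotSum]
  | succ n ih =>
    set T' := reachProb d p n (j + 1) with hT'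
    have hT0 : 0 < T' := reachProb_pos hd hp n (j + 1)
    have hT1 : T' ≤ 1 := (reachProb_mem hp _ _).2
    set T := reachProb d p (n + 1) j with hT
    have hd0 : 0 < (d j : ℝ) := by exact_mod_cast hd j
    have hp0 : 0 < p (j + 1) := (hp j).1
    have hm : 0 < (d j : ℝ) * p (j + 1) := mul_pos hd0 hp0
    have hg := pivotFactor_mul_le (d := d) hp hT0.le hT1 (s := T) rfl
    have hg0 := pivotFactor_nonneg (d := d) hp j hT0.le hT1
    set C := ∑ i ∈ Finset.range (n + 1),
      (i : ℝ) * (meanSize d p (j + 1) / meanSize d p (j + 1 + i)) with hC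
    set W := ∑ i ∈ Finset.range (n + 1), meanSize d p (j + 1) / meanSize d p (j + 1 + i) with hW
    have hW' : T'⁻¹ ≤ W := inv_reachProb_le hd hp n (j + 1)
    have hC0 : 0 ≤ C := Finset.sum_nonneg fun i _ => mul_nonneg (Nat.cast_nonneg i)
      (div_nonneg (meanSize_pos hd hp _).le (meanSize_pos hd hp _).le)
    have e : ∑ i ∈ Finset.range (n + 1 + 1), (i : ℝ) * (meanSize d p j / meanSize d p (j + i)) =
        (C + W) / (d j * p (j + 1)) := by
      rw [Finset.sum_range_succ', hC, hW, ← Finset.sum_add_distrib, Finset.sum_div]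
      simp only [Nat.cast_zero, zero_mul, add_zero]
      refine Finset.sum_congr rfl fun i _ => ?_
      rw [meanSize_succ, show j + (i + 1) = j + 1 + i by ring]
      push_cast
      field_simp
    rw [e]
    have h1 : T' ≤ T' ^ 2 * W := by
      have : T' ^ 2 * T'⁻¹ ≤ T' ^ 2 * W := by gcongr
      rwa [pow_two, mul_assoc, mul_inv_cancel₀ hT0.ne', mul_one, ← pow_two] at this
    have h2 : pivotSum d p (n + 1) j ≤ pivotFactor d p j T' * (T' ^ 2 * (C + W)) := by
      rw [pivotSum]
      refine mul_le_mul_of_nonneg_left ?_ hg0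
      have := ih (j + 1)
      rw [mul_add]
      exact add_le_add this h1
    refine h2.trans ?_
    rw [mul_div_assoc', le_div_iff₀ hm]
    have hW0 : 0 ≤ W := (inv_nonneg.2 hT0.le).trans hW'
    calc _ = pivotFactor d p j T' * (d j * p (j + 1)) * T' ^ 2 * (C + W) := by ring
      _ ≤ _ := mul_le_mul_of_nonneg_right hg (by positivity)

lemma pivotSum_le (hd : ∀ j, 1 ≤ d j) (hp : ∀ j, 0 < p (j + 1) ∧ p (j + 1) ≤ 1) (n : ℕ) :
    pivotSum d p n 0 ≤ ∑ i ∈ Finset.range (n + 1), i * (meanSize d p i)⁻¹ := by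
  have h := pivotSum_le_aux hd hp n 0
  have e : ∑ i ∈ Finset.range (n + 1), (i : ℝ) * (meanSize d p 0 / meanSize d p (0 + i)) =
      ∑ i ∈ Finset.range (n + 1), i * (meanSize d p i)⁻¹ := by
    refine Finset.sum_congr rfl fun i _ => ?_
    simp [meanSize]
  rw [e] at h
  refine h.trans ?_
  have hs : 0 ≤ ∑ i ∈ Finset.range (n + 1), (i : ℝ) * (meanSize d p i)⁻¹ :=
    Finset.sum_nonneg fun i _ => mul_nonneg (Nat.cast_nonneg i)
      (inv_nonneg.2 (meanSize_pos hd hp _).le)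
  have := reachProb_mem (d := d) hp n 0
  have : reachProb d p n 0 ^ 2 ≤ 1 := pow_le_one₀ this.1 this.2
  nlinarith

/-- The probability that a vertex at level `j` percolates. -/
noncomputable def survProb (d : ℕ → ℕ) (p : ℕ → ℝ) (j : ℕ) : ℝ := ⨅ n, reachProb d p n j

lemma tendsto_reachProb (hp : ∀ j, 0 < p (j + 1) ∧ p (j + 1) ≤ 1) (j : ℕ) :
    Tendsto (fun n => reachProb d p n j) atTop (𝓝 (survProb d p j)) :=
  tendsto_atTop_ciInf (antitone_nat_of_succ_le fun n => reachProb_antitone hp n j)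
    ⟨0, by rintro _ ⟨n, rfl⟩; exact (reachProb_mem hp n j).1⟩

lemma survProb_eq (hp : ∀ j, 0 < p (j + 1) ∧ p (j + 1) ≤ 1) (j : ℕ) :
    survProb d p j = 1 - (1 - p (j + 1) * survProb d p (j + 1)) ^ d j := by
  refine tendsto_nhds_unique ((tendsto_add_atTop_iff_nat 1).2 (tendsto_reachProb hp j)) ?_
  simp only [reachProb]
  exact ((((tendsto_reachProb hp (j + 1)).const_mul _).const_sub _).pow _).const_sub _

lemma survProb_mem (hp : ∀ j, 0 < p (j + 1) ∧ p (j + 1) ≤ 1) (j : ℕ) :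
    0 ≤ survProb d p j ∧ survProb d p j ≤ 1 :=
  ⟨ge_of_tendsto' (tendsto_reachProb hp j) fun n => (reachProb_mem hp n j).1,
    le_of_tendsto' (tendsto_reachProb hp j) fun n => (reachProb_mem hp n j).2⟩

/-- The mean number of level `j` vertices joined to the root while no other vertex of the same level
is joined to the root and percolates, up to conditioning. -/
noncomputable def pivotWeight (d : ℕ → ℕ) (p : ℕ → ℝ) (j : ℕ) : ℝ :=
  ∏ i ∈ Finset.range j, pivotFactor d p i (survProb d p (i + 1))

lemma pivotWeight_succ (j : ℕ) : pivotWeight d p (j + 1) =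
    pivotWeight d p j * pivotFactor d p j (survProb d p (j + 1)) := by
  rw [pivotWeight, Finset.prod_range_succ]; rfl

lemma pivotWeight_nonneg (hp : ∀ j, 0 < p (j + 1) ∧ p (j + 1) ≤ 1) (j : ℕ) :
    0 ≤ pivotWeight d p j :=
  Finset.prod_nonneg fun _ _ => pivotFactor_nonneg hp _ (survProb_mem hp _).1 (survProb_mem hp _).2

/-- A vertex which is the only one of its level in an infinite cluster: at most one exists. -/
lemma pivotWeight_mul_survProb_le (hp : ∀ j, 0 < p (j + 1) ∧ p (j + 1) ≤ 1) (j : ℕ) :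
    pivotWeight d p j * survProb d p j ≤ 1 := by
  induction j with
  | zero => simpa [pivotWeight] using (survProb_mem hp 0).2
  | succ j ih =>
    refine le_trans ?_ ih
    rw [pivotWeight_succ, mul_assoc]
    refine mul_le_mul_of_nonneg_left ?_ (pivotWeight_nonneg hp j)
    obtain ⟨h3, h4⟩ := hp j
    obtain ⟨h1, h2⟩ := survProb_mem (d := d) hp (j + 1)
    rw [survProb_eq hp j]
    set t := survProb d p (j + 1)
    rw [← mul_neg_geom_sum, pivotFactor]
    set y := 1 - p (j + 1) * t with hy
    have hy0 : 0 ≤ y := by nlinarith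
    have hy1 : y ≤ 1 := by nlinarith
    have : (d j : ℝ) * y ^ (d j - 1) ≤ ∑ i ∈ Finset.range (d j), y ^ i := by
      calc (d j : ℝ) * y ^ (d j - 1) = ∑ i ∈ Finset.range (d j), y ^ (d j - 1) := by simp
        _ ≤ _ := Finset.sum_le_sum fun i hi =>
          pow_le_pow_of_le_one hy0 hy1 (by have := Finset.mem_range.1 hi; omega)
    calc _ = (1 - y) * (d j * y ^ (d j - 1)) := by rw [hy]; ring
      _ ≤ _ := by gcongr

end

section
variable {d : ℕ → ℕ} {p : ℕ → ℝ}

/-- The tails of the series of reciprocals of the mean sizes. -/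
noncomputable def sizeTail (d : ℕ → ℕ) (p : ℕ → ℝ) (j : ℕ) : ℝ := ∑' i, (meanSize d p (j + i))⁻¹

lemma summable_shift (hS : Summable fun n => (meanSize d p n)⁻¹) (j : ℕ) :
    Summable fun i => (meanSize d p (j + i))⁻¹ := by
  simpa [add_comm] using (summable_nat_add_iff j).2 hS

lemma sizeTail_pos (hd : ∀ j, 1 ≤ d j) (hp : ∀ j, 0 < p (j + 1) ∧ p (j + 1) ≤ 1)
    (hS : Summable fun n => (meanSize d p n)⁻¹) (j : ℕ) : 0 < sizeTail d p j :=
  (summable_shift hS j).tsum_pos (fun _ => (inv_pos.2 (meanSize_pos hd hp _)).le) 0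
    (inv_pos.2 (meanSize_pos hd hp _))

lemma inv_le_survProb (hd : ∀ j, 1 ≤ d j) (hp : ∀ j, 0 < p (j + 1) ∧ p (j + 1) ≤ 1)
    (hS : Summable fun n => (meanSize d p n)⁻¹) (j : ℕ) :
    (meanSize d p j * sizeTail d p j)⁻¹ ≤ survProb d p j := by
  have hw := meanSize_pos hd hp j
  have hS0 := sizeTail_pos hd hp hS j
  refine ge_of_tendsto' (tendsto_reachProb hp j) fun n => ?_
  rw [inv_le_comm₀ (by positivity) (reachProb_pos hd hp n j)]
  refine (inv_reachProb_le hd hp n j).trans ?_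
  simp only [div_eq_mul_inv, ← Finset.mul_sum]
  refine mul_le_mul_of_nonneg_left ?_ hw.le
  exact (summable_shift hS j).sum_le_tsum _ fun i _ => (inv_pos.2 (meanSize_pos hd hp _)).le

lemma survProb_pos (hd : ∀ j, 1 ≤ d j) (hp : ∀ j, 0 < p (j + 1) ∧ p (j + 1) ≤ 1)
    (hS : Summable fun n => (meanSize d p n)⁻¹) (j : ℕ) : 0 < survProb d p j :=
  (inv_pos.2 (mul_pos (meanSize_pos hd hp j) (sizeTail_pos hd hp hS j))).trans_le
    (inv_le_survProb hd hp hS j)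

lemma inv_survProb_step (hd : ∀ j, 1 ≤ d j) {ε : ℝ} (hε : 0 < ε) (hε1 : ε < 1)
    (hp : ∀ j, 0 < p (j + 1) ∧ p (j + 1) ≤ 1) (hpε : ∀ j, p (j + 1) ≤ 1 - ε)
    (hS : Summable fun n => (meanSize d p n)⁻¹) (j : ℕ) :
    (meanSize d p (j + 1) * survProb d p (j + 1))⁻¹ - (8 * meanSize d p (j + 1))⁻¹ +
        ε / 8 * (meanSize d p j)⁻¹ ≤
      (meanSize d p j * survProb d p j)⁻¹ - (8 * meanSize d p j)⁻¹ := by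
  have hw := meanSize_pos hd hp j
  have hw' := meanSize_pos hd hp (j + 1)
  have ht := survProb_pos hd hp hS j
  have ht' := survProb_pos hd hp hS (j + 1)
  have ht1 := (survProb_mem (d := d) hp (j + 1)).2
  obtain ⟨h3, h4⟩ := hp j
  have hstep := survProb_eq (d := d) hp j
  have hws := meanSize_succ (d := d) (p := p) j
  obtain ⟨D, hD⟩ : ∃ D, d j = D + 1 := ⟨d j - 1, by have := hd j; omega⟩
  have hx1 : p (j + 1) * survProb d p (j + 1) ≤ 1 := by nlinarith
  have key := one_sub_pow_mul_le_mul (x := p (j + 1) * survProb d p (j + 1)) (by positivity) hx1 D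
  rw [← hD, ← hstep] at key
  have hDc : (d j : ℝ) = D + 1 := by rw [hD]; push_cast; rfl
  rw [hDc] at hws
  set w := meanSize d p j
  set w' := meanSize d p (j + 1)
  set t := survProb d p j
  set t' := survProb d p (j + 1)
  set q := p (j + 1)
  have h8 : (8 * w)⁻¹ = w⁻¹ / 8 := by rw [mul_inv]; ring
  have h8' : (8 * w')⁻¹ = w'⁻¹ / 8 := by rw [mul_inv]; ring
  rw [h8, h8']
  -- the reciprocal form of the step
  have step : (w' * t')⁻¹ + w⁻¹ * (D / (2 * (D + 1))) ≤ (w * t)⁻¹ := by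
    have hD0 : (0 : ℝ) ≤ D := Nat.cast_nonneg D
    rw [hws]
    have e : (w * ((D + 1) * q) * t')⁻¹ + w⁻¹ * (D / (2 * (D + 1)))
        = (1 + D * (q * t') / 2) / (w * ((D + 1) * (q * t'))) := by
      field_simp
    rw [e, div_le_iff₀ (by positivity)]
    have e2 : (w * t)⁻¹ * (w * ((D + 1) * (q * t'))) = ((D + 1) * (q * t')) / t := by
      field_simp
    rw [e2, le_div_iff₀ ht]
    linarith
  have hwi : 0 < w⁻¹ := inv_pos.2 hw
  have hwi' : 0 < w'⁻¹ := inv_pos.2 hw'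
  rcases Nat.eq_zero_or_pos D with h0 | h0
  · have hq := hpε j
    have : w⁻¹ ≤ (1 - ε) * w'⁻¹ := by
      rw [hws, h0]
      have : (w * (((0 : ℕ) + 1) * q))⁻¹ = w⁻¹ * q⁻¹ := by
        push_cast; rw [zero_add, one_mul, mul_inv]
      rw [this, mul_comm, mul_assoc]
      refine le_mul_of_one_le_right hwi.le ?_
      rw [inv_mul_eq_div, one_le_div h3]
      exact hq
    rw [h0] at step
    simp only [Nat.cast_zero, zero_div, mul_zero, add_zero] at step
    have h9 : (1 + ε) * w⁻¹ ≤ (1 + ε) * ((1 - ε) * w'⁻¹) := by gcongr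
    have h10 : 0 ≤ ε ^ 2 * w'⁻¹ := by positivity
    linarith
  · have : (1 : ℝ) / 4 ≤ D / (2 * (D + 1)) := by
      have : (1 : ℝ) ≤ D := by exact_mod_cast h0
      rw [div_le_div_iff₀ (by norm_num) (by positivity)]
      linarith
    have : w⁻¹ * (1 / 4) ≤ w⁻¹ * (D / (2 * (D + 1))) := by gcongr
    nlinarith

lemma sizeTail_le (hd : ∀ j, 1 ≤ d j) {ε : ℝ} (hε : 0 < ε) (hε1 : ε < 1)
    (hp : ∀ j, 0 < p (j + 1) ∧ p (j + 1) ≤ 1) (hpε : ∀ j, p (j + 1) ≤ 1 - ε)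
    (hS : Summable fun n => (meanSize d p n)⁻¹) (j : ℕ) :
    ε / 8 * sizeTail d p j ≤ (meanSize d p j * survProb d p j)⁻¹ := by
  have h : ∀ n, ε / 8 * ∑ i ∈ Finset.range n, (meanSize d p (j + i))⁻¹ ≤
      (meanSize d p j * survProb d p j)⁻¹ - (8 * meanSize d p j)⁻¹ -
      ((meanSize d p (j + n) * survProb d p (j + n))⁻¹ - (8 * meanSize d p (j + n))⁻¹) := by
    intro n
    induction n with
    | zero => simp
    | succ n ih =>
      have := inv_survProb_step hd hε hε1 hp hpε hS (j + n)
      rw [Finset.sum_range_succ, mul_add]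
      rw [show j + (n + 1) = j + n + 1 by ring]
      linarith
  have hpos : ∀ j, 0 < (meanSize d p j * survProb d p j)⁻¹ := fun j =>
    inv_pos.2 (mul_pos (meanSize_pos hd hp j) (survProb_pos hd hp hS j))
  have h' : ∀ n, ε / 8 * ∑ i ∈ Finset.range n, (meanSize d p (j + i))⁻¹ ≤
      (meanSize d p j * survProb d p j)⁻¹ + (meanSize d p (j + n))⁻¹ := by
    intro n
    have a : 0 < (8 * meanSize d p j)⁻¹ := inv_pos.2 (mul_pos (by norm_num) (meanSize_pos hd hp j))
    have b : (8 * meanSize d p (j + n))⁻¹ = (meanSize d p (j + n))⁻¹ / 8 := by rw [mul_inv]; ring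
    have c := inv_pos.2 (meanSize_pos (d := d) hd hp (j + n))
    have := h n
    have := hpos (j + n)
    linarith
  have l1 := ((summable_shift hS j).hasSum.tendsto_sum_nat).const_mul (ε / 8)
  have l2 := ((summable_shift hS j).tendsto_atTop_zero).const_add
    (meanSize d p j * survProb d p j)⁻¹
  rw [add_zero] at l2
  exact le_of_tendsto_of_tendsto' l1 l2 h'

lemma le_pivotWeight_mul (hd : ∀ j, 1 ≤ d j) {D : ℕ} (hD : ∀ j, d j ≤ D) {ε : ℝ} (hε : 0 < ε)
    (hp : ∀ j, 0 < p (j + 1) ∧ p (j + 1) ≤ 1) (hpε : ∀ j, p (j + 1) ≤ 1 - ε)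
    (hS : Summable fun n => (meanSize d p n)⁻¹) (j : ℕ) :
    survProb d p 0 ^ 2 ≤ pivotWeight d p j * (meanSize d p j * survProb d p j ^ 2) *
      (∏ i ∈ Finset.range j, (1 + (D : ℝ) ^ 2 / ε ^ D * survProb d p (i + 1) ^ 2)) ^ 2 := by
  induction j with
  | zero => simp [pivotWeight, meanSize]
  | succ j ih =>
    refine ih.trans ?_
    rw [Finset.prod_range_succ, pivotWeight_succ, meanSize_succ]
    have ht := survProb_pos hd hp hS (j + 1)
    have ht1 := (survProb_mem (d := d) hp (j + 1)).2
    obtain ⟨h3, h4⟩ := hp j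
    have h5 := hpε j
    have hw := meanSize_pos hd hp j
    have ha := pivotWeight_nonneg (d := d) hp j
    set R := ∏ i ∈ Finset.range j, (1 + (D : ℝ) ^ 2 / ε ^ D * survProb d p (i + 1) ^ 2)
    set t' := survProb d p (j + 1)
    have key : survProb d p j ^ 2 ≤ pivotFactor d p j t' * (d j * p (j + 1)) * t' ^ 2 *
        (1 + (D : ℝ) ^ 2 / ε ^ D * t' ^ 2) ^ 2 := by
      rw [survProb_eq hp j]
      set y := 1 - p (j + 1) * t' with hy
      have hyε : ε ≤ y := by nlinarith
      have hy0 : 0 ≤ y := hε.le.trans hyε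
      have hy1 : y ≤ 1 := by nlinarith
      have := geom_sum_sq_le hε hyε hy1 (hD j)
      rw [← mul_neg_geom_sum, mul_pow, pivotFactor, ← hy]
      have hyt : 0 ≤ 1 - y ∧ 1 - y ≤ t' := ⟨by linarith, by rw [hy]; nlinarith⟩
      have hyt2 : (1 - y) ^ 2 ≤ t' ^ 2 := pow_le_pow_left₀ hyt.1 hyt.2 2
      calc _ ≤ (1 - y) ^ 2 * ((d j : ℝ) ^ 2 * y ^ (d j - 1) *
            (1 + (D : ℝ) ^ 2 / ε ^ D * (1 - y) ^ 2) ^ 2) := by gcongr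
        _ ≤ (1 - y) ^ 2 * ((d j : ℝ) ^ 2 * y ^ (d j - 1) *
            (1 + (D : ℝ) ^ 2 / ε ^ D * t' ^ 2) ^ 2) := by gcongr
        _ = _ := by rw [hy]; ring
    calc _ ≤ pivotWeight d p j * (meanSize d p j * (pivotFactor d p j t' * (d j * p (j + 1)) *
          t' ^ 2 * (1 + (D : ℝ) ^ 2 / ε ^ D * t' ^ 2) ^ 2)) * R ^ 2 := by gcongr
      _ = _ := by ring

/-- The regularity of the mean sizes under which the root percolates on a set of times with
infinitely many components. -/
structure SubquadraticGrowth (w : ℕ → ℝ) : Prop where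
  summable_inv : Summable fun n => (w n)⁻¹
  le_tail : ∃ c > 0, ∀ j : ℕ, c * (j + 1) ≤ w j * ∑' i, (w (j + i))⁻¹
  summable_div : Summable fun j : ℕ => w j / (j + 1) ^ 3
  le_sq : ∃ C > 0, ∀ j : ℕ, w j ≤ C * (j + 1) ^ 2

lemma pivotWeight_bounds (hd : ∀ j, 1 ≤ d j) {D : ℕ} (hD : ∀ j, d j ≤ D) {ε : ℝ} (hε : 0 < ε)
    (hε1 : ε < 1)
    (hp : ∀ j, 0 < p (j + 1) ∧ p (j + 1) ≤ 1) (hpε : ∀ j, p (j + 1) ≤ 1 - ε)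
    (hw : SubquadraticGrowth (meanSize d p)) :
    (∃ c > 0, ∀ j : ℕ, c / (j + 1) ≤ pivotWeight d p j * survProb d p j) ∧
    (∀ j, 0 < pivotWeight d p j) ∧
    Summable fun j : ℕ => ((j + 1) * pivotWeight d p j)⁻¹ := by
  have hS := hw.summable_inv
  obtain ⟨c, hc, hct⟩ := hw.le_tail
  obtain ⟨C2, hC2, hCsq⟩ := hw.le_sq
  have hwp := meanSize_pos (d := d) hd hp
  have htp := survProb_pos hd hp hS
  set K := (D : ℝ) ^ 2 / ε ^ D with hK
  have hK0 : 0 ≤ K := by positivity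
  -- survival probabilities decay
  have hu : ∀ j : ℕ, ε / 8 * c * (j + 1) * survProb d p j ≤ 1 := by
    intro j
    have h1 := sizeTail_le hd hε hε1 hp hpε hS j
    have h2 := hct j
    have h3 : meanSize d p j * survProb d p j * (ε / 8 * sizeTail d p j) ≤ 1 := by
      have := mul_le_mul_of_nonneg_left h1 (mul_pos (hwp j) (htp j)).le
      rwa [mul_inv_cancel₀ (mul_pos (hwp j) (htp j)).ne'] at this
    calc _ = ε / 8 * survProb d p j * (c * (j + 1)) := by ring
      _ ≤ ε / 8 * survProb d p j * (meanSize d p j * sizeTail d p j) := by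
        have := (htp j).le
        exact mul_le_mul_of_nonneg_left h2 (by positivity)
      _ ≤ 1 := by linarith
  have hb0 : 0 < ε / 8 * c := by positivity
  have htsq : ∀ j : ℕ, survProb d p j ^ 2 ≤ (ε / 8 * c)⁻¹ ^ 2 * (1 / ((j : ℝ) + 1) ^ 2) := by
    intro j
    have : survProb d p j ≤ (ε / 8 * c)⁻¹ * (1 / (j + 1)) := by
      rw [inv_mul_eq_div, div_div, le_div_iff₀ (by positivity)]
      linarith [hu j]
    calc _ ≤ ((ε / 8 * c)⁻¹ * (1 / ((j : ℝ) + 1))) ^ 2 := pow_le_pow_left₀ (htp j).le this 2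
      _ = _ := by rw [mul_pow, div_pow, one_pow]
  have hsum1 : Summable fun j : ℕ => 1 / ((j : ℝ) + 1) ^ 2 := by
    have := (summable_nat_add_iff 1).2 (Real.summable_one_div_nat_pow.2 (by norm_num : 1 < 2))
    simpa using this
  have hsumt : Summable fun j : ℕ => survProb d p j ^ 2 :=
    Summable.of_nonneg_of_le (fun _ => sq_nonneg _) htsq (hsum1.mul_left _)
  have hsumt' : Summable fun j : ℕ => survProb d p (j + 1) ^ 2 := (summable_nat_add_iff 1).2 hsumt
  set E := Real.exp (K * ∑' j : ℕ, survProb d p (j + 1) ^ 2) with hE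
  have hE0 : 0 < E := Real.exp_pos _
  have hprod : ∀ j, ∏ i ∈ Finset.range j, (1 + K * survProb d p (i + 1) ^ 2) ≤ E := by
    intro j
    calc _ ≤ ∏ i ∈ Finset.range j, Real.exp (K * survProb d p (i + 1) ^ 2) :=
          Finset.prod_le_prod (fun i _ => by positivity) fun i _ => by
            rw [add_comm]; exact Real.add_one_le_exp _
      _ = Real.exp (K * ∑ i ∈ Finset.range j, survProb d p (i + 1) ^ 2) := by
          rw [← Real.exp_sum, Finset.mul_sum]
      _ ≤ E := by
          apply Real.exp_le_exp.2
          exact mul_le_mul_of_nonneg_left (hsumt'.sum_le_tsum _ fun i _ => sq_nonneg _) hK0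
  set b := survProb d p 0 ^ 2 / E ^ 2 with hb
  have hbpos : 0 < b := by have := htp 0; positivity
  have ha : ∀ j, b ≤ pivotWeight d p j * (meanSize d p j * survProb d p j ^ 2) := by
    intro j
    rw [hb, div_le_iff₀ (by positivity)]
    refine (le_pivotWeight_mul hd hD hε hp hpε hS j).trans ?_
    have h0 := pivotWeight_nonneg (d := d) hp j
    have h1 := (hwp j).le
    refine mul_le_mul_of_nonneg_left ?_ (by positivity)
    exact pow_le_pow_left₀ (Finset.prod_nonneg fun i _ => by positivity) (hprod j) 2
  have hap : ∀ j, 0 < pivotWeight d p j := by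
    intro j
    have h1 := ha j
    have h2 : 0 < meanSize d p j * survProb d p j ^ 2 := by
      have := hwp j; have := htp j; positivity
    by_contra hcon
    push Not at hcon
    nlinarith
  refine ⟨⟨b * (ε / 8) * c / C2, by positivity, fun j => ?_⟩, hap, ?_⟩
  · have h1 : b * (meanSize d p j * survProb d p j)⁻¹ ≤ pivotWeight d p j * survProb d p j := by
      have hx := mul_pos (hwp j) (htp j)
      rw [← div_eq_mul_inv, div_le_iff₀ hx]
      calc b ≤ _ := ha j
        _ = _ := by ring
    refine le_trans ?_ h1
    have h2 := sizeTail_le hd hε hε1 hp hpε hS j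
    have h3 : c / (C2 * (j + 1)) ≤ sizeTail d p j := by
      rw [div_le_iff₀ (by positivity)]
      have a1 := hct j
      have a2 := hCsq j
      have a3 : (0 : ℝ) < j + 1 := by positivity
      have a4 := (sizeTail_pos hd hp hS j).le
      have a5 : c * (j + 1) ≤ C2 * (j + 1) ^ 2 * sizeTail d p j :=
        a1.trans (mul_le_mul_of_nonneg_right a2 a4)
      refine le_of_mul_le_mul_right ?_ a3
      calc _ ≤ _ := a5
        _ = _ := by ring
    calc _ = b * (ε / 8 * (c / (C2 * (j + 1)))) := by field_simp
      _ ≤ b * (ε / 8 * sizeTail d p j) := by gcongr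
      _ ≤ _ := by gcongr
  · refine Summable.of_nonneg_of_le (fun j => ?_) (fun j => ?_)
      (hw.summable_div.mul_left (b⁻¹ * (ε / 8 * c)⁻¹ ^ 2))
    · have := hap j
      positivity
    · have h1 : (pivotWeight d p j)⁻¹ ≤ b⁻¹ * (meanSize d p j * survProb d p j ^ 2) := by
        rw [inv_mul_eq_div, le_div_iff₀ hbpos, inv_mul_le_iff₀ (hap j)]
        exact ha j
      rw [mul_inv]
      have a3 : (0 : ℝ) < j + 1 := by positivity
      have hwj := (hwp j).le
      calc _ ≤ ((j : ℝ) + 1)⁻¹ * (b⁻¹ * (meanSize d p j * ((ε / 8 * c)⁻¹ ^ 2 *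
            (1 / ((j : ℝ) + 1) ^ 2)))) := by
            refine mul_le_mul_of_nonneg_left (h1.trans ?_) (inv_nonneg.2 a3.le)
            exact mul_le_mul_of_nonneg_left (mul_le_mul_of_nonneg_left (htsq j) hwj)
              (inv_nonneg.2 hbpos.le)
        _ = _ := by field_simp

end

lemma SubquadraticGrowth.of_isTheta {w F : ℕ → ℝ} {r : ℝ} (hw : ∀ n, 0 < w n)
    (h : w =Θ[atTop] F) (hs2 : r < 2)
    (hdoub : ∃ C > 0, ∀ᶠ j : ℕ in atTop, ∀ i, j ≤ i → i ≤ 2 * j → |F i| ≤ C * |F j|)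
    (hF : F =O[atTop] fun k : ℕ => (k : ℝ) ^ r) (hsum : Summable fun k => (F k)⁻¹) :
    SubquadraticGrowth w := by
  have hS : Summable fun n => (w n)⁻¹ := summable_of_isBigO_nat hsum h.inv.isBigO
  have hwO : w =O[atTop] fun k : ℕ => (k : ℝ) ^ r := h.1.trans hF
  have hcmp : ∀ (b : ℝ), (fun k : ℕ => (k : ℝ) ^ b) =O[atTop] fun k : ℕ => ((k : ℝ) + 1) ^ b := by
    intro b
    refine IsBigO.of_bound (2 ^ |b|) ?_
    filter_upwards [eventually_ge_atTop 1] with k hk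
    have hk' : (1 : ℝ) ≤ k := by exact_mod_cast hk
    rw [Real.norm_of_nonneg (by positivity), Real.norm_of_nonneg (by positivity)]
    rcases le_total 0 b with hb | hb
    · calc (k : ℝ) ^ b ≤ ((k : ℝ) + 1) ^ b := by gcongr; linarith
        _ ≤ _ := le_mul_of_one_le_left (by positivity)
          (Real.one_le_rpow (by norm_num) (abs_nonneg b))
    · rw [abs_of_nonpos hb]
      have : ((k : ℝ) + 1) ^ (-b) ≤ 2 ^ (-b) * (k : ℝ) ^ (-b) := by
        rw [← Real.mul_rpow (by norm_num) (by linarith)]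
        exact Real.rpow_le_rpow (by linarith) (by linarith) (by linarith)
      rw [Real.rpow_neg (by linarith), Real.rpow_neg (by linarith) b] at this
      have h1 : 0 < (k : ℝ) ^ b := by positivity
      have h2 : 0 < ((k : ℝ) + 1) ^ b := by positivity
      rw [Real.rpow_neg (by norm_num)]
      rw [Real.rpow_neg (by norm_num)] at this
      have h3 := mul_le_mul_of_nonneg_left this (mul_pos h1 h2).le
      field_simp at h3 ⊢
      linarith
  refine ⟨hS, ?_, ?_, ?_⟩
  · obtain ⟨C, hC, hd⟩ := hdoub
    obtain ⟨c1, hc1, h1⟩ := h.1.exists_pos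
    obtain ⟨c2, hc2, h2⟩ := h.2.exists_pos
    have hS' : ∀ j, Summable fun i => (w (j + i))⁻¹ := fun j => by
      simpa [add_comm] using (summable_nat_add_iff j).2 hS
    have key : (fun j : ℕ => (j : ℝ) + 1) =O[atTop] fun j => w j * ∑' i, (w (j + i))⁻¹ := by
      refine IsBigO.of_bound (c1 * C * c2) ?_
      obtain ⟨N1, hN1⟩ := eventually_atTop.1 h1.bound
      obtain ⟨N2, hN2⟩ := eventually_atTop.1 h2.bound
      filter_upwards [eventually_ge_atTop N1, eventually_ge_atTop N2, hd] with j hj1 hj2 hd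
      have hle : ∀ i ∈ Finset.range (j + 1), (c1 * C * c2 * w j)⁻¹ ≤ (w (j + i))⁻¹ := by
        intro i hi
        have hi' := Finset.mem_range.1 hi
        refine inv_anti₀ (hw _) ?_
        have a1 := hN1 (j + i) (by omega)
        have a2 := hN2 j hj2
        have a3 := hd (j + i) (by omega) (by omega)
        rw [Real.norm_of_nonneg (hw _).le, Real.norm_eq_abs] at a1
        rw [Real.norm_of_nonneg (hw _).le, Real.norm_eq_abs] at a2
        calc w (j + i) ≤ c1 * |F (j + i)| := a1
          _ ≤ c1 * (C * |F j|) := by gcongr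
          _ ≤ c1 * (C * (c2 * w j)) := by gcongr
          _ = _ := by ring
      have h5 : ((j : ℝ) + 1) * (c1 * C * c2 * w j)⁻¹ ≤ ∑' i, (w (j + i))⁻¹ := by
        calc _ = ∑ i ∈ Finset.range (j + 1), (c1 * C * c2 * w j)⁻¹ := by simp
          _ ≤ ∑ i ∈ Finset.range (j + 1), (w (j + i))⁻¹ := Finset.sum_le_sum hle
          _ ≤ _ := (hS' j).sum_le_tsum _ fun i _ => (inv_pos.2 (hw _)).le
      have hwj := hw j
      have h6 : 0 ≤ ∑' i, (w (j + i))⁻¹ := tsum_nonneg fun i => (inv_pos.2 (hw _)).le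
      rw [Real.norm_of_nonneg (by positivity), Real.norm_of_nonneg (by positivity)]
      rw [← div_eq_mul_inv, div_le_iff₀ (by positivity)] at h5
      linarith
    obtain ⟨C', hC', hb⟩ := bound_of_isBigO_nat_atTop key
    have hpos : ∀ j, 0 < w j * ∑' i, (w (j + i))⁻¹ := fun j =>
      mul_pos (hw j) ((hS' j).tsum_pos (fun i => (inv_pos.2 (hw _)).le) 0 (inv_pos.2 (hw _)))
    refine ⟨C'⁻¹, inv_pos.2 hC', fun j => ?_⟩
    have := hb (hpos j).ne'
    rw [Real.norm_of_nonneg (by positivity), Real.norm_of_nonneg (hpos j).le] at this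
    rw [inv_mul_le_iff₀ hC']
    exact this
  · have h1 : (fun j : ℕ => w j / ((j : ℝ) + 1) ^ 3) =O[atTop]
        fun j : ℕ => (j : ℝ) ^ (r - 3) := by
      have h2 : (fun j : ℕ => (((j : ℝ) + 1) ^ 3)⁻¹) =O[atTop] fun j : ℕ => (j : ℝ) ^ (-3 : ℝ) := by
        refine IsBigO.of_bound 1 ?_
        filter_upwards [eventually_ge_atTop 1] with k hk
        have hk' : (0 : ℝ) < k := by exact_mod_cast hk
        rw [Real.norm_of_nonneg (by positivity), Real.norm_of_nonneg (by positivity), one_mul,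
          Real.rpow_neg hk'.le]
        norm_cast
        gcongr
        omega
      refine (hwO.mul h2).congr' (EventuallyEq.of_eq rfl) ?_
      filter_upwards [eventually_ge_atTop 1] with k hk
      have hk' : (0 : ℝ) < k := by exact_mod_cast hk
      rw [← Real.rpow_add hk', sub_eq_add_neg]
    exact summable_of_isBigO_nat (Real.summable_nat_rpow.2 (by linarith : r - 3 < -1)) h1
  · have h1 : w =O[atTop] fun j : ℕ => ((j : ℝ) + 1) ^ 2 := by
      refine (hwO.trans (hcmp r)).trans (IsBigO.of_bound 1 ?_)
      filter_upwards with k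
      rw [Real.norm_of_nonneg (by positivity), Real.norm_of_nonneg (by positivity), one_mul,
        ← Real.rpow_natCast]
      exact Real.rpow_le_rpow_of_exponent_le (by linarith [Nat.cast_nonneg (α := ℝ) k])
        (by push_cast; linarith)
    obtain ⟨C, hC, hb⟩ := bound_of_isBigO_nat_atTop h1
    refine ⟨C, hC, fun j => ?_⟩
    have := hb (x := j) (by positivity)
    rwa [Real.norm_of_nonneg (hw j).le, Real.norm_of_nonneg (by positivity)] at this

lemma SubquadraticGrowth.of_isTheta_rpow {w : ℕ → ℝ} {θ : ℝ} (hw : ∀ n, 0 < w n) (h1 : 1 < θ)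
    (h2 : θ < 2) (h : w =Θ[atTop] fun k : ℕ => (k : ℝ) ^ θ) : SubquadraticGrowth w := by
  refine .of_isTheta hw h h2 ⟨2 ^ θ, by positivity, Eventually.of_forall fun j i hji hij => ?_⟩
    (isBigO_refl _ _) ?_
  · rw [abs_of_nonneg (by positivity), abs_of_nonneg (by positivity),
      ← Real.mul_rpow (by norm_num) (by positivity)]
    gcongr
    exact_mod_cast hij
  · exact Real.summable_nat_rpow_inv.2 h1

lemma summable_inv_mul_log_rpow {θ : ℝ} (h1 : 1 < θ) :
    Summable fun k : ℕ => ((k : ℝ) * Real.log k ^ θ)⁻¹ := by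
  rw [← summable_condensed_iff_of_eventually_nonneg]
  · have : Summable fun k : ℕ => (Real.log 2 ^ θ)⁻¹ * ((k : ℝ) ^ θ)⁻¹ :=
      (Real.summable_nat_rpow_inv.2 h1).mul_left _
    refine this.congr fun k => ?_
    push_cast
    have hl : 0 < Real.log 2 := Real.log_pos (by norm_num)
    rw [Real.log_pow, Real.mul_rpow (by positivity) hl.le]
    field_simp
  · filter_upwards [eventually_ge_atTop 1] with k hk
    have : 0 ≤ Real.log k := Real.log_nonneg (by exact_mod_cast hk)
    simp only [Pi.zero_apply]
    positivity
  · filter_upwards [eventually_ge_atTop 2] with k hk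
    have hk' : (2 : ℝ) ≤ k := by exact_mod_cast hk
    have : 0 < Real.log k := Real.log_pos (by linarith)
    have h3 : Real.log k ≤ Real.log (k + 1 : ℕ) :=
      Real.log_le_log (by linarith) (by push_cast; linarith)
    gcongr
    linarith

lemma SubquadraticGrowth.of_isTheta_log {w : ℕ → ℝ} {θ : ℝ} (hw : ∀ n, 0 < w n) (h1 : 1 < θ)
    (h : w =Θ[atTop] fun k : ℕ => (k : ℝ) * Real.log k ^ θ) : SubquadraticGrowth w := by
  refine .of_isTheta hw h (r := 3 / 2) (by norm_num)
    ⟨2 * 2 ^ θ, by positivity, ?_⟩ ?_ (summable_inv_mul_log_rpow h1)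
  · filter_upwards [eventually_ge_atTop 2] with j hj i hji hij
    have hj' : (2 : ℝ) ≤ j := by exact_mod_cast hj
    have hji' : (j : ℝ) ≤ i := by exact_mod_cast hji
    have hij' : (i : ℝ) ≤ 2 * j := by exact_mod_cast hij
    have l0 : 0 < Real.log j := Real.log_pos (by linarith)
    have l1 : 0 ≤ Real.log i := Real.log_nonneg (by linarith)
    have l2 : Real.log i ≤ 2 * Real.log j := by
      calc Real.log i ≤ Real.log (2 * j) := Real.log_le_log (by linarith) hij'
        _ = Real.log 2 + Real.log j := Real.log_mul (by norm_num) (by linarith)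
        _ ≤ Real.log j + Real.log j := by gcongr
        _ = _ := by ring
    rw [abs_of_nonneg (by positivity), abs_of_nonneg (by positivity)]
    calc (i : ℝ) * Real.log i ^ θ ≤ (2 * j) * (2 * Real.log j) ^ θ := by gcongr
      _ = _ := by rw [Real.mul_rpow (by norm_num) l0.le]; ring
  · have h2 : (fun k : ℕ => Real.log k ^ θ) =O[atTop] fun k : ℕ => (k : ℝ) ^ (1 / 2 : ℝ) :=
      ((isLittleO_log_rpow_rpow_atTop θ (by norm_num : (0 : ℝ) < 1 / 2)).comp_tendsto
        tendsto_natCast_atTop_atTop).isBigO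
    refine ((isBigO_refl (fun k : ℕ => (k : ℝ)) atTop).mul h2).congr' (EventuallyEq.of_eq rfl) ?_
    filter_upwards [eventually_ge_atTop 1] with k hk
    have hk' : (0 : ℝ) < k := by exact_mod_cast hk
    nth_rewrite 1 [← Real.rpow_one (k : ℝ)]
    rw [← Real.rpow_add hk']
    norm_num

lemma summable_mul_inv_of_isTheta_rpow {w : ℕ → ℝ} {θ : ℝ} (hθ : 2 < θ)
    (h : w =Θ[atTop] fun k : ℕ => (k : ℝ) ^ θ) : Summable fun k : ℕ => (k : ℝ) * (w k)⁻¹ := by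
  have h1 : (fun k : ℕ => (k : ℝ) * (w k)⁻¹) =O[atTop] fun k : ℕ => (k : ℝ) ^ (1 - θ) := by
    refine ((isBigO_refl (fun k : ℕ => (k : ℝ)) atTop).mul h.inv.isBigO).congr'
      (EventuallyEq.of_eq rfl) ?_
    filter_upwards [eventually_ge_atTop 1] with k hk
    have hk' : (0 : ℝ) < k := by exact_mod_cast hk
    rw [Real.rpow_sub hk', Real.rpow_one, div_eq_mul_inv]
  exact summable_of_isBigO_nat (Real.summable_nat_rpow.2 (by linarith)) h1

/-! ### The evolution of a single edge -/

lemma edgeGenerator_mul_self (q : I) : edgeGenerator q * edgeGenerator q = -edgeGenerator q := by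
  ext a b
  cases a <;> cases b <;> simp [edgeGenerator, Matrix.mul_apply] <;> ring

lemma exp_smul_edgeGenerator (q : I) (t : ℝ) : NormedSpace.exp (t • edgeGenerator q) =
    1 + (1 - Real.exp (-t)) • edgeGenerator q := by
  have hpow : ∀ n : ℕ, edgeGenerator q ^ (n + 1) = (-1 : ℝ) ^ n • edgeGenerator q := by
    intro n
    induction n with
    | zero => simp
    | succ n ih => rw [pow_succ, ih, smul_mul_assoc, edgeGenerator_mul_self, pow_succ]; simp
  have h1 : HasSum (fun n : ℕ => (-t) ^ n / (n.factorial : ℝ)) (Real.exp (-t)) := by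
    rw [Real.exp_eq_exp_ℝ]
    exact NormedSpace.expSeries_div_hasSum_exp (-t)
  have h2 : HasSum (fun n : ℕ => ((n.factorial : ℝ))⁻¹ • (t • edgeGenerator q) ^ n)
      (-(Real.exp (-t) • edgeGenerator q) + (1 + edgeGenerator q)) := by
    have h3 : HasSum (fun n : ℕ => if n = 0 then (1 + edgeGenerator q) else 0)
      (1 + edgeGenerator q) := hasSum_ite_eq 0 _
    refine ((h1.smul_const (edgeGenerator q)).neg.add h3).congr_fun ?_
    intro n
    cases n with
    | zero => simp
    | succ n =>
      simp only [Nat.add_eq_zero_iff, one_ne_zero, and_false, if_false, add_zero]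
      rw [smul_pow, hpow, smul_smul, smul_smul, ← neg_smul]
      congr 1
      rw [neg_pow t, pow_succ (-1 : ℝ)]
      ring
  rw [NormedSpace.exp_eq_tsum ℝ]
  refine h2.tsum_eq.trans ?_
  rw [sub_smul, one_smul]
  abel

/-- The stationary distribution of a single edge. -/
noncomputable def edgeLaw (q : I) (a : Bool) : ℝ := if a then (q : ℝ) else 1 - q

/-- The transition probabilities of a single edge. -/
noncomputable def edgeTransition (q : I) (t : ℝ) (a b : Bool) : ℝ :=
  (1 + (1 - Real.exp (-t)) • edgeGenerator q) a b

section
variable {Ω : Type*} [MeasurableSpace Ω] {P : Measure Ω} [IsProbabilityMeasure P]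

lemma bernoulli_real_singleton (q : I) (a : Bool) :
    (bernoulliMeasure true false q).real {a} = edgeLaw q a := by
  rw [bernoulliMeasure_real_apply q (measurableSet_singleton a)]
  cases a <;> simp [edgeLaw]

lemma IsMarkovChain.real_eq {q : I} {X : ℝ≥0 → Ω → Bool}
    (hX : IsMarkovChain P (bernoulliMeasure true false q) (edgeGenerator q) X) (n : ℕ)
    (t : Fin (n + 1) → ℝ≥0) (a : Fin (n + 1) → Bool) (ht : Monotone t) :
    P.real {ω | ∀ i, X (t i) ω = a i} = edgeLaw q (a 0) *
      ∏ i : Fin n, edgeTransition q ((t i.succ : ℝ) - t i.castSucc) (a i.castSucc) (a i.succ) := by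
  have hmeas : ∀ s b, MeasurableSet {ω | X s ω = b} := fun s b =>
    hX.measurable s (measurableSet_singleton b)
  have hset : MeasurableSet {ω | ∀ i, X (t i) ω = a i} := by
    rw [Set.ofPred_forall]; exact MeasurableSet.iInter fun i => hmeas _ _
  have hsplit : P.real {ω | ∀ i, X (t i) ω = a i} =
      P.real {ω | (∀ i, X (t i) ω = a i) ∧ X 0 ω = true} +
      P.real {ω | (∀ i, X (t i) ω = a i) ∧ X 0 ω = false} := by
    rw [← measureReal_inter_add_sdiff (μ := P) (ht := hmeas 0 true)]
    congr 2
    ext ω; simp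
  have hmono : Monotone (Fin.cons 0 t : Fin (n + 2) → ℝ≥0) := by
    rw [Fin.monotone_iff_le_succ]
    intro i
    refine Fin.cases ?_ (fun j => ?_) i
    · simp
    · rw [Fin.cons_succ, ← Fin.succ_castSucc, Fin.cons_succ]
      exact ht (Fin.castSucc_le_succ j)
  have hb : ∀ b : Bool, P.real {ω | (∀ i, X (t i) ω = a i) ∧ X 0 ω = b} =
      edgeLaw q b * (edgeTransition q (t 0) b (a 0) *
      ∏ i : Fin n, edgeTransition q ((t i.succ : ℝ) - t i.castSucc) (a i.castSucc) (a i.succ)) := by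
    intro b
    have h := hX.finite_dim (n + 1) (Fin.cons 0 t) (Fin.cons b a) hmono (by simp)
    rw [Fin.prod_univ_succ] at h
    simp only [exp_smul_edgeGenerator, Fin.cons_zero, Fin.cons_succ, Fin.castSucc_zero,
      ← Fin.succ_castSucc, bernoulli_real_singleton, NNReal.coe_zero, sub_zero] at h
    rw [← edgeTransition] at h
    rw [show {ω | (∀ i, X (t i) ω = a i) ∧ X 0 ω = b} =
      {ω | ∀ i, X ((Fin.cons 0 t : Fin (n + 2) → ℝ≥0) i) ω =
        (Fin.cons b a : Fin (n + 2) → Bool) i} from ?_, h]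
    · rfl
    · ext ω
      simp only [Set.mem_ofPred_eq, Fin.forall_fin_succ (n := n + 1), Fin.cons_zero, Fin.cons_succ]
      tauto
  rw [hsplit, hb, hb, ← mul_assoc, ← mul_assoc, ← add_mul]
  congr 1
  cases a 0 <;> simp [edgeLaw, edgeTransition, edgeGenerator] <;> ring

lemma IsMarkovChain.real_one {q : I} {X : ℝ≥0 → Ω → Bool}
    (hX : IsMarkovChain P (bernoulliMeasure true false q) (edgeGenerator q) X)
    (t : ℝ≥0) (a : Bool) :
    P.real {ω | X t ω = a} = edgeLaw q a := by
  have := hX.real_eq 0 ![t] ![a] (by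
    intro a b _; rw [Subsingleton.elim (α := Fin 1) a b])
  simpa using this

lemma IsMarkovChain.real_two {q : I} {X : ℝ≥0 → Ω → Bool}
    (hX : IsMarkovChain P (bernoulliMeasure true false q) (edgeGenerator q) X)
    {s t : ℝ≥0} (hst : s ≤ t) (a b : Bool) :
    P.real {ω | X s ω = a ∧ X t ω = b} =
      edgeLaw q a * edgeTransition q ((t : ℝ) - s) a b := by
  have := hX.real_eq 1 ![s, t] ![a, b] (by
    rw [Fin.monotone_iff_le_succ]; intro i; fin_cases i; simpa using hst)
  simpa [Fin.forall_fin_two, -ite_mul] using this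

lemma IsMarkovChain.real_four {q : I} {X : ℝ≥0 → Ω → Bool}
    (hX : IsMarkovChain P (bernoulliMeasure true false q) (edgeGenerator q) X)
    {s s' t t' : ℝ≥0} (h1 : s ≤ s') (h2 : s' ≤ t) (h3 : t ≤ t')
    (a a' b b' : Bool) :
    P.real {ω | X s ω = a ∧ X s' ω = a' ∧ X t ω = b ∧ X t' ω = b'} =
      edgeLaw q a * (edgeTransition q ((s' : ℝ) - s) a a' *
        edgeTransition q ((t : ℝ) - s') a' b * edgeTransition q ((t' : ℝ) - t) b b') := by
  have := hX.real_eq 3 ![s, s', t, t'] ![a, a', b, b'] (by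
    rw [Fin.monotone_iff_le_succ]; intro i; fin_cases i <;> simp [h1, h2, h3])
  simpa [Fin.forall_fin_succ, Fin.prod_univ_succ, mul_assoc, -ite_mul] using this

end

lemma one_sub_exp_neg_mem {t : ℝ} (ht : 0 ≤ t) :
    0 ≤ 1 - Real.exp (-t) ∧ 1 - Real.exp (-t) ≤ 1 ∧ 1 - Real.exp (-t) ≤ t := by
  have := Real.exp_pos (-t)
  have h1 : Real.exp (-t) ≤ 1 := Real.exp_le_one_iff.2 (by linarith)
  have h2 := Real.add_one_le_exp (-t)
  refine ⟨by linarith, by linarith, by linarith⟩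

/-! ### Regularity of the paths -/

/-- A right continuous path with left limits in a discrete space. -/
structure IsRegularPath (x : ℝ≥0 → Bool) : Prop where
  right : ∀ t, ∀ᶠ s in 𝓝[≥] t, x s = x t
  left : ∀ t, ∃ b, ∀ᶠ s in 𝓝[<] t, x s = b

lemma IsRegularPath.exists_left {x : ℝ≥0 → Bool} (hx : IsRegularPath x) {t : ℝ≥0}
    (ht : ¬ ContinuousAt x t) : ∀ᶠ s in 𝓝[<] t, x s ≠ x t := by
  obtain ⟨b, hb⟩ := hx.left t
  have hne : b ≠ x t := by
    rintro rfl
    apply ht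
    rw [ContinuousAt, nhds_discrete Bool, tendsto_pure, ← nhdsLT_sup_nhdsGE t, eventually_sup]
    exact ⟨hb, hx.right t⟩
  filter_upwards [hb] with s hs
  rwa [hs]

lemma IsRegularPath.pos_of_not_continuousAt {x : ℝ≥0 → Bool} (hx : IsRegularPath x) {t : ℝ≥0}
    (ht : ¬ ContinuousAt x t) : 0 < t := by
  by_contra h0
  have h0 : t = 0 := le_antisymm (not_lt.1 h0) (zero_le)
  subst h0
  apply ht
  rw [ContinuousAt, nhds_discrete Bool, tendsto_pure]
  have := hx.right 0
  rwa [show Set.Ici (0 : ℝ≥0) = Set.univ from by ext; simp, nhdsWithin_univ] at this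

lemma exists_Ioo_left {t : ℝ≥0} (ht : 0 < t) {A : ℝ≥0 → Prop} (h : ∀ᶠ s in 𝓝[<] t, A s) :
    ∃ a < t, ∀ s, a < s → s < t → A s := by
  obtain ⟨a, ha, hs⟩ := (mem_nhdsLT_iff_exists_Ioo_subset' ht).1 h
  exact ⟨a, ha, fun s h1 h2 => hs ⟨h1, h2⟩⟩

lemma exists_Ico_right {t : ℝ≥0} {A : ℝ≥0 → Prop} (h : ∀ᶠ s in 𝓝[≥] t, A s) :
    ∃ b > t, ∀ s, t ≤ s → s < b → A s := by
  obtain ⟨b, hb, hs⟩ := (mem_nhdsGE_iff_exists_Ico_subset' (show t < t + 1 by simp)).1 h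
  exact ⟨b, hb, fun s h1 h2 => hs ⟨h1, h2⟩⟩

/-- The points of an equidistant grid. -/
noncomputable def gridTime (N i : ℕ) : ℝ≥0 := (i : ℝ≥0) / N

lemma gridTime_mono (N : ℕ) : Monotone (gridTime N) := by
  intro i j hij
  unfold gridTime
  gcongr

lemma gridTime_succ_sub {N : ℕ} (i : ℕ) :
    ((gridTime N (i + 1) : ℝ≥0) : ℝ) - gridTime N i = 1 / N := by
  simp only [gridTime]
  push_cast
  ring

/-- Fine grids separate the two sides of a point. -/
lemma eventually_exists_grid {t a b : ℝ≥0} (ht0 : 0 < t) (ht1 : t ≤ 1) (ha : a < t) (hb : t < b) :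
    ∀ᶠ N : ℕ in atTop, ∃ i < N, a < gridTime N i ∧ gridTime N i < t ∧ t ≤ gridTime N (i + 1) ∧
      gridTime N (i + 1) < b := by
  have h1 : ∀ᶠ N : ℕ in atTop, (1 : ℝ) / N < min ((t : ℝ) - a) (b - t) := by
    have h0 : (0 : ℝ) < min ((t : ℝ) - a) (b - t) :=
      lt_min (sub_pos.2 (by exact_mod_cast ha)) (sub_pos.2 (by exact_mod_cast hb))
    exact (tendsto_one_div_atTop_nhds_zero_nat).eventually_lt_const h0
  filter_upwards [h1, eventually_ge_atTop 1] with N hN hN1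
  have hN0 : (0 : ℝ) < N := by exact_mod_cast hN1
  have ht0' : (0 : ℝ) < t := by exact_mod_cast ht0
  have ht1' : (t : ℝ) ≤ 1 := by exact_mod_cast ht1
  obtain ⟨h2, h3⟩ := lt_min_iff.1 hN
  have hc : 0 < ⌈(t : ℝ) * N⌉₊ := Nat.ceil_pos.2 (by positivity)
  obtain ⟨i, hi⟩ : ∃ i, ⌈(t : ℝ) * N⌉₊ = i + 1 := ⟨_, (Nat.succ_pred_eq_of_pos hc).symm⟩
  have hle : (t : ℝ) * N ≤ (i : ℝ) + 1 := by
    have := Nat.le_ceil ((t : ℝ) * N); rw [hi] at this; exact_mod_cast this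
  have hlt : (i : ℝ) < t * N := by
    have := Nat.ceil_lt_add_one (show 0 ≤ (t : ℝ) * N by positivity)
    rw [hi] at this; push_cast at this; linarith
  have g : ∀ k : ℕ, ((gridTime N k : ℝ≥0) : ℝ) = k / N := fun k => by simp [gridTime]
  have e1 : (i : ℝ) / N < t := by rw [div_lt_iff₀ hN0]; exact hlt
  have e2 : (t : ℝ) ≤ ((i + 1 : ℕ) : ℝ) / N := by
    rw [le_div_iff₀ hN0]; push_cast; exact hle
  have e3 : ((i + 1 : ℕ) : ℝ) / N = i / N + 1 / N := by push_cast; ring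
  refine ⟨i, ?_, ?_, ?_, ?_, ?_⟩
  · have : (i : ℝ) < N := by nlinarith
    exact_mod_cast this
  · rw [← NNReal.coe_lt_coe, g]; linarith
  · rw [← NNReal.coe_lt_coe, g]; linarith
  · rw [← NNReal.coe_le_coe, g]; linarith
  · rw [← NNReal.coe_lt_coe, g]; linarith

section
variable {Ω : Type*} [MeasurableSpace Ω] {P : Measure Ω}

lemma measure_eventually_mem_eq_zero {A : ℕ → Set Ω}
    (h : Tendsto (fun n => P (A n)) atTop (𝓝 0)) : P {ω | ∀ᶠ n in atTop, ω ∈ A n} = 0 := by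
  have : {ω | ∀ᶠ n in atTop, ω ∈ A n} = ⋃ N, ⋂ n ≥ N, A n := by
    ext ω; simp [eventually_atTop]
  rw [this, measure_iUnion_null_iff]
  intro N
  refine le_antisymm (ge_of_tendsto h ?_) (zero_le)
  filter_upwards [eventually_ge_atTop N] with n hn
  exact measure_mono (Set.iInter₂_subset n hn)

lemma IsMarkovChain.isRegularPath {q : I} {X : ℝ≥0 → Ω → Bool}
    (hX : IsMarkovChain P (bernoulliMeasure true false q) (edgeGenerator q) X) :
    ∀ᵐ ω ∂P, IsRegularPath fun t => X t ω := by
  filter_upwards [hX.right_cont, hX.left_lim] with ω h1 h2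
  refine ⟨fun t => ?_, fun t => ?_⟩
  · have := h1 t
    rwa [ContinuousWithinAt, nhds_discrete Bool, tendsto_pure] at this
  · obtain ⟨b, hb⟩ := h2 t
    exact ⟨b, by rwa [nhds_discrete Bool, tendsto_pure] at hb⟩

lemma IsMarkovChain.measurableSet_ne {q : I} {X : ℝ≥0 → Ω → Bool}
    (hX : IsMarkovChain P (bernoulliMeasure true false q) (edgeGenerator q) X) (s t : ℝ≥0) :
    MeasurableSet {ω | X s ω ≠ X t ω} :=
  (measurableSet_eq_fun (hX.measurable s) (hX.measurable t)).compl

lemma IsMarkovChain.real_ne_le [IsProbabilityMeasure P] {q : I} {X : ℝ≥0 → Ω → Bool}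
    (hX : IsMarkovChain P (bernoulliMeasure true false q) (edgeGenerator q) X) {s t : ℝ≥0}
    (hst : s ≤ t) : P.real {ω | X s ω ≠ X t ω} ≤ 2 * q * ((t : ℝ) - s) := by
  have h : {ω | X s ω ≠ X t ω} ⊆ {ω | X s ω = true ∧ X t ω = false} ∪
      {ω | X s ω = false ∧ X t ω = true} := by
    intro ω
    simp only [Set.mem_ofPred_eq, Set.mem_union]
    cases X s ω <;> cases X t ω <;> simp
  refine (measureReal_mono h).trans ((measureReal_union_le _ _).trans ?_)
  rw [hX.real_two hst, hX.real_two hst]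
  have hd : (0 : ℝ) ≤ (t : ℝ) - s := sub_nonneg.2 (by exact_mod_cast hst)
  obtain ⟨h1, h2, h3⟩ := one_sub_exp_neg_mem hd
  have q0 := q.2.1
  have q1 := q.2.2
  simp only [edgeLaw, edgeTransition, edgeGenerator, Matrix.add_apply, Matrix.smul_apply,
    Matrix.of_apply, Matrix.one_apply, smul_eq_mul, reduceCtorEq, if_false, zero_add, if_true]
  set u := 1 - Real.exp (-((t : ℝ) - s))
  have : (q : ℝ) * u ≤ q * ((t : ℝ) - s) := by gcongr
  have : 0 ≤ (q : ℝ) * u * q := by positivity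
  nlinarith

lemma IsMarkovChain.ae_continuousAt [IsProbabilityMeasure P] {q : I} {X : ℝ≥0 → Ω → Bool}
    (hX : IsMarkovChain P (bernoulliMeasure true false q) (edgeGenerator q) X) (t : ℝ≥0) :
    ∀ᵐ ω ∂P, ContinuousAt (fun s => X s ω) t := by
  rcases eq_or_ne t 0 with rfl | h0
  · filter_upwards [hX.isRegularPath] with ω hω
    by_contra hcon
    exact lt_irrefl _ (hω.pos_of_not_continuousAt hcon)
  have ht : 0 < t := pos_iff_ne_zero.2 h0
  obtain ⟨u, -, hu, hlim⟩ := exists_seq_strictMono_tendsto' ht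
  have hlim0 : Tendsto (fun n => P {ω | X (u n) ω ≠ X t ω}) atTop (𝓝 0) := by
    have h1 : Tendsto (fun n => ENNReal.ofReal (2 * q * ((t : ℝ) - u n))) atTop (𝓝 0) := by
      rw [← ENNReal.ofReal_zero]
      apply ENNReal.tendsto_ofReal
      have : Tendsto (fun n => 2 * (q : ℝ) * ((t : ℝ) - u n)) atTop (𝓝 (2 * q * (t - t))) :=
        ((NNReal.tendsto_coe.2 hlim).const_sub _).const_mul _
      simpa using this
    refine tendsto_of_tendsto_of_tendsto_of_le_of_le tendsto_const_nhds h1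
      (fun _ => zero_le) fun n => ?_
    rw [← ofReal_measureReal (measure_ne_top _ _)]
    exact ENNReal.ofReal_le_ofReal (hX.real_ne_le (hu n).2.le)
  have hz := measure_eventually_mem_eq_zero hlim0
  filter_upwards [hX.isRegularPath, measure_eq_zero_iff_ae_notMem.1 hz] with ω hω hω'
  by_contra hcon
  apply hω'
  have := hω.exists_left hcon
  exact (tendsto_nhdsWithin_iff.2 ⟨hlim, Eventually.of_forall fun n => (hu n).2⟩).eventually this

/-- Two independent edges almost surely do not switch simultaneously. -/
lemma ae_not_simultaneous [IsProbabilityMeasure P] {q r : I} {X Y : ℝ≥0 → Ω → Bool}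
    (hX : IsMarkovChain P (bernoulliMeasure true false q) (edgeGenerator q) X)
    (hY : IsMarkovChain P (bernoulliMeasure true false r) (edgeGenerator r) Y)
    (hXY : IndepFun (fun ω t => X t ω) (fun ω t => Y t ω) P) :
    ∀ᵐ ω ∂P, ∀ t ≤ 1, ContinuousAt (fun s => X s ω) t ∨ ContinuousAt (fun s => Y s ω) t := by
  set A : ℕ → Set Ω := fun N => ⋃ i ∈ Finset.range N,
    ({ω | X (gridTime N i) ω ≠ X (gridTime N (i + 1)) ω} ∩
      {ω | Y (gridTime N i) ω ≠ Y (gridTime N (i + 1)) ω}) with hA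
  have hlim : Tendsto (fun N => P (A N)) atTop (𝓝 0) := by
    have h1 : Tendsto (fun N : ℕ => ENNReal.ofReal (4 * (1 / N))) atTop (𝓝 0) := by
      rw [← ENNReal.ofReal_zero]
      apply ENNReal.tendsto_ofReal
      simpa using tendsto_one_div_atTop_nhds_zero_nat.const_mul (4 : ℝ)
    refine tendsto_of_tendsto_of_tendsto_of_le_of_le tendsto_const_nhds h1
      (fun _ => zero_le) fun N => ?_
    rw [← ofReal_measureReal (measure_ne_top _ _)]
    apply ENNReal.ofReal_le_ofReal
    refine (measureReal_biUnion_finset_le _ _).trans ?_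
    have hterm : ∀ i ∈ Finset.range N,
        P.real ({ω | X (gridTime N i) ω ≠ X (gridTime N (i + 1)) ω} ∩
          {ω | Y (gridTime N i) ω ≠ Y (gridTime N (i + 1)) ω}) ≤ 4 * (1 / N) * (1 / N) := by
      intro i _
      have hm : ∀ s t : ℝ≥0, MeasurableSet {f : ℝ≥0 → Bool | f s ≠ f t} := fun s t =>
        (measurableSet_eq_fun (measurable_pi_apply s) (measurable_pi_apply t)).compl
      have := hXY.measure_inter_preimage_eq_mul _ _
        (hm (gridTime N i) (gridTime N (i + 1))) (hm (gridTime N i) (gridTime N (i + 1)))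
      have h2 : P.real ({ω | X (gridTime N i) ω ≠ X (gridTime N (i + 1)) ω} ∩
          {ω | Y (gridTime N i) ω ≠ Y (gridTime N (i + 1)) ω}) =
          P.real {ω | X (gridTime N i) ω ≠ X (gridTime N (i + 1)) ω} *
          P.real {ω | Y (gridTime N i) ω ≠ Y (gridTime N (i + 1)) ω} := by
        simp only [Measure.real, ← ENNReal.toReal_mul]
        exact congrArg ENNReal.toReal this
      rw [h2]
      have a1 := hX.real_ne_le (gridTime_mono N (Nat.le_succ i))
      have a2 := hY.real_ne_le (gridTime_mono N (Nat.le_succ i))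
      rw [Nat.succ_eq_add_one, gridTime_succ_sub] at a1 a2
      have q1 := q.2.2
      have r1 := r.2.2
      have q0 := q.2.1
      have r0 := r.2.1
      have hN : (0 : ℝ) ≤ 1 / N := by positivity
      have b1 : 2 * (q : ℝ) * (1 / N) ≤ 2 * (1 / N) := by nlinarith
      have b2 : 2 * (r : ℝ) * (1 / N) ≤ 2 * (1 / N) := by nlinarith
      calc _ ≤ (2 * (1 / (N : ℝ))) * (2 * (1 / N)) :=
            mul_le_mul (a1.trans b1) (a2.trans b2) measureReal_nonneg (by positivity)
        _ = _ := by ring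
    refine (Finset.sum_le_sum hterm).trans ?_
    rcases Nat.eq_zero_or_pos N with rfl | hN
    · simp
    · rw [Finset.sum_const, Finset.card_range, nsmul_eq_mul]
      have : (0 : ℝ) < N := by exact_mod_cast hN
      apply le_of_eq
      field_simp
  have hz := measure_eventually_mem_eq_zero hlim
  filter_upwards [hX.isRegularPath, hY.isRegularPath, measure_eq_zero_iff_ae_notMem.1 hz]
    with ω h1 h2 h3 t ht1
  by_contra! hcon
  apply h3
  have ht0 := h1.pos_of_not_continuousAt hcon.1
  obtain ⟨a, hat, ha⟩ := exists_Ioo_left ht0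
    ((h1.exists_left hcon.1).and (h2.exists_left hcon.2))
  obtain ⟨b, hbt, hb⟩ := exists_Ico_right ((h1.right t).and (h2.right t))
  filter_upwards [eventually_exists_grid ht0 ht1 hat hbt] with N hN
  obtain ⟨i, hi, g1, g2, g3, g4⟩ := hN
  simp only [hA, Set.mem_iUnion, Finset.mem_range]
  refine ⟨i, hi, ?_, ?_⟩
  · change X _ ω ≠ X _ ω
    rw [(hb _ g3 g4).1]; exact (ha _ g1 g2).1
  · change Y _ ω ≠ Y _ ω
    rw [(hb _ g3 g4).2]; exact (ha _ g1 g2).2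

end

/-! ### Bounded functions of independent families of edges -/

section
variable {Ω E : Type*} {m : E → MeasurableSpace Ω} {S T : Set E}
  {f g : Ω → ℝ}

/-- A bounded function depending only on the coordinates in `S`. -/
structure BddOn (m : E → MeasurableSpace Ω) (S : Set E) (f : Ω → ℝ) : Prop where
  meas : Measurable[⨆ e ∈ S, m e] f
  bdd : ∃ C, ∀ ω, |f ω| ≤ C

namespace BddOn

lemma mono (hf : BddOn m S f) (hST : S ⊆ T) : BddOn m T f :=
  ⟨hf.meas.mono (biSup_mono hST) le_rfl, hf.bdd⟩

lemma const (c : ℝ) : BddOn m S fun _ : Ω => c := ⟨measurable_const, |c|, fun _ => le_rfl⟩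

lemma add (hf : BddOn m S f) (hg : BddOn m S g) : BddOn m S fun ω => f ω + g ω := by
  obtain ⟨C, hC⟩ := hf.bdd
  obtain ⟨D, hD⟩ := hg.bdd
  exact ⟨hf.meas.add hg.meas, C + D, fun ω =>
    (abs_add_le _ _).trans (add_le_add (hC ω) (hD ω))⟩

lemma mul (hf : BddOn m S f) (hg : BddOn m S g) : BddOn m S fun ω => f ω * g ω := by
  obtain ⟨C, hC⟩ := hf.bdd
  obtain ⟨D, hD⟩ := hg.bdd
  exact ⟨hf.meas.mul hg.meas, C * D, fun ω => by
    rw [abs_mul]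
    exact mul_le_mul (hC ω) (hD ω) (abs_nonneg _) ((abs_nonneg _).trans (hC ω))⟩

lemma neg (hf : BddOn m S f) : BddOn m S fun ω => -f ω := by
  obtain ⟨C, hC⟩ := hf.bdd
  exact ⟨hf.meas.neg, C, fun ω => by rw [abs_neg]; exact hC ω⟩

lemma sub (hf : BddOn m S f) (hg : BddOn m S g) : BddOn m S fun ω => f ω - g ω := by
  simpa [sub_eq_add_neg] using hf.add hg.neg

lemma abs (hf : BddOn m S f) : BddOn m S fun ω => |f ω| := by
  obtain ⟨C, hC⟩ := hf.bdd
  exact ⟨continuous_abs.measurable.comp hf.meas, C, fun ω => by rw [abs_abs]; exact hC ω⟩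

lemma sum {ι : Type*} {s : Finset ι} {φ : ι → Ω → ℝ} (h : ∀ i ∈ s, BddOn m S (φ i)) :
    BddOn m S fun ω => ∑ i ∈ s, φ i ω := by
  classical
  induction s using Finset.induction_on with
  | empty => simpa using const 0
  | insert a s ha ih =>
    simp only [Finset.sum_insert ha]
    exact (h a (Finset.mem_insert_self _ _)).add
      (ih fun i hi => h i (Finset.mem_insert_of_mem hi))

lemma prod {ι : Type*} {s : Finset ι} {φ : ι → Ω → ℝ} (h : ∀ i ∈ s, BddOn m S (φ i)) :
    BddOn m S fun ω => ∏ i ∈ s, φ i ω := by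
  classical
  induction s using Finset.induction_on with
  | empty => simpa using const 1
  | insert a s ha ih =>
    simp only [Finset.prod_insert ha]
    exact (h a (Finset.mem_insert_self _ _)).mul
      (ih fun i hi => h i (Finset.mem_insert_of_mem hi))

variable [mΩ : MeasurableSpace Ω]

lemma measurable (hf : BddOn m S f) (hm : ∀ e, m e ≤ mΩ) : Measurable f :=
  hf.meas.mono (iSup₂_le fun e _ => hm e) le_rfl

variable {P : Measure Ω}

lemma integrable [IsProbabilityMeasure P] (hf : BddOn m S f) (hm : ∀ e, m e ≤ mΩ) :
    Integrable f P := by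
  obtain ⟨C, hC⟩ := hf.bdd
  exact .of_bound (hf.measurable hm).aestronglyMeasurable C (Eventually.of_forall hC)

lemma integral_mul (hf : BddOn m S f) (hg : BddOn m T g) (hm : ∀ e, m e ≤ mΩ)
    (hi : iIndep m P) (hST : Disjoint S T) :
    ∫ ω, f ω * g ω ∂P = (∫ ω, f ω ∂P) * ∫ ω, g ω ∂P := by
  have h := indep_iSup_of_disjoint hm hi hST
  have : IndepFun f g P := by
    rw [IndepFun_iff_Indep]
    exact indep_of_indep_of_le_left (indep_of_indep_of_le_right h hg.meas.comap_le) hf.meas.comap_le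
  exact this.integral_fun_mul_eq_mul_integral (hf.measurable hm).aestronglyMeasurable
    (hg.measurable hm).aestronglyMeasurable

end BddOn

variable [mΩ : MeasurableSpace Ω] {P : Measure Ω} [IsProbabilityMeasure P] {ι : Type*} {s : Finset ι} {A : ι → Set E}

lemma disjoint_biUnion_of_pairwise {s : Finset ι} {a : ι} (ha : a ∉ s)
    (hA : ∀ i ∈ insert a (s : Set ι), ∀ j ∈ insert a (s : Set ι), i ≠ j → Disjoint (A i) (A j)) :
    Disjoint (A a) (⋃ i ∈ s, A i) := by
  rw [Set.disjoint_iUnion₂_right]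
  intro i hi
  exact hA a (Set.mem_insert _ _) i (Set.mem_insert_of_mem _ hi) (by rintro rfl; exact ha hi)

lemma integral_prod_of_disjoint {φ : ι → Ω → ℝ} (hm : ∀ e, m e ≤ mΩ) (hi : iIndep m P)
    (hφ : ∀ i ∈ s, BddOn m (A i) (φ i))
    (hA : ∀ i ∈ s, ∀ j ∈ s, i ≠ j → Disjoint (A i) (A j)) :
    ∫ ω, ∏ i ∈ s, φ i ω ∂P = ∏ i ∈ s, ∫ ω, φ i ω ∂P := by
  classical
  induction s using Finset.induction_on with
  | empty => simp
  | insert a s ha ih =>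
    simp only [Finset.prod_insert ha]
    have hs : BddOn m (⋃ i ∈ s, A i) fun ω => ∏ i ∈ s, φ i ω := BddOn.prod fun i hi =>
      (hφ i (Finset.mem_insert_of_mem hi)).mono (Set.subset_biUnion_of_mem (u := A) hi)
    rw [(hφ a (Finset.mem_insert_self _ _)).integral_mul hs hm hi
      (disjoint_biUnion_of_pairwise ha (by simpa using hA)),
      ih (fun i hi => hφ i (Finset.mem_insert_of_mem hi))
        fun i hi j hj => hA i (Finset.mem_insert_of_mem hi) j (Finset.mem_insert_of_mem hj)]

/-- The probability that a product of independent indicators changes when each factor is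
resampled. -/
lemma integral_abs_prod_sub_prod_le {φ ψ : ι → Ω → ℝ} {y D : ℝ} (hm : ∀ e, m e ≤ mΩ)
    (hi : iIndep m P)
    (hφ : ∀ i ∈ s, BddOn m (A i) (φ i)) (hψ : ∀ i ∈ s, BddOn m (A i) (ψ i))
    (hφ0 : ∀ i ∈ s, ∀ ω, 0 ≤ φ i ω) (hψ0 : ∀ i ∈ s, ∀ ω, 0 ≤ ψ i ω)
    (hφy : ∀ i ∈ s, ∫ ω, φ i ω ∂P = y) (hψy : ∀ i ∈ s, ∫ ω, ψ i ω ∂P = y) (hy : 0 ≤ y)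
    (hD : ∀ i ∈ s, ∫ ω, |φ i ω - ψ i ω| ∂P ≤ D)
    (hA : ∀ i ∈ s, ∀ j ∈ s, i ≠ j → Disjoint (A i) (A j)) :
    ∫ ω, |∏ i ∈ s, φ i ω - ∏ i ∈ s, ψ i ω| ∂P ≤ s.card * D * y ^ (s.card - 1) := by
  classical
  induction s using Finset.induction_on with
  | empty => simp
  | insert a s ha ih =>
    have ma := Finset.mem_insert_self a s
    have ms : ∀ {i}, i ∈ s → i ∈ insert a s := fun hi => Finset.mem_insert_of_mem hi
    have hdis : Disjoint (A a) (⋃ i ∈ s, A i) := disjoint_biUnion_of_pairwise ha (by simpa using hA)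
    have hsub : ∀ i ∈ s, A i ⊆ ⋃ i ∈ s, A i := fun i hi => Set.subset_biUnion_of_mem (u := A) hi
    have hs : BddOn m (⋃ i ∈ s, A i) fun ω => ∏ i ∈ s, φ i ω :=
      BddOn.prod fun i hi => (hφ i (ms hi)).mono (hsub i hi)
    have hs' : BddOn m (⋃ i ∈ s, A i) fun ω => ∏ i ∈ s, ψ i ω :=
      BddOn.prod fun i hi => (hψ i (ms hi)).mono (hsub i hi)
    have hda := ((hφ a ma).sub (hψ a ma)).abs
    have hds := (hs.sub hs').abs
    have IH := ih (fun i hi => hφ i (ms hi)) (fun i hi => hψ i (ms hi))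
      (fun i hi => hφ0 i (ms hi)) (fun i hi => hψ0 i (ms hi)) (fun i hi => hφy i (ms hi))
      (fun i hi => hψy i (ms hi)) (fun i hi => hD i (ms hi))
      (fun i hi j hj => hA i (ms hi) j (ms hj))
    have hprod : ∫ ω, ∏ i ∈ s, φ i ω ∂P = y ^ s.card := by
      rw [integral_prod_of_disjoint hm hi (fun i hi => hφ i (ms hi))
        (fun i hi j hj => hA i (ms hi) j (ms hj)),
        Finset.prod_congr rfl (fun i hi => hφy i (ms hi)), Finset.prod_const]
    have b1 : BddOn m Set.univ fun ω => |φ a ω - ψ a ω| * ∏ i ∈ s, φ i ω :=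
      (hda.mono (Set.subset_univ _)).mul (hs.mono (Set.subset_univ _))
    have b2 : BddOn m Set.univ fun ω => ψ a ω * |∏ i ∈ s, φ i ω - ∏ i ∈ s, ψ i ω| :=
      ((hψ a ma).mono (Set.subset_univ _)).mul (hds.mono (Set.subset_univ _))
    simp only [Finset.prod_insert ha, Finset.card_insert_of_notMem ha]
    calc ∫ ω, |φ a ω * ∏ i ∈ s, φ i ω - ψ a ω * ∏ i ∈ s, ψ i ω| ∂P
        ≤ ∫ ω, (|φ a ω - ψ a ω| * ∏ i ∈ s, φ i ω +
          ψ a ω * |∏ i ∈ s, φ i ω - ∏ i ∈ s, ψ i ω|) ∂P := by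
          refine integral_mono_of_nonneg (Eventually.of_forall fun ω => abs_nonneg _)
            ((b1.add b2).integrable hm) (Eventually.of_forall fun ω => ?_)
          have e : φ a ω * ∏ i ∈ s, φ i ω - ψ a ω * ∏ i ∈ s, ψ i ω =
            (φ a ω - ψ a ω) * ∏ i ∈ s, φ i ω +
              ψ a ω * (∏ i ∈ s, φ i ω - ∏ i ∈ s, ψ i ω) := by ring
          refine (congrArg _ e).le.trans ((abs_add_le _ _).trans ?_)
          rw [abs_mul, abs_mul, abs_of_nonneg (hψ0 a ma ω),
            abs_of_nonneg (Finset.prod_nonneg fun i hi => hφ0 i (ms hi) ω)]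
      _ = (∫ ω, |φ a ω - ψ a ω| ∂P) * y ^ s.card +
          y * ∫ ω, |∏ i ∈ s, φ i ω - ∏ i ∈ s, ψ i ω| ∂P := by
          rw [integral_add (b1.integrable hm) (b2.integrable hm), hda.integral_mul hs hm hi hdis,
            (hψ a ma).integral_mul hds hm hi hdis, hprod, hψy a ma]
      _ ≤ D * y ^ s.card + y * (s.card * D * y ^ (s.card - 1)) := by
          gcongr
          exact hD a ma
      _ = _ := by
          rcases Nat.eq_zero_or_pos s.card with h0 | h0
          · simp [h0]
          · obtain ⟨k, hk⟩ : ∃ k, s.card = k + 1 := ⟨s.card - 1, by omega⟩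
            rw [hk]
            push_cast
            simp only [pow_succ]
            ring

end

/-! ### Percolation on spherically symmetric trees -/

/-- The data of a rooted tree in which the vertices at level `j` have `d j` children: the children,
the edge above a vertex, the edges below a vertex and the level. -/
structure TreeData (V E : Type*) (d : ℕ → ℕ) where
  /-- the children of a vertex -/
  ch : V → Finset V
  /-- the edge above a vertex -/
  ed : V → E
  /-- the edges strictly below a vertex -/
  below : V → Set E
  /-- the level of a vertex -/
  lev : V → ℕ
  card_ch : ∀ v, (ch v).card = d (lev v)
  lev_ch : ∀ v, ∀ c ∈ ch v, lev c = lev v + 1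
  ed_mem : ∀ v, ∀ c ∈ ch v, ed c ∈ below v
  below_sub : ∀ v, ∀ c ∈ ch v, below c ⊆ below v
  ed_notMem : ∀ v, ∀ c ∈ ch v, ed c ∉ below c
  disj : ∀ v, ∀ c ∈ ch v, ∀ c' ∈ ch v, c ≠ c' →
    Disjoint (insert (ed c) (below c)) (insert (ed c') (below c'))

section
variable {V Ω E : Type*} {d : ℕ → ℕ} (T : TreeData V E d)

/-- The indicator that `v` is joined to the `n`-th generation below it, for the configuration in
which `o e` is the indicator that `e` is open. -/
def reach (o : E → Ω → ℝ) : ℕ → V → Ω → ℝ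
  | 0, _, _ => 1
  | n + 1, v, ω => 1 - ∏ c ∈ T.ch v, (1 - o (T.ed c) ω * reach o n c ω)

/-- The indicator that `v` is joined to all generations below it. -/
noncomputable def reachInf (o : E → Ω → ℝ) (v : V) (ω : Ω) : ℝ := ⨅ n, reach T o n v ω

/-- The indicators of the open edges of a random configuration. -/
structure IsConfig (m : E → MeasurableSpace Ω) (o : E → Ω → ℝ) : Prop where
  meas : ∀ e, Measurable[m e] (o e)
  zero_or_one : ∀ e ω, o e ω = 0 ∨ o e ω = 1

variable {T} {m : E → MeasurableSpace Ω} {o o' : E → Ω → ℝ}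

lemma IsConfig.bddOn (ho : IsConfig m o) {e : E} {S : Set E} (he : e ∈ S) : BddOn m S (o e) := by
  refine ⟨(ho.meas e).mono (le_iSup₂_of_le e he le_rfl) le_rfl, 1, fun ω => ?_⟩
  rcases ho.zero_or_one e ω with h | h <;> simp [h]

lemma IsConfig.univ (ho : IsConfig m o) (e : E) : BddOn m Set.univ (o e) :=
  ho.bddOn (Set.mem_univ e)

lemma IsConfig.single (ho : IsConfig m o) (e : E) : BddOn m {e} (o e) :=
  ho.bddOn (Set.mem_singleton e)

lemma IsConfig.mem (ho : IsConfig m o) (e : E) (ω : Ω) : 0 ≤ o e ω ∧ o e ω ≤ 1 := by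
  rcases ho.zero_or_one e ω with h | h <;> simp [h]

lemma prod_zero_or_one {ι : Type*} {s : Finset ι} {x : ι → ℝ} (h : ∀ i ∈ s, x i = 0 ∨ x i = 1) :
    ∏ i ∈ s, x i = 0 ∨ ∏ i ∈ s, x i = 1 := by
  by_cases h0 : ∃ i ∈ s, x i = 0
  · obtain ⟨i, hi, h0⟩ := h0
    exact Or.inl (Finset.prod_eq_zero hi h0)
  · push Not at h0
    exact Or.inr (Finset.prod_eq_one fun i hi => (h i hi).resolve_left (h0 i hi))

lemma reach_zero_or_one (ho : IsConfig m o) (n : ℕ) (v : V) (ω : Ω) :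
    reach T o n v ω = 0 ∨ reach T o n v ω = 1 := by
  induction n generalizing v with
  | zero => right; rfl
  | succ n ih =>
    rw [reach]
    have := prod_zero_or_one (s := T.ch v) (x := fun c => 1 - o (T.ed c) ω * reach T o n c ω)
      fun c _ => by
        rcases ih c with h | h <;> rcases ho.zero_or_one (T.ed c) ω with h' | h' <;> simp [h, h']
    rcases this with h | h <;> simp [h]

lemma reach_mem (ho : IsConfig m o) (n : ℕ) (v : V) (ω : Ω) :
    0 ≤ reach T o n v ω ∧ reach T o n v ω ≤ 1 := by
  rcases reach_zero_or_one (T := T) ho n v ω with h | h <;> simp [h]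

lemma reach_antitone (ho : IsConfig m o) (v : V) (ω : Ω) : Antitone fun n => reach T o n v ω := by
  refine antitone_nat_of_succ_le fun n => ?_
  induction n generalizing v with
  | zero => exact (reach_mem ho 1 v ω).2
  | succ n ih =>
    rw [reach, reach]
    refine sub_le_sub_left (Finset.prod_le_prod (fun c _ => ?_) fun c _ => ?_) _
    · have h1 := ho.mem (T.ed c) ω
      have h2 := reach_mem (T := T) ho n c ω
      nlinarith
    · exact sub_le_sub_left (mul_le_mul_of_nonneg_left (ih c) (ho.mem _ ω).1) _

lemma tendsto_reach (ho : IsConfig m o) (v : V) (ω : Ω) :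
    Tendsto (fun n => reach T o n v ω) atTop (𝓝 (reachInf T o v ω)) :=
  tendsto_atTop_ciInf (reach_antitone ho v ω)
    ⟨0, by rintro _ ⟨n, rfl⟩; exact (reach_mem ho n v ω).1⟩

lemma reachInf_eq (ho : IsConfig m o) (v : V) (ω : Ω) :
    reachInf T o v ω = 1 - ∏ c ∈ T.ch v, (1 - o (T.ed c) ω * reachInf T o c ω) := by
  refine tendsto_nhds_unique ((tendsto_add_atTop_iff_nat 1).2 (tendsto_reach ho v ω)) ?_
  simp only [reach]
  exact (tendsto_finsetProd _ fun c _ => ((tendsto_reach ho c ω).const_mul _).const_sub _).const_sub _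

lemma reachInf_zero_or_one (ho : IsConfig m o) (v : V) (ω : Ω) :
    reachInf T o v ω = 0 ∨ reachInf T o v ω = 1 := by
  have : reachInf T o v ω ∈ ({0, 1} : Set ℝ) :=
    (Set.toFinite _).isClosed.mem_of_tendsto (tendsto_reach ho v ω)
      (Eventually.of_forall fun n => reach_zero_or_one ho n v ω)
  simpa using this

lemma reachInf_mem (ho : IsConfig m o) (v : V) (ω : Ω) :
    0 ≤ reachInf T o v ω ∧ reachInf T o v ω ≤ 1 := by
  rcases reachInf_zero_or_one (T := T) ho v ω with h | h <;> simp [h]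

lemma reachInf_le_reach (ho : IsConfig m o) (n : ℕ) (v : V) (ω : Ω) :
    reachInf T o v ω ≤ reach T o n v ω :=
  ciInf_le ⟨0, by rintro _ ⟨n, rfl⟩; exact (reach_mem ho n v ω).1⟩ n

/-- The edges relevant for the subtree hanging off the parent of `c` at `c`. -/
def TreeData.branch (T : TreeData V E d) (c : V) : Set E := insert (T.ed c) (T.below c)

lemma TreeData.branch_sub {v c : V} (hc : c ∈ T.ch v) : T.branch c ⊆ T.below v :=
  Set.insert_subset (T.ed_mem v c hc) (T.below_sub v c hc)

lemma TreeData.ed_mem_branch (c : V) : T.ed c ∈ T.branch c := Set.mem_insert _ _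

lemma TreeData.below_sub_branch (c : V) : T.below c ⊆ T.branch c := Set.subset_insert _ _

lemma bddOn_reach (ho : IsConfig m o) (n : ℕ) (v : V) : BddOn m (T.below v) (reach T o n v) := by
  induction n generalizing v with
  | zero => exact BddOn.const 1
  | succ n ih =>
    exact (BddOn.const 1).sub (BddOn.prod fun c hc => (BddOn.const 1).sub
      ((ho.bddOn (T.ed_mem v c hc)).mul ((ih c).mono (T.below_sub v c hc))))

lemma bddOn_reachInf (ho : IsConfig m o) (v : V) : BddOn m (T.below v) (reachInf T o v) := by
  refine ⟨?_, 1, fun ω => ?_⟩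
  · exact @measurable_of_tendsto_metrizable _ _ (_) _ _ _ _ _ _ (fun n => (bddOn_reach ho n v).meas)
      (tendsto_pi_nhds.2 fun ω => tendsto_reach ho v ω)
  · have := reachInf_mem (T := T) ho v ω
    rw [abs_of_nonneg this.1]; exact this.2

variable [mΩ : MeasurableSpace Ω] {P : Measure Ω} {p : ℕ → ℝ}

lemma disjoint_singleton_below {v c : V} (hc : c ∈ T.ch v) : Disjoint {T.ed c} (T.below c) :=
  Set.disjoint_singleton_left.2 (T.ed_notMem v c hc)

/-- Factorisation over the edge above a vertex and the edges below it. -/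
lemma integral_mul_below (hm : ∀ e, m e ≤ mΩ) (hi : iIndep m P) {v c : V} (hc : c ∈ T.ch v)
    {f g : Ω → ℝ} (hf : BddOn m {T.ed c} f) (hg : BddOn m (T.below c) g) :
    ∫ ω, f ω * g ω ∂P = (∫ ω, f ω ∂P) * ∫ ω, g ω ∂P :=
  hf.integral_mul hg hm hi (disjoint_singleton_below hc)

lemma integral_one_sub [IsProbabilityMeasure P] (hm : ∀ e, m e ≤ mΩ) {f : Ω → ℝ} {S : Set E} (hf : BddOn m S f) :
    ∫ ω, (1 - f ω) ∂P = 1 - ∫ ω, f ω ∂P := by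
  rw [integral_sub (integrable_const _) (hf.integrable hm)]; simp

lemma integral_reach [IsProbabilityMeasure P] (hm : ∀ e, m e ≤ mΩ) (hi : iIndep m P) (ho : IsConfig m o)
    (hp : ∀ v, ∀ c ∈ T.ch v, ∫ ω, o (T.ed c) ω ∂P = p (T.lev v + 1)) (n : ℕ) (v : V) :
    ∫ ω, reach T o n v ω ∂P = reachProb d p n (T.lev v) := by
  induction n generalizing v with
  | zero => simp [reach, reachProb]
  | succ n ih =>
    have hb : ∀ c ∈ T.ch v, BddOn m (T.branch c) fun ω => o (T.ed c) ω * reach T o n c ω :=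
      fun c _ => (ho.bddOn (T.ed_mem_branch c)).mul ((bddOn_reach ho n c).mono (T.below_sub_branch c))
    have hb' : ∀ c ∈ T.ch v, BddOn m (T.branch c) fun ω => 1 - o (T.ed c) ω * reach T o n c ω :=
      fun c hc => (BddOn.const 1).sub (hb c hc)
    simp only [reach]
    rw [integral_one_sub hm (BddOn.prod fun c hc => (hb' c hc).mono (T.branch_sub hc)),
      integral_prod_of_disjoint hm hi hb' (T.disj v)]
    rw [reachProb, ← T.card_ch, ← Finset.prod_const]
    congr 1
    refine Finset.prod_congr rfl fun c hc => ?_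
    rw [integral_one_sub hm (hb c hc), integral_mul_below hm hi hc (ho.single _)
      (bddOn_reach ho n c), hp v c hc, ih c, T.lev_ch v c hc]

lemma integral_reachInf [IsProbabilityMeasure P] (hm : ∀ e, m e ≤ mΩ) (hi : iIndep m P) (ho : IsConfig m o)
    (hp : ∀ v, ∀ c ∈ T.ch v, ∫ ω, o (T.ed c) ω ∂P = p (T.lev v + 1))
    (hp01 : ∀ j, 0 < p (j + 1) ∧ p (j + 1) ≤ 1) (v : V) :
    ∫ ω, reachInf T o v ω ∂P = survProb d p (T.lev v) := by
  have h := tendsto_integral_of_dominated_convergence (μ := P) (F := fun n => reach T o n v)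
    (f := reachInf T o v) (fun _ => 1)
    (fun n => ((bddOn_reach ho n v).measurable hm).aestronglyMeasurable) (integrable_const _)
    (fun n => Eventually.of_forall fun ω => by
      rw [Real.norm_of_nonneg (reach_mem ho n v ω).1]; exact (reach_mem ho n v ω).2)
    (Eventually.of_forall fun ω => tendsto_reach ho v ω)
  refine tendsto_nhds_unique h ?_
  simp only [integral_reach hm hi ho hp]
  exact tendsto_reachProb hp01 _

/-- Resampling: the probability that the connection to the `n`-th generation changes. -/
lemma integral_abs_reach_sub_le [IsProbabilityMeasure P] (hm : ∀ e, m e ≤ mΩ) (hi : iIndep m P) (ho : IsConfig m o)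
    (ho' : IsConfig m o')
    (hp : ∀ v, ∀ c ∈ T.ch v, ∫ ω, o (T.ed c) ω ∂P = p (T.lev v + 1))
    (hp' : ∀ v, ∀ c ∈ T.ch v, ∫ ω, o' (T.ed c) ω ∂P = p (T.lev v + 1))
    (hp01 : ∀ j, 0 < p (j + 1) ∧ p (j + 1) ≤ 1) {η : ℝ}
    (hd : ∀ v, ∀ c ∈ T.ch v, ∫ ω, |o (T.ed c) ω - o' (T.ed c) ω| ∂P ≤ p (T.lev v + 1) * η)
    (n : ℕ) (v : V) :
    ∫ ω, |reach T o n v ω - reach T o' n v ω| ∂P ≤ η * pivotSum d p n (T.lev v) := by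
  induction n generalizing v with
  | zero => simp [reach, pivotSum]
  | succ n ih =>
    have hb : ∀ {o : E → Ω → ℝ}, IsConfig m o → ∀ c ∈ T.ch v,
        BddOn m (T.branch c) fun ω => o (T.ed c) ω * reach T o n c ω := fun ho c _ =>
      (ho.bddOn (T.ed_mem_branch c)).mul ((bddOn_reach ho n c).mono (T.below_sub_branch c))
    have hb' : ∀ {o : E → Ω → ℝ}, IsConfig m o → ∀ c ∈ T.ch v,
        BddOn m (T.branch c) fun ω => 1 - o (T.ed c) ω * reach T o n c ω := fun ho c hc =>
      (BddOn.const 1).sub (hb ho c hc)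
    set t := reachProb d p n (T.lev v + 1) with ht
    set y := 1 - p (T.lev v + 1) * t with hy
    have hint : ∀ {o : E → Ω → ℝ}, IsConfig m o →
        (∀ v, ∀ c ∈ T.ch v, ∫ ω, o (T.ed c) ω ∂P = p (T.lev v + 1)) → ∀ c ∈ T.ch v,
        ∫ ω, (1 - o (T.ed c) ω * reach T o n c ω) ∂P = y := fun ho hp c hc => by
      rw [integral_one_sub hm (hb ho c hc), integral_mul_below hm hi hc (ho.single _)
        (bddOn_reach ho n c), hp v c hc, integral_reach hm hi ho hp, T.lev_ch v c hc]
    have ht01 := reachProb_mem (d := d) hp01 n (T.lev v + 1)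
    have hy0 : 0 ≤ y := by
      have := hp01 (T.lev v)
      rw [hy]; nlinarith
    have hnn : ∀ {o : E → Ω → ℝ}, IsConfig m o → ∀ c ∈ T.ch v, ∀ ω,
        0 ≤ 1 - o (T.ed c) ω * reach T o n c ω := fun ho c _ ω => by
      have h1 := ho.mem (T.ed c) ω
      have h2 := reach_mem (T := T) ho n c ω
      nlinarith
    have key := integral_abs_prod_sub_prod_le (P := P) (s := T.ch v) (A := T.branch)
      (D := p (T.lev v + 1) * (η * (pivotSum d p n (T.lev v + 1) + t))) hm hi
      (hb' ho) (hb' ho') (hnn ho) (hnn ho') (hint ho hp) (hint ho' hp') hy0 ?_ (T.disj v)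
    · have e : ∀ ω, |reach T o (n + 1) v ω - reach T o' (n + 1) v ω| =
          |∏ c ∈ T.ch v, (1 - o (T.ed c) ω * reach T o n c ω) -
            ∏ c ∈ T.ch v, (1 - o' (T.ed c) ω * reach T o' n c ω)| := fun ω => by
        rw [reach, reach, abs_sub_comm]; congr 1; ring
      simp only [e]
      refine key.trans (le_of_eq ?_)
      rw [T.card_ch, pivotSum, pivotFactor]
      ring
    · intro c hc
      have b1 : BddOn m Set.univ fun ω => |o (T.ed c) ω - o' (T.ed c) ω| * reach T o n c ω :=
        (((ho.univ _).sub (ho'.univ _)).abs).mul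
          ((bddOn_reach ho n c).mono (Set.subset_univ _))
      have b2 : BddOn m Set.univ fun ω => o' (T.ed c) ω * |reach T o n c ω - reach T o' n c ω| :=
        (ho'.univ _).mul
          (((bddOn_reach ho n c).sub (bddOn_reach ho' n c)).abs.mono (Set.subset_univ _))
      calc ∫ ω, |(1 - o (T.ed c) ω * reach T o n c ω) - (1 - o' (T.ed c) ω * reach T o' n c ω)| ∂P
          ≤ ∫ ω, (|o (T.ed c) ω - o' (T.ed c) ω| * reach T o n c ω +
              o' (T.ed c) ω * |reach T o n c ω - reach T o' n c ω|) ∂P := by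
            refine integral_mono_of_nonneg (Eventually.of_forall fun ω => abs_nonneg _)
              ((b1.add b2).integrable hm) (Eventually.of_forall fun ω => ?_)
            have e : (1 - o (T.ed c) ω * reach T o n c ω) -
                (1 - o' (T.ed c) ω * reach T o' n c ω) =
              -((o (T.ed c) ω - o' (T.ed c) ω) * reach T o n c ω +
                o' (T.ed c) ω * (reach T o n c ω - reach T o' n c ω)) := by ring
            refine (congrArg _ e).le.trans ?_
            rw [abs_neg]
            refine (abs_add_le _ _).trans ?_
            rw [abs_mul, abs_mul, abs_of_nonneg (ho'.mem _ ω).1,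
              abs_of_nonneg (reach_mem ho n c ω).1]
        _ = (∫ ω, |o (T.ed c) ω - o' (T.ed c) ω| ∂P) * t +
            p (T.lev v + 1) * ∫ ω, |reach T o n c ω - reach T o' n c ω| ∂P := by
            rw [integral_add (b1.integrable hm) (b2.integrable hm),
              integral_mul_below hm hi hc (((ho.single _).sub (ho'.single _)).abs)
                (bddOn_reach ho n c),
              integral_mul_below hm hi hc (ho'.single _)
                (((bddOn_reach ho n c).sub (bddOn_reach ho' n c)).abs),
              hp' v c hc, integral_reach hm hi ho hp, T.lev_ch v c hc]
        _ ≤ (p (T.lev v + 1) * η) * t +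
            p (T.lev v + 1) * (η * pivotSum d p n (T.lev v + 1)) := by
            have h1 := hd v c hc
            have h2 := ih c
            rw [T.lev_ch v c hc] at h2
            have h3 := (hp01 (T.lev v)).1.le
            have h4 := ht01.1
            gcongr
        _ = _ := by ring

end

/-! ### Counting pivotal openings between two times -/

section
variable {V Ω E : Type*} {d : ℕ → ℕ} (T : TreeData V E d)

/-- The indicator that `e` opens between the two configurations. -/
def opens (o o' : E → Ω → ℝ) (e : E) (ω : Ω) : ℝ := (1 - o e ω) * o' e ω

open Classical in
/-- The indicator that no child of `v` other than `c` is open and percolates. -/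
noncomputable def quiet (o : E → Ω → ℝ) (v c : V) (ω : Ω) : ℝ :=
  ∏ u ∈ (T.ch v).erase c, (1 - o (T.ed u) ω * reachInf T o u ω)

/-- The number of edges on the `k` levels below `v` which open between the two configurations, which
are joined to `v` by edges that are open in both configurations, below which there is percolation in
the second configuration, and without which `v` does not percolate in the first one. -/
noncomputable def pivotCount (o o' : E → Ω → ℝ) : ℕ → V → Ω → ℝ
  | 0, _, _ => 0
  | k + 1, v, ω => ∑ c ∈ T.ch v, (opens o o' (T.ed c) ω * reachInf T o' c ω +
      o (T.ed c) ω * o' (T.ed c) ω * pivotCount o o' k c ω) * quiet T o v c ω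

/-- The contribution to `pivotCount` of the branch at `c`. -/
noncomputable def pivotBranch (o o' : E → Ω → ℝ) (k : ℕ) (c : V) (ω : Ω) : ℝ :=
  opens o o' (T.ed c) ω * reachInf T o' c ω + o (T.ed c) ω * o' (T.ed c) ω * pivotCount T o o' k c ω

/-- The mean of `pivotCount`; `φ j` is the normalised probability that an edge of level `j`
opens. -/
noncomputable def pivotMean (d : ℕ → ℕ) (p φ : ℕ → ℝ) : ℕ → ℕ → ℝ
  | 0, _ => 0
  | k + 1, j => pivotFactor d p j (survProb d p (j + 1)) *
      (φ (j + 1) * survProb d p (j + 1) + (1 - φ (j + 1)) * pivotMean d p φ k (j + 1))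

variable {T} {m : E → MeasurableSpace Ω} {o o' q q' : E → Ω → ℝ}

lemma pivotCount_succ (k : ℕ) (v : V) (ω : Ω) : pivotCount T o o' (k + 1) v ω =
    ∑ c ∈ T.ch v, pivotBranch T o o' k c ω * quiet T o v c ω := rfl

lemma opens_zero_or_one (ho : IsConfig m o) (ho' : IsConfig m o') (e : E) (ω : Ω) :
    opens o o' e ω = 0 ∨ opens o o' e ω = 1 := by
  rcases ho.zero_or_one e ω with h | h <;> rcases ho'.zero_or_one e ω with h' | h' <;>
    simp [opens, h, h']

lemma opens_mem (ho : IsConfig m o) (ho' : IsConfig m o') (e : E) (ω : Ω) :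
    0 ≤ opens o o' e ω ∧ opens o o' e ω ≤ 1 := by
  rcases opens_zero_or_one ho ho' e ω with h | h <;> simp [h]

lemma quiet_zero_or_one (ho : IsConfig m o) (v c : V) (ω : Ω) :
    quiet T o v c ω = 0 ∨ quiet T o v c ω = 1 := by
  refine prod_zero_or_one fun u _ => ?_
  rcases ho.zero_or_one (T.ed u) ω with h | h <;>
    rcases reachInf_zero_or_one (T := T) ho u ω with h' | h' <;> simp [h, h']

lemma quiet_mem (ho : IsConfig m o) (v c : V) (ω : Ω) :
    0 ≤ quiet T o v c ω ∧ quiet T o v c ω ≤ 1 := by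
  rcases quiet_zero_or_one (T := T) ho v c ω with h | h <;> simp [h]

lemma pivotCount_eq_natCast (ho : IsConfig m o) (ho' : IsConfig m o') (k : ℕ) (v : V) (ω : Ω) :
    ∃ n : ℕ, pivotCount T o o' k v ω = n := by
  induction k generalizing v with
  | zero => exact ⟨0, by simp [pivotCount]⟩
  | succ k ih =>
    have : ∀ c, ∃ n : ℕ, pivotBranch T o o' k c ω * quiet T o v c ω = n := by
      intro c
      obtain ⟨n, hn⟩ := ih c
      rw [pivotBranch, hn, opens]
      rcases ho.zero_or_one (T.ed c) ω with h1 | h1 <;>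
      rcases ho'.zero_or_one (T.ed c) ω with h2 | h2 <;>
      rcases reachInf_zero_or_one (T := T) ho' c ω with h3 | h3 <;>
      rcases quiet_zero_or_one (T := T) ho v c ω with h4 | h4 <;>
      simp only [h1, h2, h3, h4]
      all_goals first
        | (refine ⟨0, ?_⟩; simp; done)
        | (refine ⟨1, ?_⟩; simp; done)
        | (refine ⟨n, ?_⟩; simp)
    choose n hn using this
    exact ⟨∑ c ∈ T.ch v, n c, by rw [pivotCount_succ]; push_cast; simp only [hn]⟩

lemma pivotCount_nonneg (ho : IsConfig m o) (ho' : IsConfig m o') (k : ℕ) (v : V) (ω : Ω) :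
    0 ≤ pivotCount T o o' k v ω := by
  obtain ⟨n, hn⟩ := pivotCount_eq_natCast (T := T) ho ho' k v ω
  rw [hn]; positivity

lemma pivotBranch_nonneg (ho : IsConfig m o) (ho' : IsConfig m o') (k : ℕ) (c : V) (ω : Ω) :
    0 ≤ pivotBranch T o o' k c ω :=
  add_nonneg (mul_nonneg (opens_mem ho ho' _ ω).1 (reachInf_mem ho' c ω).1)
    (mul_nonneg (mul_nonneg (ho.mem _ ω).1 (ho'.mem _ ω).1) (pivotCount_nonneg ho ho' k c ω))

/-- A pivotal opening makes the vertex percolate. -/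
lemma reachInf_of_pivotCount_ne_zero (ho : IsConfig m o) (ho' : IsConfig m o') {k : ℕ} {v : V}
    {ω : Ω} (h : pivotCount T o o' k v ω ≠ 0) :
    reachInf T o v ω = 0 ∧ reachInf T o' v ω = 1 := by
  induction k generalizing v with
  | zero => exact absurd rfl h
  | succ k ih =>
    rw [pivotCount_succ] at h
    obtain ⟨c, hc, hne⟩ := Finset.exists_ne_zero_of_sum_ne_zero h
    have h1 : pivotBranch T o o' k c ω ≠ 0 := left_ne_zero_of_mul hne
    have h2 : quiet T o v c ω = 1 :=
      (quiet_zero_or_one ho v c ω).resolve_left (right_ne_zero_of_mul hne)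
    have key : o (T.ed c) ω * reachInf T o c ω = 0 ∧ o' (T.ed c) ω * reachInf T o' c ω = 1 := by
      rcases ho.zero_or_one (T.ed c) ω with h3 | h3
      · rw [h3, zero_mul]
        simp only [pivotBranch, opens, h3, zero_mul, add_zero, sub_zero, one_mul] at h1
        have a := (ho'.zero_or_one (T.ed c) ω).resolve_left (left_ne_zero_of_mul h1)
        have b := (reachInf_zero_or_one ho' c ω).resolve_left (right_ne_zero_of_mul h1)
        simp [a, b]
      · simp only [pivotBranch, opens, h3, sub_self, zero_mul, zero_add, one_mul] at h1
        have a := (ho'.zero_or_one (T.ed c) ω).resolve_left (left_ne_zero_of_mul h1)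
        obtain ⟨b1, b2⟩ := ih (right_ne_zero_of_mul h1)
        simp [a, b1, b2]
    constructor
    · classical
      rw [reachInf_eq ho, ← Finset.mul_prod_erase _ _ hc, key.1]
      have : ∏ u ∈ (T.ch v).erase c, (1 - o (T.ed u) ω * reachInf T o u ω) = 1 := by
        rw [← h2, quiet]; congr!
      rw [this]; norm_num
    · rw [reachInf_eq ho', Finset.prod_eq_zero hc (by rw [key.2, sub_self]), sub_zero]

lemma bddOn_opens (ho : IsConfig m o) (ho' : IsConfig m o') {e : E} {S : Set E} (he : e ∈ S) :
    BddOn m S (opens o o' e) :=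
  ((BddOn.const 1).sub (ho.bddOn he)).mul (ho'.bddOn he)

lemma bddOn_one_sub (ho : IsConfig m o) (c : V) :
    BddOn m (T.branch c) fun ω => 1 - o (T.ed c) ω * reachInf T o c ω :=
  (BddOn.const 1).sub ((ho.bddOn (T.ed_mem_branch c)).mul
    ((bddOn_reachInf ho c).mono (T.below_sub_branch c)))

open Classical in
lemma bddOn_quiet (ho : IsConfig m o) (v c : V) :
    BddOn m (⋃ u ∈ (T.ch v).erase c, T.branch u) (quiet T o v c) :=
  BddOn.prod fun u hu => (bddOn_one_sub ho u).mono (Set.subset_biUnion_of_mem (u := T.branch) hu)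

open Classical in
lemma disjoint_branch_quiet {v c : V} (hc : c ∈ T.ch v) :
    Disjoint (T.branch c) (⋃ u ∈ (T.ch v).erase c, T.branch u) := by
  rw [Set.disjoint_iUnion₂_right]
  intro u hu
  exact T.disj v c hc u (Finset.mem_of_mem_erase hu) (Finset.ne_of_mem_erase hu).symm

lemma bddOn_pivotCount (ho : IsConfig m o) (ho' : IsConfig m o') (k : ℕ) (v : V) :
    BddOn m (T.below v) (pivotCount T o o' k v) := by
  classical
  induction k generalizing v with
  | zero => exact BddOn.const 0
  | succ k ih =>
    refine BddOn.sum fun c hc => BddOn.mul (BddOn.add ?_ ?_) ?_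
    · exact (bddOn_opens ho ho' (T.ed_mem v c hc)).mul
        ((bddOn_reachInf ho' c).mono (T.below_sub v c hc))
    · exact ((ho.bddOn (T.ed_mem v c hc)).mul (ho'.bddOn (T.ed_mem v c hc))).mul
        ((ih c).mono (T.below_sub v c hc))
    · refine (bddOn_quiet ho v c).mono (Set.iUnion₂_subset fun u hu => T.branch_sub ?_)
      exact Finset.mem_of_mem_erase hu

lemma bddOn_pivotBranch (ho : IsConfig m o) (ho' : IsConfig m o') (k : ℕ) (c : V) :
    BddOn m (T.branch c) (pivotBranch T o o' k c) :=
  ((bddOn_opens ho ho' (T.ed_mem_branch c)).mul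
    ((bddOn_reachInf ho' c).mono (T.below_sub_branch c))).add
  (((ho.bddOn (T.ed_mem_branch c)).mul (ho'.bddOn (T.ed_mem_branch c))).mul
    ((bddOn_pivotCount ho ho' k c).mono (T.below_sub_branch c)))

variable [mΩ : MeasurableSpace Ω]

variable (T m) in
/-- A pair of configurations at two consecutive times, with edge probabilities `p` and normalised
opening probabilities `φ`. -/
structure IsCell (P : Measure Ω) (p φ : ℕ → ℝ) (o o' : E → Ω → ℝ) : Prop where
  config : IsConfig m o
  config' : IsConfig m o'
  mean : ∀ v, ∀ c ∈ T.ch v, ∫ ω, o (T.ed c) ω ∂P = p (T.lev v + 1)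
  mean' : ∀ v, ∀ c ∈ T.ch v, ∫ ω, o' (T.ed c) ω ∂P = p (T.lev v + 1)
  mean_opens : ∀ v, ∀ c ∈ T.ch v,
    ∫ ω, opens o o' (T.ed c) ω ∂P = p (T.lev v + 1) * φ (T.lev v + 1)

variable {P : Measure Ω} [IsProbabilityMeasure P] {p φ : ℕ → ℝ}

lemma IsCell.mean_mul (hC : IsCell T m P p φ o o') (hm : ∀ e, m e ≤ mΩ) {v c : V}
    (hc : c ∈ T.ch v) :
    ∫ ω, o (T.ed c) ω * o' (T.ed c) ω ∂P = p (T.lev v + 1) * (1 - φ (T.lev v + 1)) := by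
  have e : ∀ ω, o (T.ed c) ω * o' (T.ed c) ω = o' (T.ed c) ω - opens o o' (T.ed c) ω := fun ω => by
    rw [opens]; ring
  simp only [e]
  rw [integral_sub ((hC.config'.single _).integrable hm)
    ((bddOn_opens hC.config hC.config' (Set.mem_singleton _)).integrable hm),
    hC.mean' v c hc, hC.mean_opens v c hc]
  ring

lemma integral_quiet (hm : ∀ e, m e ≤ mΩ) (hi : iIndep m P) (ho : IsConfig m o)
    (hp : ∀ v, ∀ c ∈ T.ch v, ∫ ω, o (T.ed c) ω ∂P = p (T.lev v + 1))
    (hp01 : ∀ j, 0 < p (j + 1) ∧ p (j + 1) ≤ 1) {v c : V} (hc : c ∈ T.ch v) :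
    ∫ ω, quiet T o v c ω ∂P =
      (1 - p (T.lev v + 1) * survProb d p (T.lev v + 1)) ^ (d (T.lev v) - 1) := by
  classical
  have h1 : ∫ ω, quiet T o v c ω ∂P = ∏ u ∈ (T.ch v).erase c,
      ∫ ω, (1 - o (T.ed u) ω * reachInf T o u ω) ∂P := by
    rw [← integral_prod_of_disjoint hm hi (fun u _ => bddOn_one_sub ho u)
      (fun u hu u' hu' => T.disj v u (Finset.mem_of_mem_erase hu) u' (Finset.mem_of_mem_erase hu'))]
    congr 1
  rw [h1, ← T.card_ch, ← Finset.card_erase_of_mem hc, ← Finset.prod_const]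
  refine Finset.prod_congr rfl fun u hu => ?_
  have hu' := Finset.mem_of_mem_erase hu
  have hb : BddOn m Set.univ fun ω => o (T.ed u) ω * reachInf T o u ω :=
    (ho.univ _).mul ((bddOn_reachInf ho u).mono (Set.subset_univ _))
  rw [integral_one_sub hm hb, integral_mul_below hm hi hu' (ho.single _) (bddOn_reachInf ho u),
    hp v u hu', integral_reachInf hm hi ho hp hp01, T.lev_ch v u hu']

lemma integral_pivotBranch (hC : IsCell T m P p φ o o') (hm : ∀ e, m e ≤ mΩ) (hi : iIndep m P)
    (hp01 : ∀ j, 0 < p (j + 1) ∧ p (j + 1) ≤ 1) {k : ℕ} {v c : V} (hc : c ∈ T.ch v) :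
    ∫ ω, pivotBranch T o o' k c ω ∂P = p (T.lev v + 1) *
      (φ (T.lev v + 1) * survProb d p (T.lev v + 1) +
        (1 - φ (T.lev v + 1)) * ∫ ω, pivotCount T o o' k c ω ∂P) := by
  have ho := hC.config
  have ho' := hC.config'
  have b1 := bddOn_opens ho ho' (Set.mem_singleton (T.ed c))
  have b2 : BddOn m {T.ed c} fun ω => o (T.ed c) ω * o' (T.ed c) ω := (ho.single _).mul (ho'.single _)
  have c1 := bddOn_reachInf (T := T) ho' c
  have c2 := bddOn_pivotCount (T := T) ho ho' k c
  simp only [pivotBranch]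
  rw [integral_add
    (((b1.mono (Set.subset_univ _)).mul (c1.mono (Set.subset_univ _))).integrable hm)
    (((b2.mono (Set.subset_univ _)).mul (c2.mono (Set.subset_univ _))).integrable hm),
    integral_mul_below hm hi hc b1 c1, integral_mul_below hm hi hc b2 c2, hC.mean_opens v c hc,
    hC.mean_mul hm hc, integral_reachInf hm hi ho' hC.mean' hp01, T.lev_ch v c hc]
  ring

lemma integral_pivotCount (hC : IsCell T m P p φ o o') (hm : ∀ e, m e ≤ mΩ) (hi : iIndep m P)
    (hp01 : ∀ j, 0 < p (j + 1) ∧ p (j + 1) ≤ 1) (k : ℕ) (v : V) :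
    ∫ ω, pivotCount T o o' k v ω ∂P = pivotMean d p φ k (T.lev v) := by
  induction k generalizing v with
  | zero => simp [pivotCount, pivotMean]
  | succ k ih =>
    have ho := hC.config
    have ho' := hC.config'
    simp only [pivotCount_succ]
    rw [integral_finsetSum _ fun c _ =>
      (((bddOn_pivotBranch ho ho' k c).mono (Set.subset_univ _)).mul
        ((bddOn_quiet ho v c).mono (Set.subset_univ _))).integrable hm]
    have : ∀ c ∈ T.ch v, ∫ ω, pivotBranch T o o' k c ω * quiet T o v c ω ∂P =
        p (T.lev v + 1) * (φ (T.lev v + 1) * survProb d p (T.lev v + 1) +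
          (1 - φ (T.lev v + 1)) * pivotMean d p φ k (T.lev v + 1)) *
        (1 - p (T.lev v + 1) * survProb d p (T.lev v + 1)) ^ (d (T.lev v) - 1) := by
      intro c hc
      rw [(bddOn_pivotBranch ho ho' k c).integral_mul (bddOn_quiet ho v c) hm hi
        (disjoint_branch_quiet hc), integral_pivotBranch hC hm hi hp01 hc, ih c, T.lev_ch v c hc,
        integral_quiet hm hi ho hC.mean hp01 hc]
    rw [Finset.sum_congr rfl this, Finset.sum_const, T.card_ch, nsmul_eq_mul, pivotMean,
      pivotFactor]
    ring

end

section
variable {V Ω E : Type*} {d : ℕ → ℕ} {T : TreeData V E d} {m : E → MeasurableSpace Ω}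
  {o o' q q' : E → Ω → ℝ} [mΩ : MeasurableSpace Ω] {P : Measure Ω} [IsProbabilityMeasure P]
  {p φ : ℕ → ℝ}

/-- The normalised mean contribution of one branch to the count of pivotal openings. -/
noncomputable def branchMean (d : ℕ → ℕ) (p φ : ℕ → ℝ) (k j : ℕ) : ℝ :=
  φ (j + 1) * survProb d p (j + 1) + (1 - φ (j + 1)) * pivotMean d p φ k (j + 1)

lemma integral_pivotBranch' (hC : IsCell T m P p φ o o') (hm : ∀ e, m e ≤ mΩ) (hi : iIndep m P)
    (hp01 : ∀ j, 0 < p (j + 1) ∧ p (j + 1) ≤ 1) {k : ℕ} {v c : V} (hc : c ∈ T.ch v) :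
    ∫ ω, pivotBranch T o o' k c ω ∂P = p (T.lev v + 1) * branchMean d p φ k (T.lev v) := by
  rw [integral_pivotBranch hC hm hi hp01 hc, integral_pivotCount hC hm hi hp01, T.lev_ch v c hc]
  rfl

lemma pivotMean_nonneg (hp01 : ∀ j, 0 < p (j + 1) ∧ p (j + 1) ≤ 1)
    (hφ : ∀ j, 0 ≤ φ (j + 1) ∧ φ (j + 1) ≤ 1) (k j : ℕ) : 0 ≤ pivotMean d p φ k j := by
  induction k generalizing j with
  | zero => simp [pivotMean]
  | succ k ih =>
    have h := survProb_mem (d := d) hp01 (j + 1)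
    exact mul_nonneg (pivotFactor_nonneg hp01 _ h.1 h.2)
      (add_nonneg (mul_nonneg (hφ j).1 h.1) (mul_nonneg (sub_nonneg.2 (hφ j).2) (ih _)))

/-- The contribution of two different branches factorises. -/
lemma integral_branch_mul_le (hC : IsCell T m P p φ o o') (hC' : IsCell T m P p φ q q')
    (hm : ∀ e, m e ≤ mΩ) (hi : iIndep m P) (hp01 : ∀ j, 0 < p (j + 1) ∧ p (j + 1) ≤ 1)
    {k : ℕ} {v c c' : V} (hc : c ∈ T.ch v) (hc' : c' ∈ T.ch v) (hne : c ≠ c') :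
    ∫ ω, pivotBranch T o o' k c ω * quiet T o v c ω *
      (pivotBranch T q q' k c' ω * quiet T q v c' ω) ∂P ≤
      (p (T.lev v + 1) * branchMean d p φ k (T.lev v)) ^ 2 := by
  have ho := hC.config
  have ho' := hC.config'
  have hq := hC'.config
  have hq' := hC'.config'
  have b1 := bddOn_pivotBranch (T := T) ho ho' k c
  have b2 := bddOn_pivotBranch (T := T) hq hq' k c'
  calc _ ≤ ∫ ω, pivotBranch T o o' k c ω * pivotBranch T q q' k c' ω ∂P := by
        refine integral_mono_of_nonneg (Eventually.of_forall fun ω => ?_)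
          (((b1.mono (Set.subset_univ _)).mul (b2.mono (Set.subset_univ _))).integrable hm)
          (Eventually.of_forall fun ω => ?_)
        · exact mul_nonneg (mul_nonneg (pivotBranch_nonneg ho ho' k c ω) (quiet_mem ho v c ω).1)
            (mul_nonneg (pivotBranch_nonneg hq hq' k c' ω) (quiet_mem hq v c' ω).1)
        · exact mul_le_mul
            (mul_le_of_le_one_right (pivotBranch_nonneg ho ho' k c ω) (quiet_mem ho v c ω).2)
            (mul_le_of_le_one_right (pivotBranch_nonneg hq hq' k c' ω) (quiet_mem hq v c' ω).2)
            (mul_nonneg (pivotBranch_nonneg hq hq' k c' ω) (quiet_mem hq v c' ω).1)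
            (pivotBranch_nonneg ho ho' k c ω)
    _ = _ := by
        rw [b1.integral_mul b2 hm hi (T.disj v c hc c' hc' hne),
          integral_pivotBranch' hC hm hi hp01 hc, integral_pivotBranch' hC' hm hi hp01 hc', sq]

lemma sum_sum_le_of_diag {ι : Type*} (s : Finset ι) (F : ι → ι → ℝ) {A B : ℝ} (hB : 0 ≤ B)
    (hd : ∀ i ∈ s, F i i ≤ A) (ho : ∀ i ∈ s, ∀ j ∈ s, i ≠ j → F i j ≤ B) :
    ∑ i ∈ s, ∑ j ∈ s, F i j ≤ s.card * A + (s.card : ℝ) ^ 2 * B := by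
  classical
  calc _ ≤ ∑ i ∈ s, ∑ j ∈ s, ((if i = j then A else 0) + B) := by
        refine Finset.sum_le_sum fun i hi => Finset.sum_le_sum fun j hj => ?_
        split_ifs with h
        · subst h; linarith [hd i hi]
        · linarith [ho i hi j hj h]
    _ = _ := by
        simp only [Finset.sum_add_distrib, Finset.sum_ite_eq, Finset.sum_const, nsmul_eq_mul]
        rw [Finset.sum_congr rfl (fun i hi => if_pos hi), Finset.sum_const, nsmul_eq_mul]
        ring

lemma branch_mul_branch_le {a b R S x x' y y' M N : ℝ} (ha : 0 ≤ a ∧ a ≤ 1) (hb : 0 ≤ b ∧ b ≤ 1)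
    (hR : 0 ≤ R ∧ R ≤ 1) (hS : 0 ≤ S ∧ S ≤ 1) (hx : 0 ≤ x ∧ x ≤ 1) (hx' : 0 ≤ x' ∧ x' ≤ 1)
    (hy : 0 ≤ y ∧ y ≤ 1) (hy' : 0 ≤ y' ∧ y' ≤ 1) (hN : 0 ≤ N) (hM : 0 ≤ M) :
    (a * R + x * x' * N) * (b * S + y * y' * M) ≤
      a * b * R + a * M + b * N + x * y * (N * M) := by
  have h1 : a * b * R * S ≤ a * b * R :=
    mul_le_of_le_one_right (mul_nonneg (mul_nonneg ha.1 hb.1) hR.1) hS.2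
  have h2 : a * M * (R * (y * y')) ≤ a * M := mul_le_of_le_one_right (mul_nonneg ha.1 hM)
    (mul_le_one₀ hR.2 (mul_nonneg hy.1 hy'.1) (mul_le_one₀ hy.2 hy'.1 hy'.2))
  have h3 : b * N * (S * (x * x')) ≤ b * N := mul_le_of_le_one_right (mul_nonneg hb.1 hN)
    (mul_le_one₀ hS.2 (mul_nonneg hx.1 hx'.1) (mul_le_one₀ hx.2 hx'.1 hx'.2))
  have h4 : x * y * (N * M) * (x' * y') ≤ x * y * (N * M) :=
    mul_le_of_le_one_right (mul_nonneg (mul_nonneg hx.1 hy.1) (mul_nonneg hN hM))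
      (mul_le_one₀ hx'.2 hy'.1 hy'.2)
  linarith

/-- The correlation of the contributions of one branch at two pairs of times. -/
lemma integral_branch_mul_self_le (hC : IsCell T m P p φ o o') (hC' : IsCell T m P p φ q q')
    (hm : ∀ e, m e ≤ mΩ) (hi : iIndep m P) (hp01 : ∀ j, 0 < p (j + 1) ∧ p (j + 1) ≤ 1)
    {h r B : ℝ} (hh : ∀ v, ∀ c ∈ T.ch v, ∫ ω, o (T.ed c) ω * q (T.ed c) ω ∂P ≤ p (T.lev v + 1) * h)
    (hr : ∀ v, ∀ c ∈ T.ch v,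
      ∫ ω, opens o o' (T.ed c) ω * opens q q' (T.ed c) ω ∂P ≤ p (T.lev v + 1) * r)
    {k : ℕ} {v c : V} (hc : c ∈ T.ch v) (hbound :
      ∫ ω, pivotCount T o o' k c ω * pivotCount T q q' k c ω ∂P ≤ B) :
    ∫ ω, pivotBranch T o o' k c ω * pivotBranch T q q' k c ω ∂P ≤
      p (T.lev v + 1) * (r * survProb d p (T.lev v + 1) +
          2 * φ (T.lev v + 1) * pivotMean d p φ k (T.lev v + 1) + h * B) := by
  have ho := hC.config
  have ho' := hC.config'
  have hq := hC'.config
  have hq' := hC'.config'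
  have hU : ∀ {S : Set E} {f : Ω → ℝ}, BddOn m S f → BddOn m Set.univ f := fun hf =>
    hf.mono (Set.subset_univ _)
  have hz := hU (bddOn_pivotBranch (T := T) ho ho' k c)
  have hz' := hU (bddOn_pivotBranch (T := T) hq hq' k c)
  set j := T.lev v with hj
  set t := survProb d p (j + 1) with ht
  have ht01 := survProb_mem (d := d) hp01 (j + 1)
  have f1 := (bddOn_opens ho ho' (Set.mem_singleton (T.ed c)))
  have f2 := (bddOn_opens hq hq' (Set.mem_singleton (T.ed c)))
  have f3 : BddOn m {T.ed c} fun ω => o (T.ed c) ω * q (T.ed c) ω :=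
    (ho.single _).mul (hq.single _)
  have g1 := bddOn_reachInf (T := T) ho' c
  have g2 := bddOn_pivotCount (T := T) ho ho' k c
  have g3 := bddOn_pivotCount (T := T) hq hq' k c
  have i1 := ((hU (f1.mul f2)).mul (hU g1))
  have i2 := (hU f1).mul (hU g3)
  have i3 := (hU f2).mul (hU g2)
  have i4 := (hU f3).mul (hU (g2.mul g3))
  have e2 : ∀ ω, pivotBranch T o o' k c ω * pivotBranch T q q' k c ω ≤
      opens o o' (T.ed c) ω * opens q q' (T.ed c) ω * reachInf T o' c ω +
      opens o o' (T.ed c) ω * pivotCount T q q' k c ω +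
      opens q q' (T.ed c) ω * pivotCount T o o' k c ω +
      o (T.ed c) ω * q (T.ed c) ω *
        (pivotCount T o o' k c ω * pivotCount T q q' k c ω) := by
    intro ω
    exact branch_mul_branch_le (opens_mem ho ho' _ ω) (opens_mem hq hq' _ ω)
      (reachInf_mem ho' c ω) (reachInf_mem hq' c ω) (ho.mem _ ω) (ho'.mem _ ω)
      (hq.mem _ ω) (hq'.mem _ ω) (pivotCount_nonneg ho ho' k c ω)
      (pivotCount_nonneg hq hq' k c ω)
  calc _ ≤ _ := integral_mono ((hz.mul hz').integrable hm)
        ((((i1.add i2).add i3).add i4).integrable hm) e2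
    _ = (∫ ω, opens o o' (T.ed c) ω * opens q q' (T.ed c) ω ∂P) * t +
        (p (j + 1) * φ (j + 1)) * pivotMean d p φ k (j + 1) +
        (p (j + 1) * φ (j + 1)) * pivotMean d p φ k (j + 1) +
        (∫ ω, o (T.ed c) ω * q (T.ed c) ω ∂P) *
          ∫ ω, pivotCount T o o' k c ω * pivotCount T q q' k c ω ∂P := by
        rw [integral_add (((i1.add i2).add i3).integrable hm) (i4.integrable hm),
          integral_add ((i1.add i2).integrable hm) (i3.integrable hm),
          integral_add (i1.integrable hm) (i2.integrable hm),
          integral_mul_below hm hi hc (f1.mul f2) g1,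
          integral_mul_below hm hi hc f1 g3, integral_mul_below hm hi hc f2 g2,
          integral_mul_below hm hi hc f3 (g2.mul g3),
          integral_reachInf hm hi ho' hC.mean' hp01, hC.mean_opens v c hc,
          hC'.mean_opens v c hc, integral_pivotCount hC hm hi hp01,
          integral_pivotCount hC' hm hi hp01, T.lev_ch v c hc]
    _ ≤ (p (j + 1) * r) * t +
        (p (j + 1) * φ (j + 1)) * pivotMean d p φ k (j + 1) +
        (p (j + 1) * φ (j + 1)) * pivotMean d p φ k (j + 1) +
        (p (j + 1) * h) * B := by
        have hh' := hh v c hc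
        have h0 : 0 ≤ ∫ ω, o (T.ed c) ω * q (T.ed c) ω ∂P :=
          integral_nonneg fun ω => mul_nonneg (ho.mem _ ω).1 (hq.mem _ ω).1
        have k1 : (∫ ω, opens o o' (T.ed c) ω * opens q q' (T.ed c) ω ∂P) * t ≤
            (p (j + 1) * r) * t := mul_le_mul_of_nonneg_right (hr v c hc) ht01.1
        have k2 := mul_le_mul hh' hbound (integral_nonneg fun ω => mul_nonneg
          (pivotCount_nonneg ho ho' k c ω) (pivotCount_nonneg hq hq' k c ω)) (h0.trans hh')
        linarith
    _ = _ := by ring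

/-- One step of the recursion for the correlation of the counts of pivotal openings. -/
lemma integral_pivotCount_mul_succ_le (hC : IsCell T m P p φ o o') (hC' : IsCell T m P p φ q q')
    (hm : ∀ e, m e ≤ mΩ) (hi : iIndep m P) (hp01 : ∀ j, 0 < p (j + 1) ∧ p (j + 1) ≤ 1)
    {h r B : ℝ} (hh : ∀ v, ∀ c ∈ T.ch v, ∫ ω, o (T.ed c) ω * q (T.ed c) ω ∂P ≤ p (T.lev v + 1) * h)
    (hr : ∀ v, ∀ c ∈ T.ch v,
      ∫ ω, opens o o' (T.ed c) ω * opens q q' (T.ed c) ω ∂P ≤ p (T.lev v + 1) * r)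
    {k : ℕ} {v : V} (hbound : ∀ c ∈ T.ch v,
      ∫ ω, pivotCount T o o' k c ω * pivotCount T q q' k c ω ∂P ≤ B) :
    ∫ ω, pivotCount T o o' (k + 1) v ω * pivotCount T q q' (k + 1) v ω ∂P ≤
      pivotFactor d p (T.lev v) (survProb d p (T.lev v + 1)) *
        (r * survProb d p (T.lev v + 1) +
          2 * φ (T.lev v + 1) * pivotMean d p φ k (T.lev v + 1) + h * B) +
      (d (T.lev v) * (p (T.lev v + 1) * branchMean d p φ k (T.lev v))) ^ 2 := by
  have ho := hC.config
  have ho' := hC.config'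
  have hq := hC'.config
  have hq' := hC'.config'
  have hU : ∀ {S : Set E} {f : Ω → ℝ}, BddOn m S f → BddOn m Set.univ f := fun hf =>
    hf.mono (Set.subset_univ _)
  have hz := fun c => hU (bddOn_pivotBranch (T := T) ho ho' k c)
  have hz' := fun c => hU (bddOn_pivotBranch (T := T) hq hq' k c)
  have hs := fun c => hU (bddOn_quiet (T := T) ho v c)
  have hs' := fun c => hU (bddOn_quiet (T := T) hq v c)
  simp only [pivotCount_succ, Finset.sum_mul_sum]
  rw [integral_finsetSum _ fun c _ => (BddOn.sum fun c' _ =>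
    ((hz c).mul (hs c)).mul ((hz' c').mul (hs' c'))).integrable hm]
  simp only [integral_finsetSum _ fun c' _ =>
    (((hz _).mul (hs _)).mul ((hz' c').mul (hs' c'))).integrable hm]
  set j := T.lev v with hj
  set t := survProb d p (j + 1) with ht
  set y := 1 - p (j + 1) * t with hy
  have ht01 := survProb_mem (d := d) hp01 (j + 1)
  have hy0 : 0 ≤ y := by have := hp01 j; rw [hy]; nlinarith
  refine (sum_sum_le_of_diag (T.ch v) _ (A := y ^ (d j - 1) * (p (j + 1) *
    (r * t + 2 * φ (j + 1) * pivotMean d p φ k (j + 1) + h * B)))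
    (sq_nonneg (p (j + 1) * branchMean d p φ k j)) ?_ ?_).trans (le_of_eq ?_)
  · intro c hc
    have e1 : ∀ ω, pivotBranch T o o' k c ω * quiet T o v c ω *
        (pivotBranch T q q' k c ω * quiet T q v c ω) ≤
        (pivotBranch T o o' k c ω * pivotBranch T q q' k c ω) * quiet T o v c ω := by
      intro ω
      have a1 := pivotBranch_nonneg (T := T) ho ho' k c ω
      have a2 := pivotBranch_nonneg (T := T) hq hq' k c ω
      have a3 := quiet_mem (T := T) ho v c ω
      have a4 := quiet_mem (T := T) hq v c ω
      calc _ = (pivotBranch T o o' k c ω * pivotBranch T q q' k c ω) * quiet T o v c ω *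
            quiet T q v c ω := by ring
        _ ≤ _ := mul_le_of_le_one_right (mul_nonneg (mul_nonneg a1 a2) a3.1) a4.2
    have hbb := (bddOn_pivotBranch (T := T) ho ho' k c).mul (bddOn_pivotBranch (T := T) hq hq' k c)
    calc _ ≤ ∫ ω, (pivotBranch T o o' k c ω * pivotBranch T q q' k c ω) * quiet T o v c ω ∂P :=
          integral_mono ((((hz c).mul (hs c)).mul ((hz' c).mul (hs' c))).integrable hm)
            (((hU hbb).mul (hs c)).integrable hm) e1
      _ = (∫ ω, pivotBranch T o o' k c ω * pivotBranch T q q' k c ω ∂P) * y ^ (d j - 1) := by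
          rw [hbb.integral_mul (bddOn_quiet ho v c) hm hi (disjoint_branch_quiet hc),
            integral_quiet hm hi ho hC.mean hp01 hc]
      _ ≤ _ := by
          rw [mul_comm]
          refine mul_le_mul_of_nonneg_left ?_ (pow_nonneg hy0 _)
          exact integral_branch_mul_self_le hC hC' hm hi hp01 hh hr hc (hbound c hc)
  · intro c hc c' hc' hne
    exact integral_branch_mul_le hC hC' hm hi hp01 hc hc' hne
  · rw [T.card_ch, pivotFactor]
    ring

/-- One step of the recursion for the second factorial moment. -/
lemma integral_sq_sub_succ_le (hC : IsCell T m P p φ o o')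
    (hm : ∀ e, m e ≤ mΩ) (hi : iIndep m P) (hp01 : ∀ j, 0 < p (j + 1) ∧ p (j + 1) ≤ 1)
    {B : ℝ} {k : ℕ} {v : V} (hbound : ∀ c ∈ T.ch v,
      ∫ ω, (pivotCount T o o' k c ω ^ 2 - pivotCount T o o' k c ω) ∂P ≤ B) :
    ∫ ω, (pivotCount T o o' (k + 1) v ω ^ 2 - pivotCount T o o' (k + 1) v ω) ∂P ≤
      d (T.lev v) * B + (d (T.lev v) * (p (T.lev v + 1) * branchMean d p φ k (T.lev v))) ^ 2 := by
  classical
  have ho := hC.config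
  have ho' := hC.config'
  have hU : ∀ {S : Set E} {f : Ω → ℝ}, BddOn m S f → BddOn m Set.univ f := fun hf =>
    hf.mono (Set.subset_univ _)
  have hz := fun c => (hU (bddOn_pivotBranch (T := T) ho ho' k c)).mul
    (hU (bddOn_quiet (T := T) ho v c))
  set F : V → V → Ω → ℝ := fun c c' ω => pivotBranch T o o' k c ω * quiet T o v c ω *
      (pivotBranch T o o' k c' ω * quiet T o v c' ω) -
      if c = c' then pivotBranch T o o' k c ω * quiet T o v c ω else 0 with hF
  have hFb : ∀ c c', BddOn m Set.univ (F c c') := by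
    intro c c'
    refine ((hz c).mul (hz c')).sub ?_
    split_ifs
    · exact hz c
    · exact BddOn.const 0
  have e : ∀ ω, pivotCount T o o' (k + 1) v ω ^ 2 - pivotCount T o o' (k + 1) v ω =
      ∑ c ∈ T.ch v, ∑ c' ∈ T.ch v, F c c' ω := by
    intro ω
    simp only [pivotCount_succ, hF, sq, Finset.sum_mul_sum, Finset.sum_sub_distrib,
      Finset.sum_ite_eq]
    congr 1
    exact Finset.sum_congr rfl fun c hc => (if_pos hc).symm
  simp only [e]
  rw [integral_finsetSum _ fun c _ => (BddOn.sum fun c' _ => hFb c c').integrable hm]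
  simp only [integral_finsetSum _ fun c' _ => (hFb _ c').integrable hm]
  refine (sum_sum_le_of_diag (T.ch v) _ (A := B)
    (sq_nonneg (p (T.lev v + 1) * branchMean d p φ k (T.lev v))) ?_ ?_).trans (le_of_eq ?_)
  · intro c hc
    have f3 : BddOn m {T.ed c} fun ω => o (T.ed c) ω * o' (T.ed c) ω :=
      (ho.single _).mul (ho'.single _)
    have g2 := bddOn_pivotCount (T := T) ho ho' k c
    have g3 : BddOn m (T.below c) fun ω => pivotCount T o o' k c ω ^ 2 - pivotCount T o o' k c ω := by
      simpa only [sq] using (g2.mul g2).sub g2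
    have hnn : ∀ ω, 0 ≤ pivotCount T o o' k c ω ^ 2 - pivotCount T o o' k c ω := by
      intro ω
      obtain ⟨n, hn⟩ := pivotCount_eq_natCast (T := T) ho ho' k c ω
      rw [hn, sub_nonneg]
      exact_mod_cast Nat.le_self_pow two_ne_zero n
    refine le_trans (integral_mono ((hFb c c).integrable hm) ((hU g3).integrable hm) ?_)
      (hbound c hc)
    intro ω
    have n1 := hnn ω
    simp only [hF, if_true, pivotBranch, opens]
    rcases ho.zero_or_one (T.ed c) ω with h3 | h3 <;>
    rcases ho'.zero_or_one (T.ed c) ω with h4 | h4 <;>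
    rcases reachInf_zero_or_one (T := T) ho' c ω with h7 | h7 <;>
    rcases quiet_zero_or_one (T := T) ho v c ω with h8 | h8 <;>
    simp only [h3, h4, h7, h8] <;> nlinarith
  · intro c hc c' hc' hne
    simp only [hF, if_neg hne, sub_zero]
    exact integral_branch_mul_le hC hC hm hi hp01 hc hc' hne
  · rw [T.card_ch]
    ring

end

section
variable {d : ℕ → ℕ} {p φ : ℕ → ℝ}

/-- The normalised mean number of pivotal openings in the first `K` levels. -/
noncomputable def pivotTotal (d : ℕ → ℕ) (p : ℕ → ℝ) (K : ℕ) : ℝ :=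
  ∑ i ∈ Finset.range K, pivotWeight d p (i + 1) * survProb d p (i + 1)

lemma pivotWeight_mul_pivotMean_eq (k j : ℕ) :
    pivotWeight d p j * pivotMean d p φ (k + 1) j = φ (j + 1) *
      (pivotWeight d p (j + 1) * survProb d p (j + 1)) +
      (1 - φ (j + 1)) * (pivotWeight d p (j + 1) * pivotMean d p φ k (j + 1)) := by
  rw [pivotMean, pivotWeight_succ]; ring

lemma pivotWeight_mul_pivotMean_le (hp01 : ∀ j, 0 < p (j + 1) ∧ p (j + 1) ≤ 1) {δ : ℝ}
    (hφ : ∀ j, 0 ≤ φ (j + 1) ∧ φ (j + 1) ≤ 1) (hδ : ∀ j, φ (j + 1) ≤ δ) (k j : ℕ) :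
    pivotWeight d p j * pivotMean d p φ k j ≤
      δ * ∑ i ∈ Finset.range k, pivotWeight d p (j + i + 1) * survProb d p (j + i + 1) := by
  induction k generalizing j with
  | zero => simp [pivotMean]
  | succ k ih =>
    rw [pivotWeight_mul_pivotMean_eq, Finset.sum_range_succ', mul_add, add_comm]
    have h1 : ∀ i, 0 ≤ pivotWeight d p i * survProb d p i := fun i =>
      mul_nonneg (pivotWeight_nonneg hp01 i) (survProb_mem hp01 i).1
    refine add_le_add ?_ (mul_le_mul_of_nonneg_right (hδ j) (h1 _))
    have h2 := ih (j + 1)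
    have h3 : 0 ≤ pivotWeight d p (j + 1) * pivotMean d p φ k (j + 1) :=
      mul_nonneg (pivotWeight_nonneg hp01 _) (pivotMean_nonneg hp01 hφ _ _)
    have h4 : (1 - φ (j + 1)) * (pivotWeight d p (j + 1) * pivotMean d p φ k (j + 1)) ≤
        pivotWeight d p (j + 1) * pivotMean d p φ k (j + 1) :=
      mul_le_of_le_one_left h3 (by linarith [(hφ j).1])
    refine (h4.trans h2).trans (le_of_eq ?_)
    congr 1
    refine Finset.sum_congr rfl fun i _ => ?_
    rw [show j + 1 + i = j + (i + 1) by ring]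

lemma le_pivotWeight_mul_pivotMean (hp01 : ∀ j, 0 < p (j + 1) ∧ p (j + 1) ≤ 1) {δ lo : ℝ}
    (hφ : ∀ j, 0 ≤ φ (j + 1) ∧ φ (j + 1) ≤ 1) (hδ : ∀ j, φ (j + 1) ≤ δ) (hδ1 : δ ≤ 1)
    (hlo0 : 0 ≤ lo) (hlo : ∀ j, lo ≤ φ (j + 1)) (k j : ℕ) :
    lo * (1 - δ) ^ k *
      ∑ i ∈ Finset.range k, pivotWeight d p (j + i + 1) * survProb d p (j + i + 1) ≤
      pivotWeight d p j * pivotMean d p φ k j := by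
  have hδ0 : 0 ≤ δ := (hφ 0).1.trans (hδ 0)
  induction k generalizing j with
  | zero => simp [pivotMean]
  | succ k ih =>
    rw [pivotWeight_mul_pivotMean_eq, Finset.sum_range_succ', mul_add, add_comm]
    have h1 : ∀ i, 0 ≤ pivotWeight d p i * survProb d p i := fun i =>
      mul_nonneg (pivotWeight_nonneg hp01 i) (survProb_mem hp01 i).1
    refine add_le_add ?_ ?_
    · refine mul_le_mul_of_nonneg_right ?_ (h1 _)
      exact (mul_le_of_le_one_right hlo0 (pow_le_one₀ (by linarith) (by linarith))).trans (hlo j)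
    · have h2 := ih (j + 1)
      have h3 : 0 ≤ pivotWeight d p (j + 1) * pivotMean d p φ k (j + 1) :=
        mul_nonneg (pivotWeight_nonneg hp01 _) (pivotMean_nonneg hp01 hφ _ _)
      calc _ = (1 - δ) * (lo * (1 - δ) ^ k * ∑ i ∈ Finset.range k,
            pivotWeight d p (j + 1 + i + 1) * survProb d p (j + 1 + i + 1)) := by
            rw [pow_succ]
            have : ∀ i, j + (i + 1) + 1 = j + 1 + i + 1 := fun i => by ring
            simp only [this]
            ring
        _ ≤ (1 - δ) * (pivotWeight d p (j + 1) * pivotMean d p φ k (j + 1)) :=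
            mul_le_mul_of_nonneg_left h2 (by linarith)
        _ ≤ _ := mul_le_mul_of_nonneg_right (by linarith [hδ j]) h3

lemma pivotWeight_mul_pivotMean_le_total (hp01 : ∀ j, 0 < p (j + 1) ∧ p (j + 1) ≤ 1) {δ : ℝ}
    (hφ : ∀ j, 0 ≤ φ (j + 1) ∧ φ (j + 1) ≤ 1) (hδ : ∀ j, φ (j + 1) ≤ δ) {k j K : ℕ}
    (hK : j + k ≤ K) :
    pivotWeight d p j * pivotMean d p φ k j ≤ δ * pivotTotal d p K := by
  have hδ0 : 0 ≤ δ := (hφ 0).1.trans (hδ 0)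
  refine (pivotWeight_mul_pivotMean_le hp01 hφ hδ k j).trans (mul_le_mul_of_nonneg_left ?_ hδ0)
  have h1 : ∀ i, 0 ≤ pivotWeight d p i * survProb d p i := fun i =>
    mul_nonneg (pivotWeight_nonneg hp01 i) (survProb_mem hp01 i).1
  rw [← Finset.sum_image (s := Finset.range k) (g := fun i => j + i)
    (f := fun i => pivotWeight d p (i + 1) * survProb d p (i + 1))
    (fun a _ b _ h => Nat.add_left_cancel h)]
  refine Finset.sum_le_sum_of_subset_of_nonneg (fun x hx => ?_) fun i _ _ => h1 _
  obtain ⟨i, hi, rfl⟩ := Finset.mem_image.1 hx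
  have := Finset.mem_range.1 hi
  exact Finset.mem_range.2 (by omega)

lemma pivotFactor_le {D : ℕ} (hD : ∀ j, d j ≤ D) (hp01 : ∀ j, 0 < p (j + 1) ∧ p (j + 1) ≤ 1)
    (j : ℕ) {t : ℝ} (ht0 : 0 ≤ t) (ht1 : t ≤ 1) : pivotFactor d p j t ≤ D := by
  obtain ⟨h1, h2⟩ := hp01 j
  have : (d j : ℝ) ≤ D := by exact_mod_cast hD j
  have h3 : (1 - p (j + 1) * t) ^ (d j - 1) ≤ 1 := pow_le_one₀ (by nlinarith) (by nlinarith)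
  have h4 : (0 : ℝ) ≤ d j := Nat.cast_nonneg _
  calc _ ≤ (d j : ℝ) * p (j + 1) := mul_le_of_le_one_right (by positivity) h3
    _ ≤ d j := mul_le_of_le_one_right h4 h2
    _ ≤ D := this

/-- A crude bound for the mean number of openings in `k` levels. -/
def crudeMean (D : ℕ) : ℕ → ℝ
  | 0 => 0
  | k + 1 => D * (1 + crudeMean D k)

/-- A crude bound for the second factorial moment of the number of openings in `k` levels. -/
def crudeSq (D : ℕ) : ℕ → ℝ
  | 0 => 0
  | k + 1 => D * crudeSq D k + (D * (1 + crudeMean D k)) ^ 2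

lemma crudeSq_nonneg (D k : ℕ) : 0 ≤ crudeSq D k := by
  induction k with
  | zero => exact le_rfl
  | succ k ih => rw [crudeSq]; positivity

lemma branchMean_le {δ : ℝ} (hp01 : ∀ j, 0 < p (j + 1) ∧ p (j + 1) ≤ 1)
    (hφ : ∀ j, 0 ≤ φ (j + 1) ∧ φ (j + 1) ≤ 1) (hδ : ∀ j, φ (j + 1) ≤ δ) {k j : ℕ} :
    0 ≤ branchMean d p φ k j ∧ branchMean d p φ k j ≤ δ + pivotMean d p φ k (j + 1) := by
  have h := survProb_mem (d := d) hp01 (j + 1)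
  have h2 := pivotMean_nonneg (d := d) hp01 hφ k (j + 1)
  obtain ⟨h3, h4⟩ := hφ j
  have h5 := hδ j
  rw [branchMean]
  constructor
  · have := mul_nonneg h3 h.1
    have := mul_nonneg (sub_nonneg.2 h4) h2
    linarith
  · have := mul_le_of_le_one_right h3 h.2
    have := mul_nonneg h3 h2
    linarith

lemma pivotMean_le_crude {D : ℕ} (hD : ∀ j, d j ≤ D) {δ : ℝ}
    (hp01 : ∀ j, 0 < p (j + 1) ∧ p (j + 1) ≤ 1)
    (hφ : ∀ j, 0 ≤ φ (j + 1) ∧ φ (j + 1) ≤ 1) (hδ : ∀ j, φ (j + 1) ≤ δ) (k j : ℕ) :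
    pivotMean d p φ k j ≤ δ * crudeMean D k := by
  induction k generalizing j with
  | zero => simp [pivotMean, crudeMean]
  | succ k ih =>
    have h := survProb_mem (d := d) hp01 (j + 1)
    have h1 := branchMean_le (d := d) hp01 hφ hδ (k := k) (j := j)
    rw [pivotMean, crudeMean]
    calc _ ≤ (D : ℝ) * (δ + pivotMean d p φ k (j + 1)) :=
          mul_le_mul (pivotFactor_le hD hp01 j h.1 h.2) h1.2 h1.1 (Nat.cast_nonneg _)
      _ ≤ D * (δ + δ * crudeMean D k) := by gcongr; exact ih _
      _ = _ := by ring

variable {V Ω E : Type*} {T : TreeData V E d} {m : E → MeasurableSpace Ω}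
  {o o' q q' : E → Ω → ℝ} [mΩ : MeasurableSpace Ω] {P : Measure Ω} [IsProbabilityMeasure P]

lemma integral_sq_sub_le {D : ℕ} (hD : ∀ j, d j ≤ D) {δ : ℝ} (hC : IsCell T m P p φ o o')
    (hm : ∀ e, m e ≤ mΩ) (hi : iIndep m P) (hp01 : ∀ j, 0 < p (j + 1) ∧ p (j + 1) ≤ 1)
    (hφ : ∀ j, 0 ≤ φ (j + 1) ∧ φ (j + 1) ≤ 1) (hδ : ∀ j, φ (j + 1) ≤ δ) (k : ℕ) (v : V) :
    ∫ ω, (pivotCount T o o' k v ω ^ 2 - pivotCount T o o' k v ω) ∂P ≤ crudeSq D k * δ ^ 2 := by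
  induction k generalizing v with
  | zero => simp [pivotCount, crudeSq]
  | succ k ih =>
    refine (integral_sq_sub_succ_le hC hm hi hp01 fun c _ => ih c).trans ?_
    rw [crudeSq, add_mul]
    have hd : (d (T.lev v) : ℝ) ≤ D := by exact_mod_cast hD _
    have h0 := crudeSq_nonneg D k
    have h1 := branchMean_le (d := d) hp01 hφ hδ (k := k) (j := T.lev v)
    have h2 := pivotMean_le_crude hD hp01 hφ hδ k (T.lev v + 1)
    have h3 := hp01 (T.lev v)
    refine add_le_add ?_ ?_
    · rw [mul_assoc]; gcongr
    · rw [← mul_pow]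
      have h4 : p (T.lev v + 1) * branchMean d p φ k (T.lev v) ≤ (1 + crudeMean D k) * δ := by
        calc _ ≤ branchMean d p φ k (T.lev v) := mul_le_of_le_one_left h1.1 h3.2
          _ ≤ _ := by linarith [h1.2]
      have h5 : 0 ≤ p (T.lev v + 1) * branchMean d p φ k (T.lev v) := mul_nonneg h3.1.le h1.1
      refine pow_le_pow_left₀ (mul_nonneg (Nat.cast_nonneg _) h5) ?_ 2
      rw [mul_assoc]
      exact mul_le_mul hd h4 h5 (Nat.cast_nonneg _)

/-- The coefficients in the bound for the correlations. -/
noncomputable def corrCoeff (d : ℕ → ℕ) (p : ℕ → ℝ) (ε : ℝ) (D K i : ℕ) : ℝ :=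
  (ε ^ D)⁻¹ ^ 2 * pivotTotal d p K ^ 2 / pivotWeight d p i + 2 * pivotTotal d p K + 1

lemma pivotTotal_nonneg (hp01 : ∀ j, 0 < p (j + 1) ∧ p (j + 1) ≤ 1) (K : ℕ) :
    0 ≤ pivotTotal d p K :=
  Finset.sum_nonneg fun _ _ => mul_nonneg (pivotWeight_nonneg hp01 _) (survProb_mem hp01 _).1

lemma corrCoeff_nonneg (hp01 : ∀ j, 0 < p (j + 1) ∧ p (j + 1) ≤ 1) {ε : ℝ} (D K i : ℕ) :
    0 ≤ corrCoeff d p ε D K i := by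
  have h1 := pivotTotal_nonneg (d := d) hp01 K
  have h2 := pivotWeight_nonneg (d := d) hp01 i
  rw [corrCoeff]
  positivity

lemma integral_pivotCount_mul_le {D : ℕ} (hD : ∀ j, d j ≤ D) {ε : ℝ} (hε : 0 < ε) (hε1 : ε < 1)
    {δ : ℝ} (hC : IsCell T m P p φ o o') (hC' : IsCell T m P p φ q q')
    (hm : ∀ e, m e ≤ mΩ) (hi : iIndep m P) (hp01 : ∀ j, 0 < p (j + 1) ∧ p (j + 1) ≤ 1)
    (hpε : ∀ j, p (j + 1) ≤ 1 - ε) (ha : ∀ j, 0 < pivotWeight d p j)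
    (hφ : ∀ j, 0 ≤ φ (j + 1) ∧ φ (j + 1) ≤ 1) (hδ : ∀ j, φ (j + 1) ≤ δ) {h : ℝ} (hh0 : 0 ≤ h)
    (hh : ∀ v, ∀ c ∈ T.ch v, ∫ ω, o (T.ed c) ω * q (T.ed c) ω ∂P ≤ p (T.lev v + 1) * h)
    (hr : ∀ v, ∀ c ∈ T.ch v,
      ∫ ω, opens o o' (T.ed c) ω * opens q q' (T.ed c) ω ∂P ≤ p (T.lev v + 1) * δ ^ 2)
    {K : ℕ} (k : ℕ) (v : V) (hk : T.lev v + k = K) :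
    pivotWeight d p (T.lev v) *
        ∫ ω, pivotCount T o o' k v ω * pivotCount T q q' k v ω ∂P ≤
      ∑ i ∈ Finset.range k, h ^ i * (δ ^ 2 * corrCoeff d p ε D K (T.lev v + i)) := by
  induction k generalizing v with
  | zero => simp [pivotCount]
  | succ k ih =>
    set j := T.lev v with hj
    set S := ∑ i ∈ Finset.range k, h ^ i * (δ ^ 2 * corrCoeff d p ε D K (j + 1 + i)) with hS
    set A := pivotTotal d p K with hA
    have hδ0 : 0 ≤ δ := (hφ 0).1.trans (hδ 0)
    have hS0 : 0 ≤ S := Finset.sum_nonneg fun i _ => mul_nonneg (pow_nonneg hh0 _)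
      (mul_nonneg (sq_nonneg _) (corrCoeff_nonneg hp01 _ _ _))
    have hB : ∀ c ∈ T.ch v, ∫ ω, pivotCount T o o' k c ω * pivotCount T q q' k c ω ∂P ≤
        S / pivotWeight d p (j + 1) := by
      intro c hc
      have hl := T.lev_ch v c hc
      have := ih c (by rw [hl]; omega)
      rw [hl] at this
      rw [le_div_iff₀ (ha _), mul_comm]
      exact this
    have step := integral_pivotCount_mul_succ_le hC hC' hm hi hp01 hh hr hB
    rw [← hj] at step
    have ht := survProb_mem (d := d) hp01 (j + 1)
    have hen := pivotMean_nonneg (d := d) hp01 hφ k (j + 1)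
    have hen' := pivotMean_nonneg (d := d) hp01 hφ (k + 1) j
    have hb := (branchMean_le (d := d) hp01 hφ hδ (k := k) (j := j)).1
    have haj := ha j
    have haj1 := ha (j + 1)
    have hy : ε ≤ 1 - p (j + 1) * survProb d p (j + 1) := by
      have h1 := hpε j
      have h2 := (hp01 j).1
      nlinarith
    have hyD : ε ^ D ≤ (1 - p (j + 1) * survProb d p (j + 1)) ^ (d j - 1) :=
      calc ε ^ D ≤ ε ^ (d j - 1) := pow_le_pow_of_le_one hε.le hε1.le (by have := hD j; omega)
        _ ≤ _ := pow_le_pow_left₀ hε.le hy _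
    have hx : d j * (p (j + 1) * branchMean d p φ k j) ≤
        (ε ^ D)⁻¹ * pivotMean d p φ (k + 1) j := by
      have h0 : 0 ≤ d j * (p (j + 1) * branchMean d p φ k j) :=
        mul_nonneg (Nat.cast_nonneg _) (mul_nonneg (hp01 j).1.le hb)
      rw [inv_mul_eq_div, le_div_iff₀ (by positivity)]
      calc _ ≤ d j * (p (j + 1) * branchMean d p φ k j) *
            (1 - p (j + 1) * survProb d p (j + 1)) ^ (d j - 1) :=
            mul_le_mul_of_nonneg_left hyD h0
        _ = _ := by rw [pivotMean, pivotFactor, branchMean]; ring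
    have hx2 : (d j * (p (j + 1) * branchMean d p φ k j)) ^ 2 ≤
        (ε ^ D)⁻¹ ^ 2 * pivotMean d p φ (k + 1) j ^ 2 := by
      rw [← mul_pow]
      exact pow_le_pow_left₀
        (mul_nonneg (Nat.cast_nonneg _) (mul_nonneg (hp01 j).1.le hb)) hx 2
    have m1 := pivotWeight_mul_pivotMean_le_total (d := d) hp01 hφ hδ
      (show j + (k + 1) ≤ K by omega)
    have m2 := pivotWeight_mul_pivotMean_le_total (d := d) hp01 hφ hδ
      (show (j + 1) + k ≤ K by omega)
    rw [← hA] at m1 m2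
    have m3 : pivotWeight d p j * pivotMean d p φ (k + 1) j ^ 2 ≤
        δ ^ 2 * A ^ 2 / pivotWeight d p j := by
      rw [le_div_iff₀ haj, ← mul_pow]
      calc _ = (pivotWeight d p j * pivotMean d p φ (k + 1) j) ^ 2 := by ring
        _ ≤ _ := pow_le_pow_left₀ (mul_nonneg haj.le hen') m1 2
    have m4 := pivotWeight_mul_survProb_le (d := d) hp01 (j + 1)
    have hfin : ∑ i ∈ Finset.range (k + 1), h ^ i * (δ ^ 2 * corrCoeff d p ε D K (j + i)) =
        h * S + δ ^ 2 * corrCoeff d p ε D K j := by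
      rw [Finset.sum_range_succ', hS, Finset.mul_sum]
      simp only [pow_zero, one_mul, add_zero]
      congr 1
      refine Finset.sum_congr rfl fun i _ => ?_
      rw [show j + (i + 1) = j + 1 + i by ring]
      ring
    rw [hfin]
    calc _ ≤ pivotWeight d p j * (pivotFactor d p j (survProb d p (j + 1)) *
          (δ ^ 2 * survProb d p (j + 1) + 2 * φ (j + 1) * pivotMean d p φ k (j + 1) +
            h * (S / pivotWeight d p (j + 1))) +
          (ε ^ D)⁻¹ ^ 2 * pivotMean d p φ (k + 1) j ^ 2) :=
          mul_le_mul_of_nonneg_left (step.trans (add_le_add_right hx2 _)) haj.le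
      _ = δ ^ 2 * (pivotWeight d p (j + 1) * survProb d p (j + 1)) +
          2 * φ (j + 1) * (pivotWeight d p (j + 1) * pivotMean d p φ k (j + 1)) +
          h * (S / pivotWeight d p (j + 1) * pivotWeight d p (j + 1)) +
          (ε ^ D)⁻¹ ^ 2 * (pivotWeight d p j * pivotMean d p φ (k + 1) j ^ 2) := by
          rw [pivotWeight_succ]; ring
      _ ≤ δ ^ 2 * 1 + 2 * δ * (δ * A) + h * S +
          (ε ^ D)⁻¹ ^ 2 * (δ ^ 2 * A ^ 2 / pivotWeight d p j) := by
          rw [div_mul_cancel₀ _ haj1.ne']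
          have k1 : 2 * φ (j + 1) * (pivotWeight d p (j + 1) * pivotMean d p φ k (j + 1)) ≤
              2 * δ * (δ * A) :=
            mul_le_mul (by linarith [hδ j]) m2 (mul_nonneg haj1.le hen) (by linarith)
          gcongr
      _ = _ := by rw [corrCoeff]; ring

end

/-- The Paley–Zygmund inequality for bounded random variables. -/
lemma paley_zygmund {Ω : Type*} [MeasurableSpace Ω] {P : Measure Ω} [IsProbabilityMeasure P]
    {U : Ω → ℝ} (hU : Measurable U) (hi : Integrable U P) (hi2 : Integrable (fun ω => U ω ^ 2) P)
    {a b : ℝ} (ha : 0 < a) (hb : 0 < b) (h1 : a ≤ ∫ ω, U ω ∂P) (h2 : ∫ ω, U ω ^ 2 ∂P ≤ b) :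
    a ^ 2 / (4 * b) ≤ P.real {ω | a / 2 ≤ U ω} := by
  have hS : MeasurableSet {ω | a / 2 ≤ U ω} := measurableSet_le measurable_const hU
  have hint : Integrable ({ω | a / 2 ≤ U ω}.indicator (fun _ => (1 : ℝ))) P :=
    (integrable_const 1).indicator hS
  set l := a / (2 * b) with hl
  have hl0 : 0 < l := by positivity
  have key : ∫ ω, U ω ∂P ≤ ∫ ω, (a / 2 + (l / 2 * U ω ^ 2 +
      (2 * l)⁻¹ * {ω | a / 2 ≤ U ω}.indicator (fun _ => (1 : ℝ)) ω)) ∂P := by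
    refine integral_mono hi ((integrable_const _).add ((hi2.const_mul _).add (hint.const_mul _)))
      fun ω => ?_
    by_cases h : a / 2 ≤ U ω
    · have : {ω | a / 2 ≤ U ω}.indicator (fun _ => (1 : ℝ)) ω = 1 :=
        Set.indicator_of_mem (s := {ω | a / 2 ≤ U ω}) (show ω ∈ {ω | a / 2 ≤ U ω} from h) _
      simp only [this]
      have e : l / 2 * U ω ^ 2 + (2 * l)⁻¹ * 1 - U ω = (l * U ω - 1) ^ 2 / (2 * l) := by
        field_simp; ring
      have : 0 ≤ (l * U ω - 1) ^ 2 / (2 * l) := by positivity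
      linarith
    · have : {ω | a / 2 ≤ U ω}.indicator (fun _ => (1 : ℝ)) ω = 0 :=
        Set.indicator_of_notMem (s := {ω | a / 2 ≤ U ω}) (show ω ∉ {ω | a / 2 ≤ U ω} from h) _
      simp only [this]
      push Not at h
      have : 0 ≤ l / 2 * U ω ^ 2 := by positivity
      linarith
  have hsum : Integrable (fun ω => l / 2 * U ω ^ 2 +
      (2 * l)⁻¹ * {ω | a / 2 ≤ U ω}.indicator (fun _ => (1 : ℝ)) ω) P :=
    (hi2.const_mul _).add (hint.const_mul _)
  rw [integral_add (integrable_const _) hsum,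
    integral_add (hi2.const_mul _) (hint.const_mul _), integral_const_mul, integral_const_mul,
    integral_indicator_const _ hS] at key
  simp only [integral_const, probReal_univ, smul_eq_mul, one_mul, mul_one] at key
  set x := P.real {ω | a / 2 ≤ U ω}
  have h3 : l / 2 * ∫ ω, U ω ^ 2 ∂P ≤ l / 2 * b := by gcongr
  have h4 : a / 2 ≤ a / 4 + b / a * x := by
    have e1 : l / 2 * b = a / 4 := by rw [hl]; field_simp; norm_num
    have e2 : (2 * l)⁻¹ = b / a := by rw [hl]; field_simp
    rw [e2] at key
    linarith
  have h5 : a / 4 ≤ b / a * x := by linarith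
  rw [div_mul_eq_mul_div, le_div_iff₀ ha] at h5
  rw [div_le_iff₀ (by positivity)]
  linarith

lemma sum_pow_sub_le {x : ℝ} (hx : 0 < x) (i : ℕ) :
    ∑ k ∈ Finset.range i, Real.exp (-(x * ((i : ℝ) - k))) ≤ 1 / x := by
  have h : (1 + x) * Real.exp (-x) ≤ 1 := by
    have := Real.add_one_le_exp x
    calc (1 + x) * Real.exp (-x) ≤ Real.exp x * Real.exp (-x) := by gcongr; linarith
      _ = 1 := by rw [← Real.exp_add]; simp
  induction i with
  | zero => simp; positivity
  | succ i ih =>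
    rw [Finset.sum_range_succ]
    have e : ∑ k ∈ Finset.range i, Real.exp (-(x * (((i + 1 : ℕ) : ℝ) - k))) =
        Real.exp (-x) * ∑ k ∈ Finset.range i, Real.exp (-(x * ((i : ℝ) - k))) := by
      rw [Finset.mul_sum]
      refine Finset.sum_congr rfl fun k _ => ?_
      rw [← Real.exp_add]
      congr 1
      push_cast; ring
    rw [e]
    have e2 : Real.exp (-(x * (((i + 1 : ℕ) : ℝ) - i))) = Real.exp (-x) := by
      congr 1; push_cast; ring
    rw [e2]
    calc _ ≤ Real.exp (-x) * (1 / x) + Real.exp (-x) := by gcongr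
      _ = ((1 + x) * Real.exp (-x)) / x := by field_simp
      _ ≤ 1 / x := by gcongr

lemma sum_sq_eq (x : ℕ → ℝ) (N : ℕ) : (∑ i ∈ Finset.range N, x i) ^ 2 =
    ∑ i ∈ Finset.range N, x i ^ 2 +
      2 * ∑ i ∈ Finset.range N, ∑ k ∈ Finset.range i, x k * x i := by
  induction N with
  | zero => simp
  | succ N ih =>
    rw [Finset.sum_range_succ, Finset.sum_range_succ, Finset.sum_range_succ, add_sq, ih,
      ← Finset.sum_mul]
    ring

section
variable {V Ω E : Type*} {d : ℕ → ℕ} (T : TreeData V E d) (m : E → MeasurableSpace Ω)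
  [mΩ : MeasurableSpace Ω]

/-- A stationary dynamics of the configuration, with the two- and four-time estimates of the
two state Markov chain. -/
structure IsDynamics (P : Measure Ω) (p : ℕ → ℝ) (ε : ℝ) (o : ℝ≥0 → E → Ω → ℝ) : Prop where
  config : ∀ t, IsConfig m (o t)
  mean : ∀ t v, ∀ c ∈ T.ch v, ∫ ω, o t (T.ed c) ω ∂P = p (T.lev v + 1)
  mean_opens : ∀ s t, s ≤ t → ∀ v, ∀ c ∈ T.ch v, ∫ ω, opens (o s) (o t) (T.ed c) ω ∂P =
    p (T.lev v + 1) * ((1 - p (T.lev v + 1)) * (1 - Real.exp (-((t : ℝ) - s))))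
  corr : ∀ s t : ℝ≥0, s ≤ t → (t : ℝ) - s ≤ 1 → ∀ v, ∀ c ∈ T.ch v,
    ∫ ω, o s (T.ed c) ω * o t (T.ed c) ω ∂P ≤
      p (T.lev v + 1) * Real.exp (-(ε / 2 * ((t : ℝ) - s)))
  opens_opens : ∀ s s' t t', s ≤ s' → s' ≤ t → t ≤ t' → ∀ v, ∀ c ∈ T.ch v,
    ∫ ω, opens (o s) (o s') (T.ed c) ω * opens (o t) (o t') (T.ed c) ω ∂P ≤
      p (T.lev v + 1) * (((s' : ℝ) - s) * ((t' : ℝ) - t))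
  change : ∀ s t, s ≤ t → ∀ v, ∀ c ∈ T.ch v,
    ∫ ω, |o s (T.ed c) ω - o t (T.ed c) ω| ∂P ≤ p (T.lev v + 1) * (2 * ((t : ℝ) - s))

variable {T m} {P : Measure Ω} {p : ℕ → ℝ} {ε : ℝ}
  {o : ℝ≥0 → E → Ω → ℝ}

/-- The number of pivotal openings in the first `K` levels in the `i`-th cell of a grid. -/
noncomputable def cellCount (T : TreeData V E d) (o : ℝ≥0 → E → Ω → ℝ) (N K : ℕ) (ρ : V) (i : ℕ)
    (ω : Ω) : ℝ :=
  pivotCount T (o (gridTime N i)) (o (gridTime N (i + 1))) K ρ ω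

/-- The normalised opening probability in a cell of length `1 / N`. -/
noncomputable def openRate (p : ℕ → ℝ) (N j : ℕ) : ℝ := (1 - p j) * (1 - Real.exp (-(1 / N : ℝ)))

lemma IsDynamics.isCell (ho : IsDynamics T m P p ε o) (N i : ℕ) :
    IsCell T m P p (openRate p N) (o (gridTime N i)) (o (gridTime N (i + 1))) where
  config := ho.config _
  config' := ho.config _
  mean := ho.mean _
  mean' := ho.mean _
  mean_opens v c hc := by
    rw [ho.mean_opens _ _ (gridTime_mono N (Nat.le_succ i)) v c hc, Nat.succ_eq_add_one,
      gridTime_succ_sub]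
    rfl

lemma openRate_mem (hp01 : ∀ j, 0 < p (j + 1) ∧ p (j + 1) ≤ 1) (N j : ℕ) :
    (0 ≤ openRate p N (j + 1) ∧ openRate p N (j + 1) ≤ 1) ∧ openRate p N (j + 1) ≤ 1 / N := by
  obtain ⟨h1, h2, h3⟩ := one_sub_exp_neg_mem (t := (1 / N : ℝ)) (by positivity)
  obtain ⟨h4, h5⟩ := hp01 j
  rw [openRate]
  refine ⟨⟨mul_nonneg (by linarith) h1, by nlinarith⟩, by nlinarith⟩

lemma le_openRate (hpε : ∀ j, p (j + 1) ≤ 1 - ε) (hε : 0 < ε) {N : ℕ} (hN : 1 ≤ N) (j : ℕ) :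
    ε / (2 * N) ≤ openRate p N (j + 1) := by
  have hN' : (1 : ℝ) ≤ N := by exact_mod_cast hN
  have h1 : (1 / N : ℝ) / 2 ≤ 1 - Real.exp (-(1 / N : ℝ)) := by
    have hx : (0 : ℝ) ≤ 1 / N := by positivity
    have hx1 : (1 / N : ℝ) ≤ 1 := by rw [div_le_one (by linarith)]; exact hN'
    have h2 := Real.add_one_le_exp (1 / N : ℝ)
    have h3 : Real.exp (-(1 / N : ℝ)) * Real.exp (1 / N : ℝ) = 1 := by
      rw [← Real.exp_add]; simp
    have h4 := Real.exp_pos (-(1 / N : ℝ))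
    set x := (1 / N : ℝ)
    have h5 : Real.exp (-x) * (x + 1) ≤ 1 :=
      (mul_le_mul_of_nonneg_left h2 h4.le).trans h3.le
    nlinarith
  have h2 := hpε j
  rw [openRate]
  calc ε / (2 * N) = ε * ((1 / N : ℝ) / 2) := by field_simp
    _ ≤ _ := mul_le_mul (by linarith) h1 (by positivity) (by linarith)

lemma bddOn_cellCount (ho : IsDynamics T m P p ε o) (N K : ℕ) (ρ : V) (i : ℕ) :
    BddOn m Set.univ (cellCount T o N K ρ i) :=
  (bddOn_pivotCount (ho.config _) (ho.config _) K ρ).mono (Set.subset_univ _)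

/-- The second moment of the number of pivotal openings. -/
lemma integral_sum_cellCount_sq_le [IsProbabilityMeasure P] {D : ℕ} (hD : ∀ j, d j ≤ D) (hε : 0 < ε) (hε1 : ε < 1)
    (ho : IsDynamics T m P p ε o) (hm : ∀ e, m e ≤ mΩ) (hi : iIndep m P)
    (hp01 : ∀ j, 0 < p (j + 1) ∧ p (j + 1) ≤ 1) (hpε : ∀ j, p (j + 1) ≤ 1 - ε)
    (ha : ∀ j, 0 < pivotWeight d p j) {ρ : V} (hρ : T.lev ρ = 0) (K : ℕ) {N : ℕ} (hN : 1 ≤ N) :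
    ∫ ω, (∑ i ∈ Finset.range N, cellCount T o N K ρ i ω) ^ 2 ∂P ≤
      crudeSq D K / N + pivotTotal d p K +
        2 * (Real.exp (ε / 2) * (2 / ε)) *
          ∑ j ∈ Finset.range K, corrCoeff d p ε D K j / (j + 1) := by
  have hN' : (0 : ℝ) < N := by exact_mod_cast hN
  have hb := bddOn_cellCount (T := T) ho N K ρ
  have hφ := fun j => (openRate_mem (p := p) hp01 N j).1
  have hδ := fun j => (openRate_mem (p := p) hp01 N j).2
  have a0 : pivotWeight d p 0 = 1 := by simp [pivotWeight]
  simp only [sum_sq_eq]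
  have hsq : ∀ i, BddOn m Set.univ fun ω => cellCount T o N K ρ i ω ^ 2 := fun i => by
    simpa only [sq] using (hb i).mul (hb i)
  rw [integral_add ((BddOn.sum fun i _ => hsq i).integrable hm)
    (((BddOn.const 2).mul (BddOn.sum fun i _ => BddOn.sum fun k _ =>
      (hb k).mul (hb i))).integrable hm), integral_const_mul,
    integral_finsetSum _ (fun i _ => (hsq i).integrable hm),
    integral_finsetSum _ (fun i _ => (BddOn.sum fun k _ => (hb k).mul (hb i)).integrable hm)]
  simp only [integral_finsetSum _ (fun k _ => ((hb k).mul (hb _)).integrable hm)]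
  have hdiag : ∀ i ∈ Finset.range N, ∫ ω, cellCount T o N K ρ i ω ^ 2 ∂P ≤
      crudeSq D K * (1 / N) ^ 2 + 1 / N * pivotTotal d p K := by
    intro i _
    have h1 := integral_sq_sub_le hD (ho.isCell N i) hm hi hp01 hφ hδ K ρ
    have h2 := integral_pivotCount (ho.isCell N i) hm hi hp01 K ρ
    have h3 := pivotWeight_mul_pivotMean_le_total (d := d) hp01 hφ hδ (show 0 + K ≤ K by omega)
    rw [a0, one_mul, ← hρ, ← h2] at h3
    have h4 := integral_sub ((hsq i).integrable hm) ((hb i).integrable hm) (μ := P)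
    change ∫ ω, (cellCount T o N K ρ i ω ^ 2 - cellCount T o N K ρ i ω) ∂P ≤ _ at h1
    rw [h4] at h1
    change ∫ ω, cellCount T o N K ρ i ω ∂P ≤ _ at h3
    linarith
  have hoff : ∀ i ∈ Finset.range N, ∀ k ∈ Finset.range i,
      ∫ ω, cellCount T o N K ρ k ω * cellCount T o N K ρ i ω ∂P ≤
      ∑ j ∈ Finset.range K, Real.exp (ε / 2) * ((1 / N) ^ 2 * corrCoeff d p ε D K j) *
        Real.exp (-((ε / 2 * (1 / N) * (j + 1)) * ((i : ℝ) - k))) := by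
    intro i hi' k hk
    have hiN := Finset.mem_range.1 hi'
    have hki := Finset.mem_range.1 hk
    have g : ∀ k : ℕ, ((gridTime N k : ℝ≥0) : ℝ) = k / N := fun k => by simp [gridTime]
    have hsub : ((gridTime N i : ℝ≥0) : ℝ) - gridTime N k = ((i : ℝ) - k) * (1 / N) := by
      rw [g, g]; ring
    have hik : (k : ℝ) ≤ i := by exact_mod_cast hki.le
    have hiN' : (i : ℝ) ≤ N := by exact_mod_cast hiN.le
    have hk0 : (0 : ℝ) ≤ k := Nat.cast_nonneg k
    have hle1 : ((i : ℝ) - k) * (1 / N) ≤ 1 := by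
      rw [mul_one_div, div_le_one hN']; linarith
    have hge0 : 0 ≤ ((i : ℝ) - k) * (1 / N) := mul_nonneg (by linarith) (by positivity)
    set h := Real.exp (-(ε / 2 * (((i : ℝ) - k) * (1 / N)))) with hh
    have key := integral_pivotCount_mul_le hD hε hε1 (ho.isCell N k) (ho.isCell N i) hm hi hp01
      hpε ha hφ hδ (h := h) (Real.exp_pos _).le
      (fun v c hc => by
        have := ho.corr _ _ (gridTime_mono N hki.le) (by rw [hsub]; exact hle1) v c hc
        rwa [hsub] at this)
      (fun v c hc => by
        have := ho.opens_opens _ _ _ _ (gridTime_mono N (Nat.le_succ k)) (gridTime_mono N hki)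
          (gridTime_mono N (Nat.le_succ i)) v c hc
        simp only [Nat.succ_eq_add_one] at this
        rw [gridTime_succ_sub, gridTime_succ_sub, ← sq] at this
        exact this) (K := K) K ρ (by omega)
    rw [hρ, a0, one_mul] at key
    refine key.trans (Finset.sum_le_sum fun j _ => ?_)
    rw [zero_add]
    have h1 : h ^ j ≤ Real.exp (ε / 2) *
        Real.exp (-((ε / 2 * (1 / N) * (j + 1)) * ((i : ℝ) - k))) := by
      rw [hh, ← Real.exp_nat_mul, ← Real.exp_add]
      apply Real.exp_le_exp.2
      have : ε / 2 * (((i : ℝ) - k) * (1 / N)) ≤ ε / 2 * 1 := by gcongr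
      calc (j : ℝ) * -(ε / 2 * (((i : ℝ) - k) * (1 / N)))
          = ε / 2 * (((i : ℝ) - k) * (1 / N)) +
            -((ε / 2 * (1 / N) * (j + 1)) * ((i : ℝ) - k)) := by ring
        _ ≤ _ := by linarith
    have h2 := corrCoeff_nonneg (d := d) hp01 (ε := ε) D K j
    calc _ ≤ (Real.exp (ε / 2) * Real.exp (-((ε / 2 * (1 / N) * (j + 1)) * ((i : ℝ) - k)))) *
          ((1 / N) ^ 2 * corrCoeff d p ε D K j) := by gcongr
      _ = _ := by ring
  have hsumdiag : ∑ i ∈ Finset.range N, ∫ ω, cellCount T o N K ρ i ω ^ 2 ∂P ≤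
      crudeSq D K / N + pivotTotal d p K := by
    refine (Finset.sum_le_sum hdiag).trans (le_of_eq ?_)
    rw [Finset.sum_const, Finset.card_range, nsmul_eq_mul]
    field_simp
  have hsumoff : ∑ i ∈ Finset.range N, ∑ k ∈ Finset.range i,
      ∫ ω, cellCount T o N K ρ k ω * cellCount T o N K ρ i ω ∂P ≤
      (Real.exp (ε / 2) * (2 / ε)) *
        ∑ j ∈ Finset.range K, corrCoeff d p ε D K j / (j + 1) := by
    calc _ ≤ ∑ i ∈ Finset.range N, ∑ k ∈ Finset.range i, ∑ j ∈ Finset.range K,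
          Real.exp (ε / 2) * ((1 / N) ^ 2 * corrCoeff d p ε D K j) *
          Real.exp (-((ε / 2 * (1 / N) * (j + 1)) * ((i : ℝ) - k))) :=
          Finset.sum_le_sum fun i hi => Finset.sum_le_sum fun k hk => hoff i hi k hk
      _ = ∑ i ∈ Finset.range N, ∑ j ∈ Finset.range K,
          Real.exp (ε / 2) * ((1 / N) ^ 2 * corrCoeff d p ε D K j) *
          ∑ k ∈ Finset.range i, Real.exp (-((ε / 2 * (1 / N) * (j + 1)) * ((i : ℝ) - k))) := by
          refine Finset.sum_congr rfl fun i _ => ?_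
          rw [Finset.sum_comm]
          simp only [Finset.mul_sum]
      _ ≤ ∑ i ∈ Finset.range N, ∑ j ∈ Finset.range K,
          Real.exp (ε / 2) * ((1 / N) ^ 2 * corrCoeff d p ε D K j) *
          (1 / (ε / 2 * (1 / N) * (j + 1))) := by
          refine Finset.sum_le_sum fun i _ => Finset.sum_le_sum fun j _ => ?_
          have h2 := corrCoeff_nonneg (d := d) hp01 (ε := ε) D K j
          exact mul_le_mul_of_nonneg_left (sum_pow_sub_le (by positivity) i) (by positivity)
      _ = _ := by
          rw [Finset.sum_const, Finset.card_range, nsmul_eq_mul, Finset.mul_sum, Finset.mul_sum]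
          refine Finset.sum_congr rfl fun j _ => ?_
          field_simp
  linarith

end

section
variable {d : ℕ → ℕ} {p : ℕ → ℝ}

lemma harmonic_sub_one_le_pivotTotal {c : ℝ} (hc : 0 < c)
    (h : ∀ j : ℕ, c / (j + 1) ≤ pivotWeight d p j * survProb d p j) (K : ℕ) :
    c * (∑ j ∈ Finset.range K, (1 / ((j : ℝ) + 1)) - 1) ≤ pivotTotal d p K := by
  have h1 : ∑ j ∈ Finset.range K, (1 / ((j : ℝ) + 1)) - 1 ≤
      ∑ j ∈ Finset.range K, (1 / (((j + 1 : ℕ) : ℝ) + 1)) := by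
    have e := Finset.sum_range_succ (fun j : ℕ => 1 / ((j : ℝ) + 1)) K
    rw [Finset.sum_range_succ'] at e
    norm_num at e ⊢
    have : (0 : ℝ) ≤ ((K : ℝ) + 1)⁻¹ := by positivity
    linarith
  calc _ ≤ c * ∑ j ∈ Finset.range K, (1 / (((j + 1 : ℕ) : ℝ) + 1)) := by gcongr
    _ = ∑ j ∈ Finset.range K, c / (((j + 1 : ℕ) : ℝ) + 1) := by
      rw [Finset.mul_sum]; simp only [mul_one_div]
    _ ≤ _ := Finset.sum_le_sum fun j _ => h (j + 1)

lemma tendsto_pivotTotal {c : ℝ} (hc : 0 < c)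
    (h : ∀ j : ℕ, c / (j + 1) ≤ pivotWeight d p j * survProb d p j) :
    Tendsto (pivotTotal d p) atTop atTop := by
  refine tendsto_atTop_mono (harmonic_sub_one_le_pivotTotal hc h) ?_
  refine Tendsto.const_mul_atTop hc ?_
  exact tendsto_atTop_add_const_right _ (-1) Real.tendsto_sum_range_one_div_nat_succ_atTop

lemma sum_corrCoeff_le {ε c : ℝ} (hε : 0 < ε) (hc : 0 < c)
    (h : ∀ j : ℕ, c / (j + 1) ≤ pivotWeight d p j * survProb d p j)
    (ha : ∀ j, 0 < pivotWeight d p j)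
    (hs : Summable fun j : ℕ => ((j + 1) * pivotWeight d p j)⁻¹) (D : ℕ) {K : ℕ}
    (hK : 1 ≤ pivotTotal d p K) :
    ∑ j ∈ Finset.range K, corrCoeff d p ε D K j / (j + 1) ≤
      ((ε ^ D)⁻¹ ^ 2 * (∑' j : ℕ, (((j : ℝ) + 1) * pivotWeight d p j)⁻¹) + 3 * (1 / c + 1)) *
        pivotTotal d p K ^ 2 := by
  set A := pivotTotal d p K with hA
  set H := ∑ j ∈ Finset.range K, (1 / ((j : ℝ) + 1)) with hH
  have hH1 : H ≤ (1 / c + 1) * A := by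
    have h1 := harmonic_sub_one_le_pivotTotal hc h K
    rw [← hH, ← hA] at h1
    have h2 : H - 1 ≤ A / c := by rw [le_div_iff₀ hc]; linarith
    calc H ≤ A / c + 1 := by linarith
      _ ≤ A / c + A := by gcongr
      _ = _ := by ring
  have hH0 : 0 ≤ H := Finset.sum_nonneg fun _ _ => by positivity
  have hsum : ∑ j ∈ Finset.range K, (((j : ℝ) + 1) * pivotWeight d p j)⁻¹ ≤
      ∑' j : ℕ, (((j : ℝ) + 1) * pivotWeight d p j)⁻¹ :=
    hs.sum_le_tsum _ fun j _ => inv_nonneg.2 (mul_nonneg (by positivity) (ha j).le)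
  have e : ∑ j ∈ Finset.range K, corrCoeff d p ε D K j / (j + 1) =
      (ε ^ D)⁻¹ ^ 2 * A ^ 2 * ∑ j ∈ Finset.range K, (((j : ℝ) + 1) * pivotWeight d p j)⁻¹ +
        (2 * A + 1) * H := by
    rw [hH, Finset.mul_sum, Finset.mul_sum, ← Finset.sum_add_distrib]
    refine Finset.sum_congr rfl fun j _ => ?_
    have := (ha j).ne'
    rw [corrCoeff, ← hA]
    field_simp
    ring
  rw [e]
  calc _ ≤ (ε ^ D)⁻¹ ^ 2 * A ^ 2 * (∑' j : ℕ, (((j : ℝ) + 1) * pivotWeight d p j)⁻¹) +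
        (3 * A) * ((1 / c + 1) * A) := by gcongr; linarith
    _ = _ := by ring

end

section
variable {V Ω E : Type*} {d : ℕ → ℕ} {T : TreeData V E d} {m : E → MeasurableSpace Ω}
  [mΩ : MeasurableSpace Ω] {P : Measure Ω} [IsProbabilityMeasure P] {p : ℕ → ℝ} {ε : ℝ}
  {o : ℝ≥0 → E → Ω → ℝ}

lemma le_integral_sum_cellCount (hε : 0 < ε)
    (ho : IsDynamics T m P p ε o) (hm : ∀ e, m e ≤ mΩ) (hi : iIndep m P)
    (hp01 : ∀ j, 0 < p (j + 1) ∧ p (j + 1) ≤ 1) (hpε : ∀ j, p (j + 1) ≤ 1 - ε)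
    {ρ : V} (hρ : T.lev ρ = 0) {K N : ℕ} (hN : 1 ≤ N) (hNK : 2 * K ≤ N) :
    ε / 4 * pivotTotal d p K ≤
      ∫ ω, ∑ i ∈ Finset.range N, cellCount T o N K ρ i ω ∂P := by
  have hN' : (1 : ℝ) ≤ N := by exact_mod_cast hN
  have hb := bddOn_cellCount (T := T) ho N K ρ
  have hφ := fun j => (openRate_mem (p := p) hp01 N j).1
  have hδ := fun j => (openRate_mem (p := p) hp01 N j).2
  have a0 : pivotWeight d p 0 = 1 := by simp [pivotWeight]
  have hδ1 : (1 / N : ℝ) ≤ 1 := by rw [div_le_one (by linarith)]; exact hN'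
  rw [integral_finsetSum _ (fun i _ => (hb i).integrable hm)]
  have h1 := le_pivotWeight_mul_pivotMean (d := d) hp01 hφ hδ hδ1 (lo := ε / (2 * N))
    (by positivity) (le_openRate hpε hε hN) K 0
  simp only [zero_add, a0, one_mul] at h1
  have hpow : (1 / 2 : ℝ) ≤ (1 - 1 / N) ^ K := by
    have h2 := one_add_mul_le_pow (a := -(1 / N : ℝ)) (by linarith) K
    have h3 : (K : ℝ) * (1 / N) ≤ 1 / 2 := by
      have : (2 * K : ℝ) ≤ N := by exact_mod_cast hNK
      rw [mul_one_div, div_le_iff₀ (by linarith)]; linarith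
    have h4 : (1 : ℝ) + -(1 / N) = 1 - 1 / N := by ring
    rw [h4] at h2
    linarith
  have hA := pivotTotal_nonneg (d := d) hp01 K
  have h5 : ε / (4 * N) * pivotTotal d p K ≤ pivotMean d p (openRate p N) K 0 := by
    refine le_trans ?_ h1
    change _ ≤ ε / (2 * N) * (1 - 1 / N) ^ K * pivotTotal d p K
    have : ε / (4 * N) = ε / (2 * N) * (1 / 2) := by field_simp; norm_num
    rw [this]
    gcongr
  calc ε / 4 * pivotTotal d p K = ∑ i ∈ Finset.range N, ε / (4 * N) * pivotTotal d p K := by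
        rw [Finset.sum_const, Finset.card_range, nsmul_eq_mul]; field_simp
    _ ≤ _ := Finset.sum_le_sum fun i _ => by
        have := integral_pivotCount (ho.isCell N i) hm hi hp01 K ρ
        rw [hρ] at this
        exact h5.trans this.ge

/-- Except on an event of small probability each cell contains at most one pivotal opening. -/
lemma real_one_lt_cellCount_le {D : ℕ} (hD : ∀ j, d j ≤ D)
    (ho : IsDynamics T m P p ε o) (hm : ∀ e, m e ≤ mΩ) (hi : iIndep m P)
    (hp01 : ∀ j, 0 < p (j + 1) ∧ p (j + 1) ≤ 1) (ρ : V) (K : ℕ) {N : ℕ} (hN : 1 ≤ N) :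
    P.real {ω | ∃ i ∈ Finset.range N, 1 < cellCount T o N K ρ i ω} ≤ crudeSq D K / N := by
  have hN' : (0 : ℝ) < N := by exact_mod_cast hN
  have hb := bddOn_cellCount (T := T) ho N K ρ
  have hφ := fun j => (openRate_mem (p := p) hp01 N j).1
  have hδ := fun j => (openRate_mem (p := p) hp01 N j).2
  have hset : {ω | ∃ i ∈ Finset.range N, 1 < cellCount T o N K ρ i ω} =
      ⋃ i ∈ Finset.range N, {ω | 1 < cellCount T o N K ρ i ω} := by
    ext ω; simp
  rw [hset]
  refine (measureReal_biUnion_finset_le _ _).trans ?_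
  calc _ ≤ ∑ i ∈ Finset.range N, crudeSq D K * (1 / N) ^ 2 := Finset.sum_le_sum fun i _ => ?_
    _ = _ := by rw [Finset.sum_const, Finset.card_range, nsmul_eq_mul]; field_simp
  refine le_trans ?_ (integral_sq_sub_le hD (ho.isCell N i) hm hi hp01 hφ hδ K ρ)
  change _ ≤ ∫ ω, (cellCount T o N K ρ i ω ^ 2 - cellCount T o N K ρ i ω) ∂P
  have hbb : BddOn m Set.univ fun ω => cellCount T o N K ρ i ω ^ 2 - cellCount T o N K ρ i ω := by
    simpa only [sq] using ((hb i).mul (hb i)).sub (hb i)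
  have hnn : ∀ ω, 0 ≤ cellCount T o N K ρ i ω ^ 2 - cellCount T o N K ρ i ω := fun ω => by
    obtain ⟨n, hn⟩ := pivotCount_eq_natCast (T := T) (ho.config (gridTime N i))
      (ho.config (gridTime N (i + 1))) K ρ ω
    rw [cellCount, hn]
    rcases Nat.eq_zero_or_pos n with h | h
    · simp [h]
    · have : (1 : ℝ) ≤ n := by exact_mod_cast h
      nlinarith
  have := mul_meas_ge_le_integral_of_nonneg (μ := P) (ae_of_all _ hnn) (hbb.integrable hm) 1
  rw [one_mul] at this
  refine le_trans (measureReal_mono (fun ω hω => ?_)) this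
  obtain ⟨n, hn⟩ := pivotCount_eq_natCast (T := T) (ho.config (gridTime N i))
      (ho.config (gridTime N (i + 1))) K ρ ω
  change 1 < cellCount T o N K ρ i ω at hω
  change 1 ≤ cellCount T o N K ρ i ω ^ 2 - cellCount T o N K ρ i ω
  rw [cellCount, hn] at hω ⊢
  have h2 : 2 ≤ n := by exact_mod_cast hω
  have : (2 : ℝ) ≤ n := by exact_mod_cast h2
  nlinarith

/-- With probability bounded away from zero there are many cells with pivotal openings. -/
lemma exists_le_real_card_cellCount {D : ℕ} (hD : ∀ j, d j ≤ D) (hε : 0 < ε) (hε1 : ε < 1)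
    (ho : IsDynamics T m P p ε o) (hm : ∀ e, m e ≤ mΩ) (hi : iIndep m P)
    (hp01 : ∀ j, 0 < p (j + 1) ∧ p (j + 1) ≤ 1) (hpε : ∀ j, p (j + 1) ≤ 1 - ε)
    {c : ℝ} (hc : 0 < c) (h : ∀ j : ℕ, c / (j + 1) ≤ pivotWeight d p j * survProb d p j)
    (ha : ∀ j, 0 < pivotWeight d p j)
    (hs : Summable fun j : ℕ => ((j + 1) * pivotWeight d p j)⁻¹)
    {ρ : V} (hρ : T.lev ρ = 0) :
    ∃ c₀ > 0, ∀ R : ℕ, ∃ N ≥ 1, ∃ K, c₀ ≤ P.real {ω | R ≤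
      ((Finset.range N).filter fun i => cellCount T o N K ρ i ω ≠ 0).card} := by
  set M := 2 + 2 * (Real.exp (ε / 2) * (2 / ε)) *
    ((ε ^ D)⁻¹ ^ 2 * (∑' j : ℕ, (((j : ℝ) + 1) * pivotWeight d p j)⁻¹) + 3 * (1 / c + 1)) with hM
  have hM0 : 0 < M := by
    have : 0 ≤ ∑' j : ℕ, (((j : ℝ) + 1) * pivotWeight d p j)⁻¹ :=
      tsum_nonneg fun j => inv_nonneg.2 (mul_nonneg (by positivity) (ha j).le)
    positivity
  set c₁ := (ε / 4) ^ 2 / (4 * M) with hc₁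
  have hc₁0 : 0 < c₁ := by positivity
  refine ⟨c₁ / 2, by positivity, fun R => ?_⟩
  obtain ⟨K, hK1, hKR⟩ := ((tendsto_pivotTotal hc h).eventually_ge_atTop 1 |>.and
    ((tendsto_pivotTotal hc h).eventually_ge_atTop (8 * R / ε))).exists
  set A := pivotTotal d p K with hA
  obtain ⟨N, hN⟩ := exists_nat_ge (max (2 * K + 1 : ℝ)
    (max (crudeSq D K) (crudeSq D K / (c₁ / 2))))
  have hN1 : (2 * K + 1 : ℝ) ≤ N := (le_max_left _ _).trans hN
  have hN2 : crudeSq D K ≤ N := ((le_max_left _ _).trans (le_max_right _ _)).trans hN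
  have hN3 : crudeSq D K / (c₁ / 2) ≤ N := ((le_max_right _ _).trans (le_max_right _ _)).trans hN
  have hN1' : 2 * K + 1 ≤ N := by exact_mod_cast hN1
  have hNpos : (0 : ℝ) < N := by have : (0 : ℝ) ≤ K := Nat.cast_nonneg K; linarith
  refine ⟨N, by omega, K, ?_⟩
  set U : Ω → ℝ := fun ω => ∑ i ∈ Finset.range N, cellCount T o N K ρ i ω with hU
  have hb : BddOn m Set.univ U := BddOn.sum fun i _ => bddOn_cellCount (T := T) ho N K ρ i
  have hb2 : BddOn m Set.univ fun ω => U ω ^ 2 := by simpa only [sq] using hb.mul hb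
  have hEU := le_integral_sum_cellCount hε ho hm hi hp01 hpε hρ (K := K) (N := N) (by omega)
    (by omega)
  have hEU2 : ∫ ω, U ω ^ 2 ∂P ≤ M * A ^ 2 := by
    refine (integral_sum_cellCount_sq_le hD hε hε1 ho hm hi hp01 hpε ha hρ K (N := N)
      (by omega)).trans ?_
    have h1 : crudeSq D K / N ≤ 1 := by rw [div_le_one hNpos]; exact hN2
    have h2 := sum_corrCoeff_le (d := d) (p := p) hε hc h ha hs D hK1
    have h3 : A ≤ A ^ 2 := by nlinarith
    have h4 : 0 ≤ 2 * (Real.exp (ε / 2) * (2 / ε)) := by positivity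
    have h5 := mul_le_mul_of_nonneg_left h2 h4
    rw [← hA] at h5 ⊢
    rw [hM]
    nlinarith
  have hPZ := paley_zygmund (hb.measurable hm) (hb.integrable hm) (hb2.integrable hm)
    (a := ε / 4 * A) (b := M * A ^ 2) (by positivity) (by positivity) hEU hEU2
  have e1 : (ε / 4 * A) ^ 2 / (4 * (M * A ^ 2)) = c₁ := by
    rw [hc₁]; have : A ≠ 0 := by linarith
    field_simp
  rw [e1] at hPZ
  have hbad := real_one_lt_cellCount_le hD ho hm hi hp01 ρ K (N := N) (by omega)
  have hbad2 : crudeSq D K / N ≤ c₁ / 2 := by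
    rw [div_le_iff₀ (by positivity)] at hN3
    rw [div_le_iff₀ hNpos]; linarith
  have hsub : {ω | ε / 4 * A / 2 ≤ U ω} ⊆
      {ω | R ≤ ((Finset.range N).filter fun i => cellCount T o N K ρ i ω ≠ 0).card} ∪
      {ω | ∃ i ∈ Finset.range N, 1 < cellCount T o N K ρ i ω} := by
    intro ω hω
    by_cases hb : ∃ i ∈ Finset.range N, 1 < cellCount T o N K ρ i ω
    · exact Or.inr hb
    · left
      push Not at hb
      change ε / 4 * A / 2 ≤ U ω at hω
      change R ≤ ((Finset.range N).filter fun i => cellCount T o N K ρ i ω ≠ 0).card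
      have h1 : (R : ℝ) ≤ ε / 4 * A / 2 := by
        rw [div_le_iff₀ hε] at hKR; linarith
      have h2 : U ω ≤ ((Finset.range N).filter fun i => cellCount T o N K ρ i ω ≠ 0).card := by
        rw [hU]
        simp only
        rw [← Finset.sum_filter_ne_zero]
        refine (Finset.sum_le_card_nsmul _ _ 1 fun i hi' => hb i ?_).trans (by simp)
        exact (Finset.mem_filter.1 hi').1
      exact_mod_cast h1.trans (hω.trans h2)
  have := (measureReal_mono hsub (μ := P)).trans (measureReal_union_le _ _)
  linarith

end

section parent
variable {V : Type*} {G : SimpleGraph V} {ρ : V}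

lemma eq_of_adj_of_dist_add_one (hT : G.IsTree) {u u' v : V} (h : G.Adj u v) (h' : G.Adj u' v)
    (hd : G.dist ρ u + 1 = G.dist ρ v) (hd' : G.dist ρ u' + 1 = G.dist ρ v) : u = u' := by
  obtain ⟨q, hq⟩ := hT.connected.exists_walk_length_eq_dist ρ u
  obtain ⟨q', hq'⟩ := hT.connected.exists_walk_length_eq_dist ρ u'
  have h1 : (q.concat h).IsPath :=
    SimpleGraph.Walk.isPath_of_length_eq_dist _ (by rw [SimpleGraph.Walk.length_concat, hq, hd])
  have h2 : (q'.concat h').IsPath :=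
    SimpleGraph.Walk.isPath_of_length_eq_dist _ (by rw [SimpleGraph.Walk.length_concat, hq', hd'])
  have h3 := (hT.isAcyclic.subsingleton_path ρ v).elim ⟨_, h1⟩ ⟨_, h2⟩
  have h4 : q.concat h = q'.concat h' := congrArg Subtype.val h3
  have h5 := congrArg SimpleGraph.Walk.penultimate h4
  simpa using h5

lemma exists_adj_dist_add_one (hT : G.IsTree) {v : V} (hv : v ≠ ρ) :
    ∃ u, G.Adj u v ∧ G.dist ρ u + 1 = G.dist ρ v := by
  obtain ⟨q, hq⟩ := hT.connected.exists_walk_length_eq_dist v ρ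
  cases q with
  | nil => exact absurd rfl hv
  | @cons _ u _ h q' =>
    refine ⟨u, h.symm, ?_⟩
    have h1 := SimpleGraph.dist_le q'
    have h2 := hT.dist_eq_dist_add_one_of_adj ρ h
    rw [SimpleGraph.Walk.length_cons, SimpleGraph.dist_comm] at hq
    rw [SimpleGraph.dist_comm] at h1
    omega

variable (G ρ)

open Classical in
/-- The parent of a vertex in a rooted tree; the root is its own parent. -/
noncomputable def parent (v : V) : V :=
  if h : ∃ u, G.Adj u v ∧ G.dist ρ u + 1 = G.dist ρ v then h.choose else ρ

open Classical in
/-- The edge between a vertex and its parent. -/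
noncomputable def parentEdge (e₀ : G.edgeSet) (v : V) : G.edgeSet :=
  if h : s(parent G ρ v, v) ∈ G.edgeSet then ⟨_, h⟩ else e₀

variable {G ρ}

lemma parent_spec (hT : G.IsTree) {v : V} (hv : v ≠ ρ) :
    G.Adj (parent G ρ v) v ∧ G.dist ρ (parent G ρ v) + 1 = G.dist ρ v := by
  have h := exists_adj_dist_add_one hT hv
  rw [parent, dif_pos h]
  exact h.choose_spec

lemma ne_root_of_dist_pos {v : V} (h : 0 < G.dist ρ v) : v ≠ ρ := by
  rintro rfl; simp at h

lemma dist_pos_of_ne_root (hT : G.IsTree) {v : V} (hv : v ≠ ρ) : 0 < G.dist ρ v :=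
  hT.connected.pos_dist_of_ne hv.symm

lemma parent_eq (hT : G.IsTree) {u v : V} (h : G.Adj u v) (hd : G.dist ρ u + 1 = G.dist ρ v) :
    parent G ρ v = u := by
  have h2 := parent_spec hT (ne_root_of_dist_pos (G := G) (ρ := ρ) (v := v) (by omega))
  exact eq_of_adj_of_dist_add_one hT h2.1 h h2.2 hd

lemma dist_iterate_parent (hT : G.IsTree) {v : V} {k : ℕ} (hk : k ≤ G.dist ρ v) :
    G.dist ρ ((parent G ρ)^[k] v) + k = G.dist ρ v := by
  induction k with
  | zero => simp
  | succ k ih =>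
    have h1 := ih (by omega)
    rw [Function.iterate_succ_apply']
    have h2 := parent_spec hT (ne_root_of_dist_pos (G := G) (ρ := ρ) (v := (parent G ρ)^[k] v) (by omega))
    omega

lemma eq_root_of_dist_eq_zero (hT : G.IsTree) {v : V} (h : G.dist ρ v = 0) : v = ρ := by
  by_contra hv
  have := dist_pos_of_ne_root hT hv
  omega

lemma coe_parentEdge (hT : G.IsTree) (e₀ : G.edgeSet) {v : V} (hv : v ≠ ρ) :
    (parentEdge G ρ e₀ v : Sym2 V) = s(parent G ρ v, v) := by
  have h : s(parent G ρ v, v) ∈ G.edgeSet := (parent_spec hT hv).1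
  rw [parentEdge, dif_pos h]

lemma parentEdge_injOn (hT : G.IsTree) (e₀ : G.edgeSet) {u v : V} (hu : u ≠ ρ) (hv : v ≠ ρ)
    (h : parentEdge G ρ e₀ u = parentEdge G ρ e₀ v) : u = v := by
  have h1 := congrArg Subtype.val h
  rw [coe_parentEdge hT e₀ hu, coe_parentEdge hT e₀ hv, Sym2.eq_iff] at h1
  rcases h1 with h1 | h1
  · exact h1.2
  · have h2 := (parent_spec hT hu).2
    have h3 := (parent_spec hT hv).2
    rw [h1.1] at h2
    rw [← h1.2] at h3
    omega

lemma edgeLevel_parentEdge (hT : G.IsTree) (e₀ : G.edgeSet) {v : V} (hv : v ≠ ρ) :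
    edgeLevel G ρ (parentEdge G ρ e₀ v) = G.dist ρ v := by
  rw [edgeLevel, coe_parentEdge hT e₀ hv]
  have h2 := (parent_spec hT hv).2
  simp only [Sym2.lift_mk]
  omega

/-- The cluster of the root consists of the vertices whose ancestral line is open. -/
lemma mem_cluster_root_iff (hT : G.IsTree) (e₀ : G.edgeSet) (O : Set G.edgeSet) (v : V) :
    v ∈ cluster G O ρ ↔
      ∀ k < G.dist ρ v, parentEdge G ρ e₀ ((parent G ρ)^[k] v) ∈ O := by
  constructor
  · intro h
    obtain ⟨w⟩ := h
    have key : ∀ {a b : V} (w : (openSubgraph G O).Walk a b),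
        (∀ k < G.dist ρ a, parentEdge G ρ e₀ ((parent G ρ)^[k] a) ∈ O) →
        ∀ k < G.dist ρ b, parentEdge G ρ e₀ ((parent G ρ)^[k] b) ∈ O := by
      intro a b w
      induction w with
      | nil => exact fun h => h
      | @cons a c b hac w ih =>
        refine fun h => ih ?_
        rw [openSubgraph, SimpleGraph.fromEdgeSet_adj] at hac
        obtain ⟨⟨⟨e, he⟩, heO, heq⟩, hne⟩ := hac
        change e = s(a, c) at heq
        subst heq
        have hadj : G.Adj a c := he
        rcases hT.dist_eq_dist_add_one_of_adj ρ hadj with hd | hd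
        · have hpar : parent G ρ a = c := parent_eq hT hadj.symm (by omega)
          intro k hk
          have := h (k + 1) (by omega)
          rwa [Function.iterate_succ_apply, hpar] at this
        · have hpar : parent G ρ c = a := parent_eq hT hadj (by omega)
          intro k hk
          rcases k with _ | k
          · have hc : c ≠ ρ := ne_root_of_dist_pos (G := G) (by omega)
            have : parentEdge G ρ e₀ c = ⟨s(a, c), he⟩ :=
              Subtype.ext (by rw [coe_parentEdge hT e₀ hc, hpar])
            simpa [this] using heO
          · rw [Function.iterate_succ_apply, hpar]
            exact h k (by omega)
    exact key w (by simp)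
  · intro h
    obtain ⟨n, hn⟩ : ∃ n, G.dist ρ v = n := ⟨_, rfl⟩
    induction n generalizing v with
    | zero =>
      rw [eq_root_of_dist_eq_zero hT hn]
      exact SimpleGraph.Reachable.refl _
    | succ n ih =>
      have hv : v ≠ ρ := ne_root_of_dist_pos (G := G) (by omega)
      have h1 := parent_spec hT hv
      have h2 : parent G ρ v ∈ cluster G O ρ := by
        refine ih _ (fun k hk => ?_) (by omega)
        have := h (k + 1) (by omega)
        rwa [Function.iterate_succ_apply] at this
      refine SimpleGraph.Reachable.trans h2 (SimpleGraph.Adj.reachable ?_)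
      rw [openSubgraph, SimpleGraph.fromEdgeSet_adj]
      exact ⟨⟨_, h 0 (by omega), by simpa using coe_parentEdge hT e₀ hv⟩, h1.1.ne⟩

lemma iterate_parent_mem_cluster (hT : G.IsTree) (e₀ : G.edgeSet) {O : Set G.edgeSet} {v : V}
    (h : v ∈ cluster G O ρ) {k : ℕ} (hk : k ≤ G.dist ρ v) :
    (parent G ρ)^[k] v ∈ cluster G O ρ := by
  rw [mem_cluster_root_iff hT e₀] at h ⊢
  intro i hi
  rw [← Function.iterate_add_apply]
  have := dist_iterate_parent hT hk
  exact h _ (by omega)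

end parent

namespace IsSphericallySymmetricTree
variable {V : Type*} {G : SimpleGraph V} {ρ : V} {d : ℕ → ℕ}

lemma finite_children (hG : IsSphericallySymmetricTree G ρ d) (v : V) :
    {u | G.Adj v u ∧ G.dist ρ u = G.dist ρ v + 1}.Finite := by
  rw [← Set.encard_lt_top_iff, hG.encard_children]
  exact ENat.natCast_lt_top _

/-- The children of a vertex. -/
noncomputable def children (hG : IsSphericallySymmetricTree G ρ d) (v : V) : Finset V :=
  (hG.finite_children v).toFinset

lemma mem_children (hG : IsSphericallySymmetricTree G ρ d) {v u : V} :
    u ∈ hG.children v ↔ G.Adj v u ∧ G.dist ρ u = G.dist ρ v + 1 := by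
  simp [children]

lemma mem_children_iff (hG : IsSphericallySymmetricTree G ρ d) {v u : V} :
    u ∈ hG.children v ↔ u ≠ ρ ∧ parent G ρ u = v := by
  rw [mem_children]
  constructor
  · rintro ⟨h1, h2⟩
    exact ⟨ne_root_of_dist_pos (G := G) (by omega), parent_eq hG.isTree h1 h2.symm⟩
  · rintro ⟨h1, rfl⟩
    have := parent_spec hG.isTree h1
    exact ⟨this.1, this.2.symm⟩

lemma card_children (hG : IsSphericallySymmetricTree G ρ d) (v : V) :
    (hG.children v).card = d (G.dist ρ v) := by
  have := hG.encard_children v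
  rw [(hG.finite_children v).encard_eq_coe_toFinset_card] at this
  exact_mod_cast this

lemma finite_level (hG : IsSphericallySymmetricTree G ρ d) (n : ℕ) :
    {v | G.dist ρ v = n}.Finite := by
  induction n with
  | zero =>
    refine (Set.finite_singleton ρ).subset fun v hv => ?_
    exact eq_root_of_dist_eq_zero hG.isTree hv
  | succ n ih =>
    refine (ih.biUnion fun v _ => hG.finite_children v).subset fun v hv => ?_
    have hv' : G.dist ρ v = n + 1 := hv
    have := parent_spec hG.isTree (ne_root_of_dist_pos (G := G) (ρ := ρ) (v := v) (by omega))
    simp only [Set.mem_iUnion]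
    exact ⟨parent G ρ v, by change _ = n; omega, this.1, this.2.symm⟩

lemma exists_dist_eq [Infinite V] (hG : IsSphericallySymmetricTree G ρ d) (n : ℕ) :
    ∃ v, G.dist ρ v = n := by
  have h : ∃ v, n ≤ G.dist ρ v := by
    by_contra! h
    refine Set.infinite_univ (α := V) ?_
    refine ((Finset.range n).finite_toSet.biUnion fun k _ => hG.finite_level k).subset
      fun v _ => ?_
    simpa using h v
  obtain ⟨v, hv⟩ := h
  refine ⟨(parent G ρ)^[G.dist ρ v - n] v, ?_⟩
  have := dist_iterate_parent hG.isTree (ρ := ρ) (v := v) (k := G.dist ρ v - n) (by omega)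
  omega

lemma one_le_degree [Infinite V] (hG : IsSphericallySymmetricTree G ρ d) (j : ℕ) : 1 ≤ d j := by
  obtain ⟨v, hv⟩ := hG.exists_dist_eq (j + 1)
  have h1 := parent_spec hG.isTree (ne_root_of_dist_pos (G := G) (ρ := ρ) (v := v) (by omega))
  have h2 : v ∈ hG.children (parent G ρ v) := hG.mem_children.2 ⟨h1.1, h1.2.symm⟩
  have h3 := hG.card_children (parent G ρ v)
  have h4 : G.dist ρ (parent G ρ v) = j := by omega
  rw [h4] at h3
  rw [← h3]
  exact Finset.card_pos.2 ⟨v, h2⟩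

lemma nonempty_edgeSet [Infinite V] (hG : IsSphericallySymmetricTree G ρ d) :
    Nonempty G.edgeSet := by
  obtain ⟨v, hv⟩ := hG.exists_dist_eq 1
  have h1 := parent_spec hG.isTree (ne_root_of_dist_pos (G := G) (ρ := ρ) (v := v) (by omega))
  exact ⟨⟨_, (G.mem_edgeSet).2 h1.1⟩⟩

lemma countable (hG : IsSphericallySymmetricTree G ρ d) : Countable V := by
  rw [← Set.countable_univ_iff]
  refine (Set.countable_iUnion fun n => (hG.finite_level n).countable).mono fun v _ => ?_
  simp

lemma countable_edgeSet (hG : IsSphericallySymmetricTree G ρ d) : Countable G.edgeSet := by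
  have := hG.countable
  exact Subtype.countable

/-- The tree data of a spherically symmetric tree. -/
noncomputable def treeData (hG : IsSphericallySymmetricTree G ρ d) (e₀ : G.edgeSet) :
    TreeData V G.edgeSet d where
  ch := hG.children
  ed := parentEdge G ρ e₀
  below v := {e | ∃ u, G.dist ρ v < G.dist ρ u ∧
    (parent G ρ)^[G.dist ρ u - G.dist ρ v] u = v ∧ parentEdge G ρ e₀ u = e}
  lev := G.dist ρ
  card_ch := hG.card_children
  lev_ch v c hc := (hG.mem_children.1 hc).2
  ed_mem v c hc := by
    have h := (hG.mem_children.1 hc).2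
    refine ⟨c, by omega, ?_, rfl⟩
    rw [h, Nat.add_sub_cancel_left, Function.iterate_one]
    exact (hG.mem_children_iff.1 hc).2
  below_sub v c hc := by
    have h := (hG.mem_children.1 hc).2
    rintro e ⟨u, h1, h2, h3⟩
    refine ⟨u, by omega, ?_, h3⟩
    have : G.dist ρ u - G.dist ρ v = (G.dist ρ u - G.dist ρ c) + 1 := by omega
    rw [this, Function.iterate_succ_apply', h2]
    exact (hG.mem_children_iff.1 hc).2
  ed_notMem v c hc := by
    rintro ⟨u, h1, h2, h3⟩
    have := parentEdge_injOn hG.isTree e₀ (ne_root_of_dist_pos (G := G) (by omega))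
      (hG.mem_children_iff.1 hc).1 h3
    rw [this] at h1
    exact lt_irrefl _ h1
  disj v c hc c' hc' hne := by
    have key : ∀ c ∈ hG.children v, ∀ e ∈ insert (parentEdge G ρ e₀ c)
        {e | ∃ u, G.dist ρ c < G.dist ρ u ∧
          (parent G ρ)^[G.dist ρ u - G.dist ρ c] u = c ∧ parentEdge G ρ e₀ u = e},
        ∃ u, u ≠ ρ ∧ (parent G ρ)^[G.dist ρ u - (G.dist ρ v + 1)] u = c ∧
          parentEdge G ρ e₀ u = e := by
      intro c hc e he
      have h := (hG.mem_children.1 hc).2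
      rcases he with rfl | ⟨u, h1, h2, h3⟩
      · exact ⟨c, (hG.mem_children_iff.1 hc).1, by simp [h], rfl⟩
      · exact ⟨u, ne_root_of_dist_pos (G := G) (by omega), by rw [← h]; exact h2, h3⟩
    rw [Set.disjoint_left]
    intro e he he'
    obtain ⟨u, h0, h1, h2⟩ := key c hc e he
    obtain ⟨u', h0', h1', h2'⟩ := key c' hc' e he'
    have := parentEdge_injOn hG.isTree e₀ h0 h0' (h2.trans h2'.symm)
    subst this
    exact hne (h1.symm.trans h1')

variable {Ω : Type*}

open Classical in
lemma reach_eq_one_iff (hG : IsSphericallySymmetricTree G ρ d) (e₀ : G.edgeSet)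
    {o : G.edgeSet → Ω → ℝ} (ω : Ω) (O : Set G.edgeSet)
    (ho : ∀ e, o e ω = if e ∈ O then 1 else 0) (n : ℕ) (v : V) :
    (reach (hG.treeData e₀) o n v ω = 1 ↔ ∃ u, G.dist ρ u = G.dist ρ v + n ∧
      (parent G ρ)^[n] u = v ∧ ∀ k < n, parentEdge G ρ e₀ ((parent G ρ)^[k] u) ∈ O) ∧
    (reach (hG.treeData e₀) o n v ω = 0 ∨ reach (hG.treeData e₀) o n v ω = 1) := by
  induction n generalizing v with
  | zero => exact ⟨⟨fun _ => ⟨v, by simp⟩, fun _ => rfl⟩, Or.inr rfl⟩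
  | succ n ih =>
    have h01 : ∀ c, o (parentEdge G ρ e₀ c) ω * reach (hG.treeData e₀) o n c ω = 0 ∨
        o (parentEdge G ρ e₀ c) ω * reach (hG.treeData e₀) o n c ω = 1 := by
      intro c
      rw [ho]
      split_ifs
      · rw [one_mul]; exact (ih c).2
      · left; rw [zero_mul]
    have hval : reach (hG.treeData e₀) o (n + 1) v ω = 1 ↔ ∃ c ∈ hG.children v,
        parentEdge G ρ e₀ c ∈ O ∧ reach (hG.treeData e₀) o n c ω = 1 := by
      rw [reach, sub_eq_self, Finset.prod_eq_zero_iff]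
      refine exists_congr fun c => and_congr_right fun hc => ?_
      change 1 - o (parentEdge G ρ e₀ c) ω * _ = 0 ↔ _
      rw [ho]
      split_ifs with h
      · rw [one_mul, sub_eq_zero]; exact ⟨fun h' => ⟨h, h'.symm⟩, fun h' => h'.2.symm⟩
      · simp [h]
    refine ⟨?_, ?_⟩
    · rw [hval]
      constructor
      · rintro ⟨c, hc, hcO, hr⟩
        obtain ⟨u, h1, h2, h3⟩ := (ih c).1.1 hr
        have h := (hG.mem_children.1 hc).2
        refine ⟨u, by omega, ?_, fun k hk => ?_⟩
        · rw [Function.iterate_succ_apply', h2]; exact (hG.mem_children_iff.1 hc).2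
        · rcases Nat.lt_succ_iff_lt_or_eq.1 hk with h' | rfl
          · exact h3 k h'
          · rw [h2]; exact hcO
      · rintro ⟨u, h1, h2, h3⟩
        have h4 := dist_iterate_parent hG.isTree (ρ := ρ) (v := u) (k := n) (by omega)
        have h5 : (parent G ρ)^[n] u ∈ hG.children v := by
          rw [hG.mem_children_iff]
          refine ⟨ne_root_of_dist_pos (G := G) (by omega), ?_⟩
          rw [← Function.iterate_succ_apply' (parent G ρ) n u]; exact h2
        refine ⟨_, h5, h3 n (Nat.lt_succ_self n), (ih _).1.2 ⟨u, by omega, rfl, fun k hk =>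
          h3 k (by omega)⟩⟩
    · rw [reach]
      by_cases h : ∃ c ∈ hG.children v,
          o (parentEdge G ρ e₀ c) ω * reach (hG.treeData e₀) o n c ω = 1
      · obtain ⟨c, hc, h⟩ := h
        right
        rw [sub_eq_self]
        exact Finset.prod_eq_zero hc (by rw [sub_eq_zero]; exact h.symm)
      · push Not at h
        left
        rw [sub_eq_zero, eq_comm]
        refine Finset.prod_eq_one fun c hc => ?_
        change 1 - o (parentEdge G ρ e₀ c) ω * _ = 1
        rw [(h01 c).resolve_right (h c hc), sub_zero]

open Classical in
lemma reach_root_eq_one_iff (hG : IsSphericallySymmetricTree G ρ d) (e₀ : G.edgeSet)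
    {o : G.edgeSet → Ω → ℝ} (ω : Ω) (O : Set G.edgeSet)
    (ho : ∀ e, o e ω = if e ∈ O then 1 else 0) (n : ℕ) :
    reach (hG.treeData e₀) o n ρ ω = 1 ↔ ∃ u ∈ cluster G O ρ, G.dist ρ u = n := by
  rw [(hG.reach_eq_one_iff e₀ ω O ho n ρ).1]
  refine exists_congr fun u => ?_
  rw [mem_cluster_root_iff hG.isTree e₀, SimpleGraph.dist_self, zero_add]
  constructor
  · rintro ⟨h1, h2, h3⟩
    exact ⟨by rwa [h1], h1⟩
  · rintro ⟨h1, rfl⟩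
    have := dist_iterate_parent hG.isTree (ρ := ρ) (v := u) le_rfl
    exact ⟨rfl, eq_root_of_dist_eq_zero hG.isTree (by omega), h1⟩

lemma infinite_cluster_iff (hG : IsSphericallySymmetricTree G ρ d) (e₀ : G.edgeSet)
    (O : Set G.edgeSet) :
    (cluster G O ρ).Infinite ↔ ∀ n, ∃ u ∈ cluster G O ρ, G.dist ρ u = n := by
  constructor
  · intro h n
    by_contra! hn
    refine h ?_
    refine ((Finset.range n).finite_toSet.biUnion fun k _ => hG.finite_level k).subset
      fun v hv => ?_
    have : G.dist ρ v < n := by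
      by_contra! hle
      refine hn _ (iterate_parent_mem_cluster hG.isTree e₀ hv
        (k := G.dist ρ v - n) (by omega)) ?_
      have := dist_iterate_parent hG.isTree (ρ := ρ) (v := v) (k := G.dist ρ v - n) (by omega)
      omega
    simpa using this
  · intro h
    refine Set.Infinite.of_image (G.dist ρ) ?_
    have : G.dist ρ '' cluster G O ρ = Set.univ := Set.eq_univ_of_forall fun n => by
      obtain ⟨u, hu, hn⟩ := h n
      exact ⟨u, hu, hn⟩
    rw [this]
    exact Set.infinite_univ

end IsSphericallySymmetricTree

section
variable {E Ω : Type*} {mΩ : MeasurableSpace Ω} {P : Measure Ω}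

/-- The indicator that an edge is in the open state at time `t`. -/
noncomputable def openInd (X : E → ℝ≥0 → Ω → Bool) (t : ℝ≥0) (e : E) (ω : Ω) : ℝ :=
  if X e t ω = true then 1 else 0

/-- The information about the evolution of an edge. -/
@[reducible]
def edgeField (X : E → ℝ≥0 → Ω → Bool) (e : E) : MeasurableSpace Ω :=
  MeasurableSpace.comap (fun ω (t : ℝ≥0) => X e t ω) inferInstance

lemma measurable_edgeField (X : E → ℝ≥0 → Ω → Bool) (e : E) (t : ℝ≥0) :
    Measurable[edgeField X e] (X e t) :=
  (measurable_pi_apply t).comp (comap_measurable (fun ω (t : ℝ≥0) => X e t ω))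

lemma edgeField_le {X : E → ℝ≥0 → Ω → Bool} (hX : ∀ e t, Measurable (X e t)) (e : E) :
    edgeField X e ≤ mΩ :=
  (measurable_pi_iff.2 fun t => hX e t).comap_le

lemma isConfig_openInd (X : E → ℝ≥0 → Ω → Bool) (t : ℝ≥0) :
    IsConfig (edgeField X) (openInd X t) where
  meas e := by
    have : openInd X t e = (fun b : Bool => if b = true then (1 : ℝ) else 0) ∘ X e t := rfl
    rw [this]
    exact (measurable_of_finite _).comp (measurable_edgeField X e t)
  zero_or_one e ω := by
    unfold openInd
    split_ifs <;> simp

lemma integral_ite_one {A : Ω → Prop} [DecidablePred A] (hA : MeasurableSet {ω | A ω}) :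
    ∫ ω, (if A ω then (1 : ℝ) else 0) ∂P = P.real {ω | A ω} := by
  rw [← integral_indicator_one hA]
  refine integral_congr_ae (ae_of_all _ fun ω => ?_)
  by_cases h : A ω <;> simp [h, Set.indicator]

end

section
variable {Ω : Type*} [mΩ : MeasurableSpace Ω] {P : Measure Ω}
  {V : Type*} {G : SimpleGraph V} {ρ : V} {d : ℕ → ℕ} {p : ℕ → I}
  {X : G.edgeSet → ℝ≥0 → Ω → Bool}

lemma IsDynamicalPercolation.iIndep_edgeField {q : G.edgeSet → I}
    (hX : IsDynamicalPercolation G q P X) : iIndep (edgeField X) P :=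
  hX.indep.iIndep

lemma IsDynamicalPercolation.edgeField_le {q : G.edgeSet → I}
    (hX : IsDynamicalPercolation G q P X) (e : G.edgeSet) : edgeField X e ≤ mΩ :=
  DynPerc.edgeField_le (fun e => (hX.isMarkovChain e).measurable) e

lemma edgeTransition_true_true_le {q : I} {ε t : ℝ} (hε : 0 < ε) (hq : (q : ℝ) ≤ 1 - ε)
    (ht : 0 ≤ t) (ht1 : t ≤ 1) : edgeTransition q t true true ≤ Real.exp (-(ε / 2 * t)) := by
  have h1 : t / 2 ≤ 1 - Real.exp (-t) := by
    have h2 := Real.add_one_le_exp t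
    have h3 : Real.exp (-t) * Real.exp t = 1 := by rw [← Real.exp_add]; simp
    have h4 := Real.exp_pos (-t)
    have h5 : Real.exp (-t) * (t + 1) ≤ 1 := (mul_le_mul_of_nonneg_left h2 h4.le).trans h3.le
    nlinarith
  have h2 := Real.add_one_le_exp (-(ε / 2 * t))
  have e : edgeTransition q t true true = 1 - (1 - q) * (1 - Real.exp (-t)) := by
    simp only [edgeTransition, edgeGenerator, Matrix.add_apply, Matrix.smul_apply, Matrix.of_apply,
      Matrix.one_apply, smul_eq_mul, if_true]
    ring
  rw [e]
  have : ε * (t / 2) ≤ (1 - q) * (1 - Real.exp (-t)) :=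
    mul_le_mul (by linarith) h1 (by positivity) (by linarith)
  linarith

lemma IsDynamicalPercolation.isDynamics [IsProbabilityMeasure P] (hG : IsSphericallySymmetricTree G ρ d) (e₀ : G.edgeSet)
    (hX : IsDynamicalPercolation G (edgeProb G ρ p) P X) {ε : ℝ} (hε : 0 < ε)
    (hp : ∀ n, (p (n + 1) : ℝ) ≤ 1 - ε) :
    IsDynamics (hG.treeData e₀) (edgeField X) P (fun n => (p n : ℝ)) ε (openInd X) := by
  have hq : ∀ v, ∀ c ∈ (hG.treeData e₀).ch v,
      edgeProb G ρ p ((hG.treeData e₀).ed c) = p ((hG.treeData e₀).lev v + 1) := by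
    intro v c hc
    rw [edgeProb]
    change p (edgeLevel G ρ (parentEdge G ρ e₀ c)) = p (G.dist ρ v + 1)
    rw [edgeLevel_parentEdge hG.isTree e₀ (hG.mem_children_iff.1 hc).1, (hG.mem_children.1 hc).2]
  have hms : ∀ e t (b : Bool), MeasurableSet {ω | X e t ω = b} := fun e t b =>
    (hX.isMarkovChain e).measurable t (measurableSet_singleton b)
  have hopens : ∀ s t e ω, opens (openInd X s) (openInd X t) e ω =
      if X e s ω = false ∧ X e t ω = true then 1 else 0 := by
    intro s t e ω
    unfold opens openInd
    cases X e s ω <;> cases X e t ω <;> simp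
  refine ⟨isConfig_openInd X, fun t v c hc => ?_, fun s t hst v c hc => ?_,
    fun s t hst hst1 v c hc => ?_, fun s s' t t' h1 h2 h3 v c hc => ?_, fun s t hst v c hc => ?_⟩
  · rw [← hq v c hc]
    set e := (hG.treeData e₀).ed c
    unfold openInd
    rw [integral_ite_one (hms e t true), (hX.isMarkovChain e).real_one]
    simp [edgeLaw]
  · rw [← hq v c hc]
    set e := (hG.treeData e₀).ed c
    simp only [hopens]
    rw [integral_ite_one (A := fun ω => X e s ω = false ∧ X e t ω = true) ((hms e s false).inter (hms e t true)),
      (hX.isMarkovChain e).real_two hst]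
    simp [edgeLaw, edgeTransition, edgeGenerator]
    ring
  · have hle := hp ((hG.treeData e₀).lev v)
    rw [← hq v c hc] at hle ⊢
    set e := (hG.treeData e₀).ed c
    have : ∀ ω, openInd X s e ω * openInd X t e ω =
        if X e s ω = true ∧ X e t ω = true then 1 else 0 := by
      intro ω
      unfold openInd
      cases X e s ω <;> cases X e t ω <;> simp
    simp only [this]
    rw [integral_ite_one (A := fun ω => X e s ω = true ∧ X e t ω = true) ((hms e s true).inter (hms e t true)),
      (hX.isMarkovChain e).real_two hst]
    simp only [edgeLaw, if_true]
    exact mul_le_mul_of_nonneg_left (edgeTransition_true_true_le hε hle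
      (sub_nonneg.2 (by exact_mod_cast hst)) hst1) (edgeProb G ρ p e).2.1
  · rw [← hq v c hc]
    set e := (hG.treeData e₀).ed c
    have : ∀ ω, opens (openInd X s) (openInd X s') e ω * opens (openInd X t) (openInd X t') e ω =
        if X e s ω = false ∧ X e s' ω = true ∧ X e t ω = false ∧ X e t' ω = true
          then 1 else 0 := by
      intro ω
      rw [hopens, hopens]
      cases X e s ω <;> cases X e s' ω <;> cases X e t ω <;> cases X e t' ω <;> simp
    simp only [this]
    rw [integral_ite_one (A := fun ω => X e s ω = false ∧ X e s' ω = true ∧ X e t ω = false ∧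
      X e t' ω = true) ((hms e s false).inter ((hms e s' true).inter
      ((hms e t false).inter (hms e t' true)))), (hX.isMarkovChain e).real_four h1 h2 h3]
    set q := edgeProb G ρ p e
    have q0 := q.2.1
    have q1 := q.2.2
    obtain ⟨a1, a2, a3⟩ := one_sub_exp_neg_mem (t := (s' : ℝ) - s)
      (sub_nonneg.2 (by exact_mod_cast h1))
    obtain ⟨b1, b2, b3⟩ := one_sub_exp_neg_mem (t := (t : ℝ) - s')
      (sub_nonneg.2 (by exact_mod_cast h2))
    obtain ⟨c1, c2, c3⟩ := one_sub_exp_neg_mem (t := (t' : ℝ) - t)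
      (sub_nonneg.2 (by exact_mod_cast h3))
    have hFT : ∀ u, edgeTransition q u false true = (1 - Real.exp (-u)) * q := by
      intro u; simp [edgeTransition, edgeGenerator]
    have hTF : ∀ u, edgeTransition q u true false = (1 - Real.exp (-u)) * (1 - q) := by
      intro u; simp [edgeTransition, edgeGenerator]
    rw [hFT, hFT, hTF]
    simp only [edgeLaw, Bool.false_eq_true, if_false]
    set x := 1 - Real.exp (-((s' : ℝ) - s))
    set y := 1 - Real.exp (-((t : ℝ) - s'))
    set z := 1 - Real.exp (-((t' : ℝ) - t))
    have hxz : x * z ≤ ((s' : ℝ) - s) * ((t' : ℝ) - t) := mul_le_mul a3 c3 c1 (a1.trans a3)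
    have hk : (1 - (q : ℝ)) * (y * (1 - q) * q) ≤ 1 := by
      have k1 : y * (1 - q) ≤ 1 := mul_le_one₀ b2 (by linarith) (by linarith)
      have k2 : y * (1 - q) * q ≤ 1 := mul_le_one₀ k1 q0 q1
      exact mul_le_one₀ (by linarith) (by have : 0 ≤ 1 - (q : ℝ) := by linarith
                                          positivity) k2
    calc (1 - (q : ℝ)) * (x * q * (y * (1 - q)) * (z * q))
        = q * ((x * z) * ((1 - q) * (y * (1 - q) * q))) := by ring
      _ ≤ q * ((x * z) * 1) := by
        have := mul_nonneg a1 c1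
        gcongr
      _ ≤ _ := by rw [mul_one]; gcongr
  · rw [← hq v c hc]
    set e := (hG.treeData e₀).ed c
    have : ∀ ω, |openInd X s e ω - openInd X t e ω| =
        if X e s ω ≠ X e t ω then 1 else 0 := by
      intro ω
      unfold openInd
      cases X e s ω <;> cases X e t ω <;> simp
    simp only [this]
    rw [integral_ite_one ((hX.isMarkovChain e).measurableSet_ne s t)]
    refine ((hX.isMarkovChain e).real_ne_le hst).trans (le_of_eq (by ring))

end

/-! ### Connected components of sets of times -/

lemma mk_ne_mk_of_notMem {Z : Set ℝ≥0} {x y : Z} {s : ℝ≥0} (hs : s ∉ Z) (hx : (x : ℝ≥0) < s)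
    (hy : s < y) : (x : ConnectedComponents Z) ≠ y := by
  intro h
  rw [ConnectedComponents.coe_eq_coe] at h
  have hpre : IsPreconnected (Subtype.val '' connectedComponent x) :=
    isPreconnected_connectedComponent.image _ continuous_subtype_val.continuousOn
  have := hpre.ordConnected.out ⟨x, mem_connectedComponent, rfl⟩
    ⟨y, by rw [h]; exact mem_connectedComponent, rfl⟩ ⟨hx.le, hy.le⟩
  obtain ⟨z, -, rfl⟩ := this
  exact hs z.2

lemma exists_notMem_of_mk_ne_mk {Z : Set ℝ≥0} {x y : Z} (hxy : (x : ℝ≥0) < y)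
    (h : (x : ConnectedComponents Z) ≠ y) : ∃ s, s ∉ Z ∧ (x : ℝ≥0) < s ∧ s < y := by
  by_contra! hcon
  apply h
  have hsub : Set.Icc (x : ℝ≥0) y ⊆ Z := by
    intro s hs
    by_contra hsZ
    rcases hs.1.eq_or_lt with h1 | h1
    · exact hsZ (h1 ▸ x.2)
    · rcases hs.2.eq_or_lt with h2 | h2
      · exact hsZ (h2 ▸ y.2)
      · exact absurd h2 (not_lt.2 (hcon s hsZ h1))
  have hpre : IsPreconnected ((Subtype.val : Z → ℝ≥0) ⁻¹' Set.Icc (x : ℝ≥0) y) := by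
    rw [← IsInducing.subtypeVal.isPreconnected_image, Subtype.image_preimage_coe,
      Set.inter_eq_right.2 hsub]
    exact isPreconnected_Icc
  rw [ConnectedComponents.coe_eq_coe]
  refine connectedComponent_eq ?_
  exact hpre.subset_connectedComponent ⟨le_rfl, hxy.le⟩ ⟨hxy.le, le_rfl⟩

lemma exists_alternating {Z : Set ℝ≥0} [Infinite (ConnectedComponents Z)] (M : ℕ) :
    ∃ z s : ℕ → ℝ≥0, (∀ k ≤ M, z k ∈ Z) ∧ ∀ k < M, s k ∉ Z ∧ z k < s k ∧ s k < z (k + 1) := by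
  obtain ⟨S, hS⟩ := Infinite.exists_subset_card_eq (ConnectedComponents Z) (M + 1)
  have hout : ∀ c : ConnectedComponents Z, ((Quot.out c : Z) : ConnectedComponents Z) = c :=
    fun c => Quot.out_eq c
  set f : ConnectedComponents Z → ℝ≥0 := fun c => (Quot.out c : Z) with hf
  have hinj : Function.Injective f := fun c c' h => by
    rw [← hout c, ← hout c', Subtype.ext h]
  set F := S.image f with hF
  have hcard : F.card = M + 1 := by rw [hF, Finset.card_image_of_injective _ hinj, hS]
  set g := F.orderEmbOfFin hcard with hg
  set z : ℕ → ℝ≥0 := fun k => if h : k < M + 1 then g ⟨k, h⟩ else 0 with hz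
  have hmem : ∀ k ≤ M, ∃ c : ConnectedComponents Z, f c = z k := by
    intro k hk
    have h1 : z k ∈ F := by
      simp only [hz, dif_pos (Nat.lt_succ_of_le hk)]
      exact Finset.orderEmbOfFin_mem _ _ _
    obtain ⟨c, -, hc⟩ := Finset.mem_image.1 h1
    exact ⟨c, hc⟩
  have hstep : ∀ k < M, ∃ s, s ∉ Z ∧ z k < s ∧ s < z (k + 1) := by
    intro k hk
    obtain ⟨c, hc⟩ := hmem k hk.le
    obtain ⟨c', hc'⟩ := hmem (k + 1) hk
    have hlt : z k < z (k + 1) := by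
      simp only [hz, dif_pos (show k < M + 1 by omega), dif_pos (show k + 1 < M + 1 by omega)]
      exact g.strictMono (by simp [Fin.lt_def])
    rw [← hc, ← hc'] at hlt ⊢
    refine exists_notMem_of_mk_ne_mk hlt ?_
    rw [hout, hout]
    rintro rfl
    exact lt_irrefl _ hlt
  choose! s hs using hstep
  refine ⟨z, s, fun k hk => ?_, hs⟩
  obtain ⟨c, hc⟩ := hmem k hk
  rw [← hc]
  exact (Quot.out c : Z).2

/-- Grid cells whose left end is outside and whose right end is inside a set belong to different
components. -/
lemma card_le_card_connectedComponents {Z : Set ℝ≥0} [Finite (ConnectedComponents Z)] {N : ℕ}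
    (S : Finset ℕ) (hS : ∀ i ∈ S, gridTime N i ∉ Z ∧ gridTime N (i + 1) ∈ Z) :
    S.card ≤ Nat.card (ConnectedComponents Z) := by
  set f : S → ConnectedComponents Z := fun i =>
    ((⟨gridTime N (i + 1), (hS i i.2).2⟩ : Z) : ConnectedComponents Z) with hf
  have key : ∀ i j : S, (i : ℕ) < j → f i ≠ f j := by
    intro i j hij
    refine mk_ne_mk_of_notMem (hS j j.2).1 ?_ ?_
    · refine lt_of_le_of_ne (gridTime_mono N hij) fun h => (hS j j.2).1 ?_
      rw [← h]; exact (hS i i.2).2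
    · refine lt_of_le_of_ne (gridTime_mono N (Nat.le_succ _)) fun h => (hS j j.2).1 ?_
      rw [h]; exact (hS j j.2).2
  have hinj : Function.Injective f := by
    intro i j h
    rcases lt_trichotomy (i : ℕ) j with hlt | heq | hlt
    · exact absurd h (key i j hlt)
    · exact Subtype.ext heq
    · exact absurd h.symm (key j i hlt)
  have := Nat.card_le_card_of_injective f hinj
  simpa using this

lemma le_measure_frequently {Ω : Type*} [MeasurableSpace Ω] {P : Measure Ω} [IsFiniteMeasure P]
    {B : ℕ → Set Ω} (hB : ∀ n, MeasurableSet (B n)) {c : ℝ≥0∞} (h : ∀ n, c ≤ P (B n)) :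
    c ≤ P {ω | ∃ᶠ n in atTop, ω ∈ B n} := by
  have e : {ω | ∃ᶠ n in atTop, ω ∈ B n} = ⋂ m, ⋃ n ≥ m, B n := by
    ext ω; simp [frequently_atTop]
  have ht := tendsto_measure_iInter_atTop (μ := P) (s := fun m => ⋃ n ≥ m, B n)
    (fun m => (MeasurableSet.biUnion (Set.to_countable _) fun n _ => hB n).nullMeasurableSet)
    (fun m m' hmm => Set.biUnion_subset_biUnion_left fun n hn => le_trans hmm hn)
    ⟨0, measure_ne_top _ _⟩
  rw [e]
  refine ge_of_tendsto' ht fun m => (h m).trans (measure_mono ?_)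
  exact Set.subset_biUnion_of_mem (u := B) (show m ∈ {n | n ≥ m} from le_refl m)

section
variable {Ω : Type*} {V : Type*} {G : SimpleGraph V} {ρ : V} {d : ℕ → ℕ} {p : ℕ → I}
  {X : G.edgeSet → ℝ≥0 → Ω → Bool}

lemma reachInf_root_eq_one_iff (hG : IsSphericallySymmetricTree G ρ d) (e₀ : G.edgeSet)
    (t : ℝ≥0) (ω : Ω) : reachInf (hG.treeData e₀) (openInd X t) ρ ω = 1 ↔
      (cluster G {e | X e t ω = true} ρ).Infinite := by
  have hc := isConfig_openInd X t
  have hn : ∀ n, reach (hG.treeData e₀) (openInd X t) n ρ ω = 1 ↔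
      ∃ u ∈ cluster G {e | X e t ω = true} ρ, G.dist ρ u = n := by
    classical
    refine hG.reach_root_eq_one_iff e₀ ω _ fun e => ?_
    simp only [openInd, Set.mem_ofPred_eq]
    congr
  rw [hG.infinite_cluster_iff e₀]
  simp only [← hn]
  constructor
  · intro h n
    have h1 := reachInf_le_reach hc n ρ ω (T := hG.treeData e₀)
    have h2 := (reach_mem hc n ρ ω (T := hG.treeData e₀)).2
    linarith
  · intro h
    rw [reachInf]
    simp [h]

/-- If with probability bounded away from zero there are many cells with pivotal openings, then
there are infinitely many components with positive probability. -/
lemma measure_infinite_components_pos [MeasurableSpace Ω] {P : Measure Ω} [IsProbabilityMeasure P] [Countable G.edgeSet]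
    (hG : IsSphericallySymmetricTree G ρ d) (e₀ : G.edgeSet) {q : G.edgeSet → I}
    (hX : IsDynamicalPercolation G q P X) {c : ℝ} (hc : 0 < c)
    (h : ∀ R : ℕ, ∃ N ≥ 1, ∃ K, c ≤ P.real {ω | R ≤ ((Finset.range N).filter fun i =>
      cellCount (hG.treeData e₀) (openInd X) N K ρ i ω ≠ 0).card}) :
    0 < P {ω | Infinite (ConnectedComponents (percolationTimes G ρ X ω))} := by
  choose N hN K hK using h
  set B : ℕ → Set Ω := fun R => {ω | R ≤ ((Finset.range (N R)).filter fun i =>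
      cellCount (hG.treeData e₀) (openInd X) (N R) (K R) ρ i ω ≠ 0).card} with hB
  have hBm : ∀ R, MeasurableSet (B R) := by
    intro R
    have hmeas : ∀ i, Measurable (cellCount (hG.treeData e₀) (openInd X) (N R) (K R) ρ i) :=
      fun i => (bddOn_pivotCount (isConfig_openInd X _) (isConfig_openInd X _) _ _).measurable
        hX.edgeField_le
    simp only [hB, Finset.card_filter]
    refine measurableSet_le measurable_const (Finset.measurable_sum _ fun i _ => ?_)
    exact Measurable.ite ((measurableSet_singleton (0 : ℝ)).compl.preimage (hmeas i))
      measurable_const measurable_const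
  have hgood : ∀ᵐ ω ∂P, ∀ N i e, ContinuousAt (fun s => X e s ω) (gridTime N i) := by
    rw [ae_all_iff]; intro N
    rw [ae_all_iff]; intro i
    rw [ae_all_iff]; intro e
    exact (hX.isMarkovChain e).ae_continuousAt _
  have hlow := le_measure_frequently hBm (P := P) (c := ENNReal.ofReal c) fun R =>
    (ENNReal.ofReal_le_ofReal (hK R)).trans_eq (ofReal_measureReal (measure_ne_top _ _))
  refine (ENNReal.ofReal_pos.2 hc).trans_le (hlow.trans (measure_mono_ae ?_))
  filter_upwards [hgood] with ω hω hfreq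
  change ∃ᶠ R in atTop, ω ∈ B R at hfreq
  change Infinite (ConnectedComponents (percolationTimes G ρ X ω))
  by_contra hfin
  rw [not_infinite_iff_finite] at hfin
  obtain ⟨R, hR, hRB⟩ := (frequently_atTop.1 hfreq)
    (Nat.card (ConnectedComponents (percolationTimes G ρ X ω)) + 1)
  have hon : ∀ i, onEdges X (gridTime (N R) i) ω = {e | X e (gridTime (N R) i) ω = true} := by
    intro i
    ext e
    simp only [onEdges, Set.mem_ofPred_eq, or_iff_left_iff_imp]
    exact fun hcon => absurd (hω (N R) i e) hcon
  have hle := card_le_card_connectedComponents (Z := percolationTimes G ρ X ω) (N := N R)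
    ((Finset.range (N R)).filter fun i =>
      cellCount (hG.treeData e₀) (openInd X) (N R) (K R) ρ i ω ≠ 0) (fun i hi => by
    obtain ⟨hi1, hi2⟩ := Finset.mem_filter.1 hi
    obtain ⟨h0, h1⟩ := reachInf_of_pivotCount_ne_zero (isConfig_openInd X _)
      (isConfig_openInd X _) hi2
    have h0' : ¬ reachInf (hG.treeData e₀) (openInd X (gridTime (N R) i)) ρ ω = 1 := by
      rw [h0]; norm_num
    rw [reachInf_root_eq_one_iff] at h0' h1
    refine ⟨fun hmem => h0' ?_, ⟨⟨zero_le, ?_⟩, ?_⟩⟩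
    · have := hmem.2
      rwa [hon] at this
    · have hN1 := hN R
      have hlt := Finset.mem_range.1 hi1
      rw [gridTime, div_le_one (by exact_mod_cast hN1)]
      exact_mod_cast hlt
    · rw [hon]; exact h1)
  have : R ≤ _ := hRB
  omega

end

lemma measure_eventually_mem_le {Ω : Type*} [MeasurableSpace Ω] {P : Measure Ω} {A : ℕ → Set Ω}
    {c : ℝ≥0∞} (h : ∀ᶠ n in atTop, P (A n) ≤ c) : P {ω | ∀ᶠ n in atTop, ω ∈ A n} ≤ c := by
  have e : {ω | ∀ᶠ n in atTop, ω ∈ A n} = ⋃ N, ⋂ n ≥ N, A n := by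
    ext ω; simp [eventually_atTop]
  have hmono : Monotone fun N => ⋂ n ≥ N, A n := fun N N' hN =>
    Set.biInter_subset_biInter_left fun n hn => le_trans hN hn
  rw [e, hmono.measure_iUnion]
  refine iSup_le fun N => ?_
  obtain ⟨n, hn, hn'⟩ := (h.and (eventually_ge_atTop N)).exists
  exact (measure_mono (Set.iInter₂_subset n hn')).trans hn

lemma eventually_exists_grid_Ioo {a b : ℝ≥0} (hab : a < b) (hb : b ≤ 1) :
    ∀ᶠ N : ℕ in atTop, ∃ i ≤ N, a < gridTime N i ∧ gridTime N i < b := by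
  filter_upwards [eventually_exists_grid (lt_of_le_of_lt (zero_le) hab) hb hab
    (show b < b + 1 by simp)] with N ⟨i, hi, h1, h2, _⟩
  exact ⟨i, hi.le, h1, h2⟩

lemma le_sum_abs_sub {f : ℕ → ℝ} {τ s : ℕ → ℕ} {M N : ℕ} (h1 : ∀ k < M, τ k ≤ s k)
    (h2 : ∀ k < M, s k ≤ τ (k + 1)) (hN : τ M ≤ N) (hf : ∀ k < M, 1 ≤ |f (s k) - f (τ k)|) :
    (M : ℝ) ≤ ∑ i ∈ Finset.range N, |f (i + 1) - f i| := by
  have key : ∀ k ≤ M, (k : ℝ) ≤ ∑ i ∈ Finset.range (τ k), |f (i + 1) - f i| := by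
    intro k
    induction k with
    | zero => intro _; simpa using Finset.sum_nonneg fun i _ => abs_nonneg _
    | succ k ih =>
      intro hk
      have ih' := ih (by omega)
      have hτs := h1 k (by omega)
      have hsτ := h2 k (by omega)
      have h3 := Finset.sum_range_add_sum_Ico (fun i => |f (i + 1) - f i|) hτs
      have h4 : |f (s k) - f (τ k)| ≤ ∑ i ∈ Finset.Ico (τ k) (s k), |f (i + 1) - f i| := by
        rw [← Finset.sum_Ico_sub f hτs]
        exact Finset.abs_sum_le_sum_abs _ _
      have h5 : ∑ i ∈ Finset.range (s k), |f (i + 1) - f i| ≤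
          ∑ i ∈ Finset.range (τ (k + 1)), |f (i + 1) - f i| :=
        Finset.sum_le_sum_of_subset_of_nonneg (Finset.range_mono hsτ) fun _ _ _ => abs_nonneg _
      have h6 := hf k (by omega)
      push_cast
      linarith
  exact (key M le_rfl).trans (Finset.sum_le_sum_of_subset_of_nonneg (Finset.range_mono hN)
    fun _ _ _ => abs_nonneg _)

section
variable {Ω : Type*} {V : Type*} {G : SimpleGraph V} {ρ : V} {d : ℕ → ℕ}
  {X : G.edgeSet → ℝ≥0 → Ω → Bool}

lemma reach_root_openInd_eq_one_iff (hG : IsSphericallySymmetricTree G ρ d) (e₀ : G.edgeSet)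
    (n : ℕ) (t : ℝ≥0) (ω : Ω) : reach (hG.treeData e₀) (openInd X t) n ρ ω = 1 ↔
      ∃ u ∈ cluster G {e | X e t ω = true} ρ, G.dist ρ u = n := by
  classical
  refine hG.reach_root_eq_one_iff e₀ ω _ (fun e => ?_) n
  simp only [openInd, Set.mem_ofPred_eq]
  congr

lemma IsRegularPath.eventually_right {x : ℝ≥0 → Bool} (hx : IsRegularPath x) {t : ℝ≥0}
    (h : x t = true) : ∀ᶠ s in 𝓝[≥] t, x s = true := by
  filter_upwards [hx.right t] with s hs
  rw [hs, h]

lemma eventually_eq_of_continuousAt {x : ℝ≥0 → Bool} {t : ℝ≥0} (h : ContinuousAt x t) :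
    ∀ᶠ s in 𝓝 t, x s = x t := by
  rwa [ContinuousAt, nhds_discrete Bool, tendsto_pure] at h

/-- Near a time at which the root percolates there is an interval of times at which the root is
joined to level `n` by edges in the open state. -/
lemma exists_Ioo_reach_eq_one (hG : IsSphericallySymmetricTree G ρ d) (e₀ : G.edgeSet) {ω : Ω}
    (hreg : ∀ e, IsRegularPath fun t => X e t ω)
    (hsim : ∀ e e', e ≠ e' → ∀ t ≤ 1, ContinuousAt (fun s => X e s ω) t ∨
      ContinuousAt (fun s => X e' s ω) t)
    (hone : ∀ e, ContinuousAt (fun s => X e s ω) 1) {t : ℝ≥0}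
    (ht : t ∈ percolationTimes G ρ X ω) {U : Set ℝ≥0} (hU : U ∈ 𝓝 t) (n : ℕ) :
    ∃ a b, a < b ∧ b ≤ 1 ∧ ∀ s, a < s → s < b → s ∈ U ∧
      reach (hG.treeData e₀) (openInd X s) n ρ ω = 1 := by
  obtain ⟨⟨-, ht1⟩, hinf⟩ := ht
  obtain ⟨u, hu, hun⟩ := (hG.infinite_cluster_iff e₀ _).1 hinf n
  rw [mem_cluster_root_iff hG.isTree e₀, hun] at hu
  have hreach : ∀ s, (∀ k < n, X (parentEdge G ρ e₀ ((parent G ρ)^[k] u)) s ω = true) →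
      reach (hG.treeData e₀) (openInd X s) n ρ ω = 1 := fun s hs => by
    rw [reach_root_openInd_eq_one_iff]
    exact ⟨u, (mem_cluster_root_iff hG.isTree e₀ _ u).2 (by rw [hun]; exact hs), hun⟩
  set F : ℕ → G.edgeSet := fun k => parentEdge G ρ e₀ ((parent G ρ)^[k] u) with hF
  have hleft : 0 < t → (∀ᶠ s in 𝓝[<] t, ∀ k < n, X (F k) s ω = true) →
      ∃ a b, a < b ∧ b ≤ 1 ∧ ∀ s, a < s → s < b → s ∈ U ∧
        reach (hG.treeData e₀) (openInd X s) n ρ ω = 1 := by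
    intro ht0 h
    obtain ⟨a, ha, hs⟩ := exists_Ioo_left ht0 (h.and (mem_nhdsWithin_of_mem_nhds hU))
    exact ⟨a, t, ha, ht1, fun s h1 h2 => ⟨(hs s h1 h2).2, hreach s (hs s h1 h2).1⟩⟩
  by_cases hall : ∀ k < n, X (F k) t ω = true
  · rcases ht1.lt_or_eq with ht1' | rfl
    · have h : ∀ᶠ s in 𝓝[≥] t, ∀ k < n, X (F k) s ω = true :=
        (Set.finite_lt_nat n).eventually_all.2 fun k hk =>
          (hreg (F k)).eventually_right (hall k hk)
      obtain ⟨b, hb, hs⟩ := exists_Ico_right (h.and (mem_nhdsWithin_of_mem_nhds hU))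
      exact ⟨t, min b 1, lt_min hb ht1', min_le_right _ _, fun s h1 h2 =>
        ⟨(hs s h1.le (h2.trans_le (min_le_left _ _))).2,
          hreach s (hs s h1.le (h2.trans_le (min_le_left _ _))).1⟩⟩
    · refine hleft one_pos (nhdsWithin_le_nhds ((Set.finite_lt_nat n).eventually_all.2
        fun k hk => ?_))
      filter_upwards [eventually_eq_of_continuousAt (hone (F k))] with s hs
      rw [hs]; exact hall k hk
  · push Not at hall
    obtain ⟨k₀, hk₀, hX0⟩ := hall
    have hdis : ¬ ContinuousAt (fun s => X (F k₀) s ω) t := (hu k₀ hk₀).resolve_left hX0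
    refine hleft ((hreg _).pos_of_not_continuousAt hdis)
      ((Set.finite_lt_nat n).eventually_all.2 fun k hk => ?_)
    by_cases hke : F k = F k₀
    · filter_upwards [(hreg _).exists_left hdis] with s hs
      rw [hke]
      revert hs hX0
      cases X (F k₀) s ω <;> cases X (F k₀) t ω <;> simp
    · have hcont : ContinuousAt (fun s => X (F k) s ω) t :=
        (hsim _ _ hke t ht1).resolve_right hdis
      have htrue : X (F k) t ω = true := (hu k hk).resolve_right (not_not.2 hcont)
      refine nhdsWithin_le_nhds ?_
      filter_upwards [eventually_eq_of_continuousAt hcont] with s hs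
      rw [hs]; exact htrue

/-- Near a time at which the root does not percolate the root is not joined to level `n` by edges
in the open state, if `n` is large. -/
lemma eventually_reach_ne_one (hG : IsSphericallySymmetricTree G ρ d) (e₀ : G.edgeSet) {ω : Ω}
    {t : ℝ≥0} (ht1 : t ≤ 1) (ht : t ∉ percolationTimes G ρ X ω) :
    ∀ᶠ n in atTop, ∀ᶠ s in 𝓝 t, reach (hG.treeData e₀) (openInd X s) n ρ ω ≠ 1 := by
  have hfin : ¬ (cluster G (onEdges X t ω) ρ).Infinite := fun h => ht ⟨⟨zero_le, ht1⟩, h⟩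
  rw [hG.infinite_cluster_iff e₀] at hfin
  push Not at hfin
  obtain ⟨n₀, hn₀⟩ := hfin
  filter_upwards [eventually_ge_atTop n₀] with n hn
  have hF : ({v | G.dist ρ v ≤ n} : Set V).Finite := by
    refine ((Finset.range (n + 1)).finite_toSet.biUnion fun k _ => hG.finite_level k).subset
      fun v hv => ?_
    have hv' : G.dist ρ v ≤ n := hv
    simpa using Nat.lt_succ_of_le hv'
  have hall : ∀ᶠ s in 𝓝 t, ∀ v ∈ {v | G.dist ρ v ≤ n},
      X (parentEdge G ρ e₀ v) s ω = true → parentEdge G ρ e₀ v ∈ onEdges X t ω := by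
    rw [hF.eventually_all]
    intro v _
    by_cases hon : parentEdge G ρ e₀ v ∈ onEdges X t ω
    · exact Eventually.of_forall fun s _ => hon
    · have hon' : ¬ (X (parentEdge G ρ e₀ v) t ω = true ∨
        ¬ ContinuousAt (fun s => X (parentEdge G ρ e₀ v) s ω) t) := hon
      push Not at hon'
      filter_upwards [eventually_eq_of_continuousAt hon'.2] with s hs h
      rw [hs] at h
      exact absurd h hon'.1
  filter_upwards [hall] with s hs h
  rw [reach_root_openInd_eq_one_iff] at h
  obtain ⟨u, hu, hun⟩ := h
  have hon : u ∈ cluster G (onEdges X t ω) ρ := by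
    rw [mem_cluster_root_iff hG.isTree e₀] at hu ⊢
    intro k hk
    refine hs _ ?_ (hu k hk)
    have := dist_iterate_parent hG.isTree (ρ := ρ) hk.le
    change G.dist ρ _ ≤ n
    omega
  refine hn₀ _ (iterate_parent_mem_cluster hG.isTree e₀ hon (k := n - n₀) (by omega)) ?_
  have := dist_iterate_parent hG.isTree (ρ := ρ) (v := u) (k := n - n₀) (by omega)
  omega

/-- The variation along a grid of the indicator that the root is joined to level `n`. -/
noncomputable def gridVariation (hG : IsSphericallySymmetricTree G ρ d) (e₀ : G.edgeSet)
    (X : G.edgeSet → ℝ≥0 → Ω → Bool) (n N : ℕ) (ω : Ω) : ℝ :=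
  ∑ i ∈ Finset.range N, |reach (hG.treeData e₀) (openInd X (gridTime N (i + 1))) n ρ ω -
    reach (hG.treeData e₀) (openInd X (gridTime N i)) n ρ ω|

lemma eventually_le_gridVariation (hG : IsSphericallySymmetricTree G ρ d) (e₀ : G.edgeSet) {ω : Ω}
    (hreg : ∀ e, IsRegularPath fun t => X e t ω)
    (hsim : ∀ e e', e ≠ e' → ∀ t ≤ 1, ContinuousAt (fun s => X e s ω) t ∨
      ContinuousAt (fun s => X e' s ω) t)
    (hone : ∀ e, ContinuousAt (fun s => X e s ω) 1)
    (hinf : Infinite (ConnectedComponents (percolationTimes G ρ X ω))) (M : ℕ) :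
    ∀ᶠ n in atTop, ∀ᶠ N in atTop, (M : ℝ) ≤ gridVariation hG e₀ X n N ω := by
  obtain ⟨z, s, hz, hs⟩ := exists_alternating (Z := percolationTimes G ρ X ω) M
  have hs1 : ∀ k < M, s k ≤ 1 := fun k hk =>
    (hs k hk).2.2.le.trans (hz (k + 1) hk).1.2
  have hn : ∀ᶠ n in atTop, ∀ k < M, ∀ᶠ r in 𝓝 (s k),
      reach (hG.treeData e₀) (openInd X r) n ρ ω ≠ 1 :=
    (Set.finite_lt_nat M).eventually_all.2 fun k hk =>
      eventually_reach_ne_one hG e₀ (hs1 k hk) (hs k hk).1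
  filter_upwards [hn] with n hn
  have hsep : ∀ k < M, ∃ c c', z k < c ∧ c < s k ∧ s k < c' ∧ c' < z (k + 1) := by
    intro k hk
    obtain ⟨c, h1, h2⟩ := exists_between (hs k hk).2.1
    obtain ⟨c', h3, h4⟩ := exists_between (hs k hk).2.2
    exact ⟨c, c', h1, h2, h3, h4⟩
  choose! c c' hc1 hc2 hc3 hc4 using hsep
  have hτ : ∀ᶠ N in atTop, ∀ k < M + 1, ∃ i ≤ N, (k < M → gridTime N i < c k) ∧
      (∀ l < M, k = l + 1 → c' l < gridTime N i) ∧
      reach (hG.treeData e₀) (openInd X (gridTime N i)) n ρ ω = 1 := by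
    refine (Set.finite_lt_nat (M + 1)).eventually_all.2 fun k hk => ?_
    have hU : ∀ᶠ r in 𝓝 (z k), (k < M → r < c k) ∧ (∀ l < M, k = l + 1 → c' l < r) := by
      refine Eventually.and ?_ ?_
      · by_cases hkM : k < M
        · filter_upwards [eventually_lt_nhds (hc1 k hkM)] with r hr _ using hr
        · exact Eventually.of_forall fun r h => absurd h hkM
      · rcases k with _ | k
        · exact Eventually.of_forall fun r l _ h => absurd h (by omega)
        · have hkM : k < M := Nat.lt_of_succ_lt_succ hk
          filter_upwards [eventually_gt_nhds (hc4 k hkM)] with r hr l _ hl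
          obtain rfl : k = l := by omega
          exact hr
    obtain ⟨a, b, hab, hb, h⟩ := exists_Ioo_reach_eq_one hG e₀ hreg hsim hone
      (hz k (Nat.le_of_lt_succ hk)) hU n
    filter_upwards [eventually_exists_grid_Ioo hab hb] with N ⟨i, hi, h1, h2⟩
    obtain ⟨⟨h3, h4⟩, h5⟩ := h _ h1 h2
    exact ⟨i, hi, h3, h4, h5⟩
  have hσ : ∀ᶠ N in atTop, ∀ k < M, ∃ i ≤ N, c k < gridTime N i ∧ gridTime N i < c' k ∧
      reach (hG.treeData e₀) (openInd X (gridTime N i)) n ρ ω ≠ 1 := by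
    refine (Set.finite_lt_nat M).eventually_all.2 fun k hk => ?_
    have hU : ∀ᶠ r in 𝓝 (s k), c k < r ∧ r < c' k ∧
        reach (hG.treeData e₀) (openInd X r) n ρ ω ≠ 1 := by
      filter_upwards [hn k hk, eventually_gt_nhds (hc2 k hk), eventually_lt_nhds (hc3 k hk)]
        with r h1 h2 h3 using ⟨h2, h3, h1⟩
    obtain ⟨a, ha, h⟩ := exists_Ioo_left (lt_of_le_of_lt (zero_le) (hs k hk).2.1)
      (nhdsWithin_le_nhds hU)
    filter_upwards [eventually_exists_grid_Ioo ha (hs1 k hk)] with N ⟨i, hi, h1, h2⟩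
    exact ⟨i, hi, h _ h1 h2⟩
  filter_upwards [hτ, hσ] with N hτ hσ
  choose! τ hτN hτ1 hτ2 hτ3 using hτ
  choose! r hrN hr1 hr2 hr3 using hσ
  have hlt : ∀ {i j}, gridTime N i < gridTime N j → i ≤ j := fun h =>
    ((gridTime_mono N).reflect_lt h).le
  refine le_sum_abs_sub
    (f := fun i => reach (hG.treeData e₀) (openInd X (gridTime N i)) n ρ ω)
    (τ := τ) (s := r) (fun k hk => hlt ((hτ1 k (by omega) hk).trans (hr1 k hk)))
    (fun k hk => hlt ((hr2 k hk).trans (hτ2 (k + 1) (by omega) k hk rfl)))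
    (hτN M (by omega)) fun k hk => ?_
  have h0 := (reach_zero_or_one (T := hG.treeData e₀) (isConfig_openInd X (gridTime N (r k)))
    n ρ ω).resolve_right (hr3 k hk)
  rw [h0, hτ3 k (by omega)]
  norm_num

lemma measure_le_gridVariation_le [MeasurableSpace Ω] {P : Measure Ω} [IsProbabilityMeasure P]
    {p : ℕ → I}
    (hG : IsSphericallySymmetricTree G ρ d) (e₀ : G.edgeSet)
    (hX : IsDynamicalPercolation G (edgeProb G ρ p) P X) {ε : ℝ} (hε : 0 < ε)
    (hp : ∀ n, (p (n + 1) : ℝ) ≤ 1 - ε) (hp01 : ∀ j, 0 < (p (j + 1) : ℝ) ∧ (p (j + 1) : ℝ) ≤ 1)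
    {C : ℝ} (n : ℕ) (hC : pivotSum d (fun n => (p n : ℝ)) n 0 ≤ C) {N : ℕ} (hN : 1 ≤ N) {M : ℕ}
    (hM : 1 ≤ M) :
    P {ω | (M : ℝ) ≤ gridVariation hG e₀ X n N ω} ≤ ENNReal.ofReal (2 * C / M) := by
  have hD := hX.isDynamics hG e₀ hε hp
  have hN' : (0 : ℝ) < N := by exact_mod_cast hN
  have hM' : (0 : ℝ) < M := by exact_mod_cast hM
  have hb : ∀ i, BddOn (edgeField X) Set.univ fun ω =>
      |reach (hG.treeData e₀) (openInd X (gridTime N (i + 1))) n ρ ω -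
        reach (hG.treeData e₀) (openInd X (gridTime N i)) n ρ ω| := fun i =>
    (((bddOn_reach (isConfig_openInd X _) n ρ).sub
      (bddOn_reach (isConfig_openInd X _) n ρ)).mono (Set.subset_univ _)).abs
  have hnn : ∀ ω, 0 ≤ gridVariation hG e₀ X n N ω := fun ω =>
    Finset.sum_nonneg fun _ _ => abs_nonneg _
  have hint : Integrable (gridVariation hG e₀ X n N) P :=
    (BddOn.sum fun i _ => hb i).integrable hX.edgeField_le
  have hE : ∫ ω, gridVariation hG e₀ X n N ω ∂P ≤ 2 * C := by
    unfold gridVariation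
    rw [integral_finsetSum _ fun i _ => (hb i).integrable hX.edgeField_le]
    calc _ ≤ ∑ i ∈ Finset.range N, 2 / N * C := Finset.sum_le_sum fun i _ => ?_
      _ = 2 * C := by
        rw [Finset.sum_const, Finset.card_range, nsmul_eq_mul]; field_simp
    have h := integral_abs_reach_sub_le (T := hG.treeData e₀) (p := fun n => (p n : ℝ))
      (η := 2 / N) hX.edgeField_le
      hX.iIndep_edgeField (isConfig_openInd X (gridTime N i))
      (isConfig_openInd X (gridTime N (i + 1))) (hD.mean _) (hD.mean _) hp01
      (fun v c hc => by
        have := hD.change _ _ (gridTime_mono N (Nat.le_succ i)) v c hc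
        rw [Nat.succ_eq_add_one, gridTime_succ_sub, mul_one_div] at this
        exact this) n ρ
    have hρ : (hG.treeData e₀).lev ρ = 0 := SimpleGraph.dist_self
    rw [hρ] at h
    simp only [abs_sub_comm (reach _ (openInd X (gridTime N (i + 1))) _ _ _)]
    exact h.trans (by gcongr)
  have := mul_meas_ge_le_integral_of_nonneg (μ := P) (ae_of_all _ hnn) hint M
  rw [← ofReal_measureReal (measure_ne_top P _)]
  refine ENNReal.ofReal_le_ofReal ?_
  rw [le_div_iff₀ hM']
  linarith

/-- If the expected number of pivotal edges stays bounded, then there are almost surely finitely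
many components. -/
lemma ae_finite_components [MeasurableSpace Ω] {P : Measure Ω} [IsProbabilityMeasure P]
    [Countable G.edgeSet] {p : ℕ → I}
    (hG : IsSphericallySymmetricTree G ρ d) (e₀ : G.edgeSet)
    (hX : IsDynamicalPercolation G (edgeProb G ρ p) P X) {ε : ℝ} (hε : 0 < ε)
    (hp : ∀ n, (p (n + 1) : ℝ) ≤ 1 - ε) (hp01 : ∀ j, 0 < (p (j + 1) : ℝ) ∧ (p (j + 1) : ℝ) ≤ 1)
    {C : ℝ} (hC : ∀ n, pivotSum d (fun n => (p n : ℝ)) n 0 ≤ C) :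
    ∀ᵐ ω ∂P, Finite (ConnectedComponents (percolationTimes G ρ X ω)) := by
  have hreg : ∀ᵐ ω ∂P, ∀ e, IsRegularPath fun t => X e t ω :=
    ae_all_iff.2 fun e => (hX.isMarkovChain e).isRegularPath
  have hsim : ∀ᵐ ω ∂P, ∀ e e', e ≠ e' → ∀ t ≤ 1, ContinuousAt (fun s => X e s ω) t ∨
      ContinuousAt (fun s => X e' s ω) t := by
    rw [ae_all_iff]; intro e
    rw [ae_all_iff]; intro e'
    by_cases h : e = e'
    · exact ae_of_all _ fun ω h' => absurd h h'
    · filter_upwards [ae_not_simultaneous (hX.isMarkovChain e) (hX.isMarkovChain e')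
        (hX.indep.indepFun h)] with ω hω _ using hω
  have hone : ∀ᵐ ω ∂P, ∀ e, ContinuousAt (fun s => X e s ω) 1 :=
    ae_all_iff.2 fun e => (hX.isMarkovChain e).ae_continuousAt 1
  set A : Set Ω := {ω | ∀ M : ℕ, ∀ᶠ n in atTop, ∀ᶠ N in atTop,
    (M : ℝ) ≤ gridVariation hG e₀ X n N ω} with hA
  have hA0 : P A = 0 := by
    have hle : ∀ M : ℕ, 1 ≤ M → P A ≤ ENNReal.ofReal (2 * C / M) := by
      intro M hM
      refine le_trans (measure_mono (show A ⊆ {ω | ∀ᶠ n in atTop, ω ∈ {ω | ∀ᶠ N in atTop,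
        ω ∈ {ω | (M : ℝ) ≤ gridVariation hG e₀ X n N ω}}} from fun ω hω => hω M)) ?_
      refine measure_eventually_mem_le (Eventually.of_forall fun n => ?_)
      refine measure_eventually_mem_le ?_
      filter_upwards [eventually_ge_atTop 1] with N hN
      exact measure_le_gridVariation_le hG e₀ hX hε hp hp01 n (hC n) hN hM
    have hlim : Tendsto (fun M : ℕ => ENNReal.ofReal (2 * C / M)) atTop (𝓝 0) := by
      rw [← ENNReal.ofReal_zero]
      exact ENNReal.tendsto_ofReal (tendsto_const_div_atTop_nhds_zero_nat (2 * C))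
    refine le_antisymm (ge_of_tendsto hlim ?_) zero_le
    filter_upwards [eventually_ge_atTop 1] with M hM using hle M hM
  have hnot : ∀ᵐ ω ∂P, ω ∉ A := measure_eq_zero_iff_ae_notMem.1 hA0
  filter_upwards [hreg, hsim, hone, hnot] with ω h1 h2 h3 h4
  by_contra hfin
  rw [not_finite_iff_infinite] at hfin
  exact h4 fun M => eventually_le_gridVariation hG e₀ h1 h2 h3 hfin M

end

section
variable {V : Type*} {G : SimpleGraph V} {ρ : V} {d : ℕ → ℕ}

/-! ### Static percolation -/

instance (q : G.edgeSet → I) : IsProbabilityMeasure (percolationMeasure G q) := by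
  unfold percolationMeasure; infer_instance

lemma percolationMeasure_real_forall_open (q : G.edgeSet → I) (s : Finset G.edgeSet) :
    (percolationMeasure G q).real {η | ∀ e ∈ s, η e = true} = ∏ e ∈ s, (q e : ℝ) := by
  have e : {η : G.edgeSet → Bool | ∀ e ∈ s, η e = true} = Set.pi s fun _ => {true} := by
    ext η; simp [Set.mem_pi]
  rw [measureReal_def, e, percolationMeasure,
    Measure.infinitePi_pi _ fun e _ => measurableSet_singleton true, ENNReal.toReal_prod]
  refine Finset.prod_congr rfl fun e _ => ?_
  rw [← measureReal_def, bernoulli_real_singleton]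
  simp [edgeLaw]

namespace IsSphericallySymmetricTree

lemma percolationMeasure_real_path (hG : IsSphericallySymmetricTree G ρ d) (e₀ : G.edgeSet)
    (q : G.edgeSet → I) {u : V} {k : ℕ} (hk : k ≤ G.dist ρ u) :
    (percolationMeasure G q).real
      {η | ∀ i < k, parentEdge G ρ e₀ ((parent G ρ)^[i] u) ∈ openEdges η} =
      ∏ i ∈ Finset.range k, (q (parentEdge G ρ e₀ ((parent G ρ)^[i] u)) : ℝ) := by
  classical
  have hlev : ∀ i < k, G.dist ρ ((parent G ρ)^[i] u) + i = G.dist ρ u := fun i hi =>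
    dist_iterate_parent hG.isTree (by omega)
  have hinj : Set.InjOn (fun i => parentEdge G ρ e₀ ((parent G ρ)^[i] u)) (Finset.range k) := by
    intro i hi j hj h
    have hi' := hlev i (by simpa using hi)
    have hj' := hlev j (by simpa using hj)
    have hik : i < k := by simpa using hi
    have hjk : j < k := by simpa using hj
    have := parentEdge_injOn hG.isTree e₀ (ne_root_of_dist_pos (G := G) (by omega))
      (ne_root_of_dist_pos (G := G) (by omega)) h
    rw [this] at hi'
    omega
  rw [← Finset.prod_image (f := fun e => (q e : ℝ)) hinj, ← percolationMeasure_real_forall_open]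
  congr 1
  ext η
  simp [openEdges]

/-- The vertices at level `n`. -/
noncomputable def level (hG : IsSphericallySymmetricTree G ρ d) (n : ℕ) : Finset V :=
  (hG.finite_level n).toFinset

lemma mem_level (hG : IsSphericallySymmetricTree G ρ d) {n : ℕ} {v : V} :
    v ∈ hG.level n ↔ G.dist ρ v = n := by
  simp [level]

lemma card_level (hG : IsSphericallySymmetricTree G ρ d) (n : ℕ) :
    (hG.level n).card = ∏ i ∈ Finset.range n, d i := by
  classical
  induction n with
  | zero =>
    rw [Finset.range_zero, Finset.prod_empty, Finset.card_eq_one]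
    refine ⟨ρ, ?_⟩
    ext v
    rw [hG.mem_level, Finset.mem_singleton]
    exact ⟨eq_root_of_dist_eq_zero hG.isTree, fun h => by rw [h, SimpleGraph.dist_self]⟩
  | succ n ih =>
    have e : hG.level (n + 1) = (hG.level n).biUnion hG.children := by
      ext v
      rw [hG.mem_level, Finset.mem_biUnion]
      constructor
      · intro h
        have h1 := parent_spec hG.isTree (ne_root_of_dist_pos (G := G) (ρ := ρ) (v := v) (by omega))
        exact ⟨parent G ρ v, hG.mem_level.2 (by omega), hG.mem_children.2 ⟨h1.1, h1.2.symm⟩⟩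
      · rintro ⟨u, hu, hv⟩
        rw [(hG.mem_children.1 hv).2, hG.mem_level.1 hu]
    rw [e, Finset.card_biUnion, Finset.prod_range_succ, ← ih, Finset.sum_congr rfl fun u hu => ?_,
      Finset.sum_const, smul_eq_mul]
    · rw [hG.card_children, hG.mem_level.1 hu]
    · intro u _ u' _ hne
      rw [Function.onFun, Finset.disjoint_left]
      intro v hv hv'
      exact hne ((hG.mem_children_iff.1 hv).2.symm.trans (hG.mem_children_iff.1 hv').2)

lemma meanLevelCount_eq [Nonempty G.edgeSet] (hG : IsSphericallySymmetricTree G ρ d) (p : ℕ → I)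
    (n : ℕ) :
    meanLevelCount G ρ p n = meanSize d (fun n => (p n : ℝ)) n := by
  classical
  have e₀ : G.edgeSet := Classical.arbitrary _
  have hset : ∀ u : V, G.dist ρ u = n → {η : G.edgeSet → Bool | u ∈ cluster G (openEdges η) ρ} =
      {η | ∀ i < n, parentEdge G ρ e₀ ((parent G ρ)^[i] u) ∈ openEdges η} := by
    intro u hu
    ext η
    simp only [Set.mem_ofPred_eq]
    rw [mem_cluster_root_iff hG.isTree e₀, hu]
  have hmeas : ∀ u : V, G.dist ρ u = n →
      MeasurableSet {η : G.edgeSet → Bool | u ∈ cluster G (openEdges η) ρ} := by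
    intro u hu
    rw [hset u hu]
    simp only [openEdges, Set.mem_ofPred_eq, Set.ofPred_forall]
    exact MeasurableSet.iInter fun i => MeasurableSet.iInter fun _ =>
      measurable_pi_apply (X := fun _ : G.edgeSet => Bool)
        (parentEdge G ρ e₀ ((parent G ρ)^[i] u)) (measurableSet_singleton true)
  have hcount : ∀ η : G.edgeSet → Bool, (levelCount G ρ (openEdges η) n : ℝ) =
      ∑ u ∈ hG.level n, if u ∈ cluster G (openEdges η) ρ then (1 : ℝ) else 0 := by
    intro η
    have e : {x | G.dist ρ x = n ∧ x ∈ cluster G (openEdges η) ρ} =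
        ((hG.level n).filter fun u => u ∈ cluster G (openEdges η) ρ : Finset V) := by
      ext x; simp [hG.mem_level]
    rw [levelCount, e, Set.ncard_coe_finset, Finset.card_filter]
    push_cast
    rfl
  rw [meanLevelCount]
  simp only [hcount]
  rw [integral_finsetSum]
  · have hterm : ∀ u ∈ hG.level n, ∫ η, (if u ∈ cluster G (openEdges η) ρ then (1 : ℝ) else 0)
        ∂(percolationMeasure G (edgeProb G ρ p)) = ∏ i ∈ Finset.range n, (p (i + 1) : ℝ) := by
      intro u hu
      rw [hG.mem_level] at hu
      rw [integral_ite_one (hmeas u hu), hset u hu,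
        hG.percolationMeasure_real_path e₀ _ hu.ge, ← Finset.prod_range_reflect]
      refine Finset.prod_congr rfl fun i hi => ?_
      have hi' := Finset.mem_range.1 hi
      have h1 := dist_iterate_parent hG.isTree (ρ := ρ) (v := u) (k := n - 1 - i) (by omega)
      rw [edgeProb, edgeLevel_parentEdge hG.isTree e₀ (ne_root_of_dist_pos (G := G) (by omega))]
      congr 2
      omega
    rw [Finset.sum_congr rfl hterm, Finset.sum_const, hG.card_level, nsmul_eq_mul, meanSize,
      Finset.prod_mul_distrib]
    push_cast
    rfl
  · intro u hu
    exact (integrable_const (1 : ℝ)).mono'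
      (Measurable.ite (hmeas u (hG.mem_level.1 hu)) measurable_const
        measurable_const).aestronglyMeasurable
      (ae_of_all _ fun η => by split_ifs <;> simp)

/-! ### Homogeneous trees -/

lemma exists_open_path_of_infinite_cluster (hG : IsSphericallySymmetricTree G ρ d)
    (e₀ : G.edgeSet) {O : Set G.edgeSet} {x : V} (h : (cluster G O x).Infinite) (m : ℕ) :
    ∃ u ∈ hG.level (G.dist ρ x + m), ∀ i < m, parentEdge G ρ e₀ ((parent G ρ)^[i] u) ∈ O := by
  set O' : Set G.edgeSet := O ∪ {e | edgeLevel G ρ e ≤ G.dist ρ x} with hO'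
  have hx : x ∈ cluster G O' ρ := by
    rw [mem_cluster_root_iff hG.isTree e₀]
    intro k hk
    have h1 := dist_iterate_parent hG.isTree (ρ := ρ) (v := x) hk.le
    refine Or.inr ?_
    change edgeLevel G ρ _ ≤ _
    rw [edgeLevel_parentEdge hG.isTree e₀ (ne_root_of_dist_pos (G := G) (by omega))]
    omega
  have hle : openSubgraph G O ≤ openSubgraph G O' :=
    SimpleGraph.fromEdgeSet_mono (Set.image_mono Set.subset_union_left)
  have hsub : cluster G O x ⊆ cluster G O' ρ := fun y hy =>
    SimpleGraph.Reachable.trans hx (SimpleGraph.Reachable.mono hle hy)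
  obtain ⟨u, hu, hun⟩ := (hG.infinite_cluster_iff e₀ O').1 (h.mono hsub) (G.dist ρ x + m)
  refine ⟨u, hG.mem_level.2 hun, fun i hi => ?_⟩
  rw [mem_cluster_root_iff hG.isTree e₀] at hu
  have h1 := dist_iterate_parent hG.isTree (ρ := ρ) (v := u) (k := i) (by omega)
  refine (hu i (by omega)).resolve_right fun h2 => ?_
  change edgeLevel G ρ _ ≤ _ at h2
  rw [edgeLevel_parentEdge hG.isTree e₀ (ne_root_of_dist_pos (G := G) (by omega))] at h2
  omega

lemma measureReal_infinite_cluster_le (hG : IsSphericallySymmetricTree G ρ d)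
    (e₀ : G.edgeSet) (q : I) (x : V) (m : ℕ) :
    (percolationMeasure G fun _ => q).real {η | (cluster G (openEdges η) x).Infinite} ≤
      (∏ i ∈ Finset.range (G.dist ρ x + m), (d i : ℝ)) * (q : ℝ) ^ m := by
  have hsub : {η | (cluster G (openEdges η) x).Infinite} ⊆ ⋃ u ∈ hG.level (G.dist ρ x + m),
      {η | ∀ i < m, parentEdge G ρ e₀ ((parent G ρ)^[i] u) ∈ openEdges η} := by
    intro η hη
    obtain ⟨u, hu, h⟩ := hG.exists_open_path_of_infinite_cluster e₀ hη m
    simp only [Set.mem_iUnion]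
    exact ⟨u, hu, h⟩
  refine (measureReal_mono hsub (measure_ne_top _ _)).trans ((measureReal_biUnion_finset_le _ _).trans ?_)
  rw [Finset.sum_congr rfl fun u hu => hG.percolationMeasure_real_path e₀ (fun _ => q) (k := m)
    (by rw [hG.mem_level.1 hu]; omega)]
  simp [hG.card_level]

lemma one_lt_of_criticalProbability_lt [Infinite V] (hG : IsSphericallySymmetricTree G ρ d)
    (hd : ∀ j, d (j + 1) = d 1) {p : I} (h : criticalProbability G < p) : 1 < (d 1 : ℝ) * p := by
  by_contra! hle
  have hcount := hG.countable
  obtain ⟨e₀⟩ := hG.nonempty_edgeSet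
  have hd1 : (1 : ℝ) ≤ d 1 := by exact_mod_cast hG.one_le_degree 1
  refine absurd h (not_lt.2 (le_of_forall_lt fun q hq => ?_))
  obtain ⟨q', hqq', hq'⟩ := exists_between hq
  refine hqq'.trans_le (le_sSup ?_)
  have hq1 : (d 1 : ℝ) * q' < 1 := by
    have : (q' : ℝ) < p := hq'
    nlinarith
  have hq0 := q'.2.1
  change ∀ᵐ η ∂(percolationMeasure G fun _ => q'), ¬ ∃ x, (cluster G (openEdges η) x).Infinite
  simp only [not_exists]
  rw [ae_all_iff]
  intro x
  have hzero : (percolationMeasure G fun _ => q').real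
      {η | (cluster G (openEdges η) x).Infinite} ≤ 0 := by
    have hlim : Tendsto (fun m : ℕ => (∏ i ∈ Finset.range (G.dist ρ x), (d i : ℝ)) * d 0 *
        ((d 1 : ℝ) * q') ^ m) atTop (𝓝 0) := by
      have := (tendsto_pow_atTop_nhds_zero_of_lt_one (by positivity) hq1).const_mul
        ((∏ i ∈ Finset.range (G.dist ρ x), (d i : ℝ)) * d 0)
      rwa [mul_zero] at this
    refine ge_of_tendsto' hlim fun m => ?_
    refine (hG.measureReal_infinite_cluster_le e₀ q' x m).trans ?_
    rw [Finset.prod_range_add, mul_pow, ← mul_assoc, mul_assoc _ _ ((d 1 : ℝ) ^ m)]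
    have hd0 : (1 : ℝ) ≤ d 0 := by exact_mod_cast hG.one_le_degree 0
    have : ∀ k : ℕ, (d k : ℝ) ≤ (if k = 0 then (d 0 : ℝ) else 1) * d 1 := by
      intro k
      rcases k with _ | k
      · simp only [if_true]; nlinarith
      · rw [hd k]; simp
    have hprod : ∏ i ∈ Finset.range m, (d (G.dist ρ x + i) : ℝ) ≤ d 0 * (d 1 : ℝ) ^ m := by
      calc ∏ i ∈ Finset.range m, (d (G.dist ρ x + i) : ℝ)
          ≤ ∏ i ∈ Finset.range m, ((if i = 0 then (d 0 : ℝ) else 1) * d 1) := by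
            refine Finset.prod_le_prod (fun _ _ => Nat.cast_nonneg _) fun i _ => ?_
            refine (this _).trans ?_
            gcongr
            split_ifs with h1 h2 h2
            · exact le_rfl
            · omega
            · exact hd0
            · exact le_rfl
        _ ≤ _ := by
          rw [Finset.prod_mul_distrib, Finset.prod_const, Finset.card_range]
          gcongr
          rw [Finset.prod_ite_eq']
          split_ifs
          · exact le_rfl
          · exact hd0
    gcongr
  have hz : (percolationMeasure G fun _ => q') {η | (cluster G (openEdges η) x).Infinite} = 0 := by
    rw [← measureReal_eq_zero_iff (measure_ne_top _ _)]
    exact le_antisymm hzero measureReal_nonneg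
  exact measure_eq_zero_iff_ae_notMem.1 hz

end IsSphericallySymmetricTree

end

lemma summable_mul_inv_meanSize_of_one_lt {d : ℕ → ℕ} {p : ℕ → ℝ} (hd : ∀ j, d (j + 1) = d 1)
    (hp : ∀ j, p (j + 1) = p 1) (h : 1 < (d 1 : ℝ) * p 1) :
    Summable fun k : ℕ => (k : ℝ) * (meanSize d p k)⁻¹ := by
  have hr0 : 0 < (d 1 : ℝ) * p 1 := by linarith
  have hr : ‖((d 1 : ℝ) * p 1)⁻¹‖ < 1 := by
    rw [norm_inv, Real.norm_of_nonneg hr0.le]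
    exact inv_lt_one_of_one_lt₀ h
  have hs := (summable_pow_mul_geometric_of_norm_lt_one 1 hr).mul_left
    (((d 0 : ℝ) * p 1)⁻¹ * ((d 1 : ℝ) * p 1))
  refine hs.congr fun k => ?_
  rcases k with _ | k
  · simp
  · have e : meanSize d p (k + 1) = ((d 1 : ℝ) * p 1) ^ k * (d 0 * p 1) := by
      rw [meanSize, Finset.prod_range_succ']
      congr 1
      rw [Finset.prod_congr rfl fun i _ => by rw [hd i, hp (i + 1)], Finset.prod_const,
        Finset.card_range]
    have hd1 : (d 1 : ℝ) ≠ 0 := fun h0 => by simp [h0] at hr0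
    rw [e, mul_inv, pow_one, inv_pow, pow_succ]
    field_simp

end DynPerc

theorem theorem1p3 {V Ω : Type*} [Infinite V] [MeasurableSpace Ω]
    (G : SimpleGraph V) (ρ : V) (d : ℕ → ℕ) (p : ℕ → I) (P : Measure Ω) [IsProbabilityMeasure P]
    (X : G.edgeSet → ℝ≥0 → Ω → Bool)
    (hG : DynPerc.IsSphericallySymmetricTree G ρ d)
    (hp : ∃ ε : ℝ, 0 < ε ∧ ∀ n : ℕ, ε ≤ (p (n + 1) : ℝ) ∧ (p (n + 1) : ℝ) ≤ 1 - ε)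
    (hX : DynPerc.IsDynamicalPercolation G (DynPerc.edgeProb G ρ p) P X) :
    -- (i) finitely many components, almost surely
    ((Summable fun k : ℕ => (k : ℝ) * (DynPerc.meanLevelCount G ρ p k)⁻¹) →
      ∀ᵐ ω ∂P, Finite (ConnectedComponents (DynPerc.percolationTimes G ρ X ω))) ∧
    -- (i) the two classes of examples for the hypothesis
    (∀ θ : ℝ, 2 < θ → (DynPerc.meanLevelCount G ρ p =Θ[atTop] fun k : ℕ => (k : ℝ) ^ θ) →
      Summable fun k : ℕ => (k : ℝ) * (DynPerc.meanLevelCount G ρ p k)⁻¹) ∧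
    ((∀ j : ℕ, d (j + 1) = d 1) → (∀ n : ℕ, p (n + 1) = p 1) →
      DynPerc.criticalProbability G < p 1 →
      Summable fun k : ℕ => (k : ℝ) * (DynPerc.meanLevelCount G ρ p k)⁻¹) ∧
    -- (ii) infinitely many components, with positive probability
    (BddAbove (Set.range d) → ∀ θ : ℝ,
      ((1 < θ ∧ θ < 2 ∧ DynPerc.meanLevelCount G ρ p =Θ[atTop] fun k : ℕ => (k : ℝ) ^ θ) ∨
        (1 < θ ∧ DynPerc.meanLevelCount G ρ p =Θ[atTop]
          fun k : ℕ => (k : ℝ) * (Real.log k) ^ θ)) →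
      0 < P {ω | Infinite (ConnectedComponents (DynPerc.percolationTimes G ρ X ω))}) := by
  obtain ⟨ε, hε, hpε⟩ := hp
  have hε1 : ε < 1 := by have := hpε 0; linarith
  have hp01 : ∀ j, 0 < (p (j + 1) : ℝ) ∧ (p (j + 1) : ℝ) ≤ 1 := fun j =>
    ⟨hε.trans_le (hpε j).1, (p (j + 1)).2.2⟩
  have hd := hG.one_le_degree
  have := hG.nonempty_edgeSet
  have := hG.countable_edgeSet
  have e₀ : G.edgeSet := Classical.arbitrary _
  have hw : DynPerc.meanLevelCount G ρ p = DynPerc.meanSize d fun n => (p n : ℝ) :=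
    funext fun n => hG.meanLevelCount_eq p n
  have hpos : ∀ n, 0 < DynPerc.meanSize d (fun n => (p n : ℝ)) n :=
    DynPerc.meanSize_pos hd hp01
  rw [hw]
  refine ⟨fun hs => ?_, fun θ hθ h => DynPerc.summable_mul_inv_of_isTheta_rpow hθ h,
    fun hd1 hp1 hc => ?_, fun hbdd θ hθ => ?_⟩
  · refine DynPerc.ae_finite_components hG e₀ hX hε (fun n => (hpε n).2) hp01 fun n =>
      (DynPerc.pivotSum_le hd hp01 n).trans (hs.sum_le_tsum _ fun i _ => ?_)
    exact mul_nonneg (Nat.cast_nonneg i) (inv_nonneg.2 (hpos i).le)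
  · exact DynPerc.summable_mul_inv_meanSize_of_one_lt hd1 (fun j => by rw [hp1 j])
      (hG.one_lt_of_criticalProbability_lt hd1 hc)
  · obtain ⟨D, hD⟩ := hbdd
    have hD' : ∀ j, d j ≤ D := fun j => hD ⟨j, rfl⟩
    have hgrowth : DynPerc.SubquadraticGrowth (DynPerc.meanSize d fun n => (p n : ℝ)) := by
      rcases hθ with ⟨h1, h2, h⟩ | ⟨h1, h⟩
      · exact .of_isTheta_rpow hpos h1 h2 h
      · exact .of_isTheta_log hpos h1 h
    obtain ⟨⟨c, hc, hlow⟩, ha, hsum⟩ :=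
      DynPerc.pivotWeight_bounds hd hD' hε hε1 hp01 (fun n => (hpε n).2) hgrowth
    obtain ⟨c₀, hc₀, h⟩ := DynPerc.exists_le_real_card_cellCount hD' hε hε1
      (hX.isDynamics hG e₀ hε fun n => (hpε n).2) hX.edgeField_le hX.iIndep_edgeField hp01
      (fun n => (hpε n).2) hc hlow ha hsum (ρ := ρ) SimpleGraph.dist_self
    exact DynPerc.measure_infinite_components_pos hG e₀ hX hc₀ h
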